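/- **Theorem 2.2.** Let $\nu\in\mathbf N$, let $m_1\le m_2\le\dots\le m_{\nu+1}$ be natural numbers, let $n=m_1+\dots+m_\nu$, $m=m_{\nu+1}$, and let $t_0<t_1<T$. Consider the control system $\dot x=f(t,x,u)$, $t\in[t_0,T]$, with state $x=(x_1,\dots,x_\nu)\in\mathbf R^{m_1}\times\dots\times\mathbf R^{m_\nu}=\mathbf R^n$ and control $u=x_{\nu+1}\in\mathbf R^m$, whose right-hand side has the triangular form $$f(t,x,u)=\bigl(f_1(t,x_1,x_2),\,f_2(t,x_1,x_2,x_3),\,\dots,\,f_\nu(t,x_1,\dots,x_\nu,u)\bigr),\qquad f_i(t,x_1,\dots,x_{i+1})\in\mathbf R^{m_i}.$$ Assume: (I) $f$, $\partial f/\partial x$ and $\partial f/\partial u$ exist and are continuous on $[t_0,T]\times\mathbf R^n\times\mathbf R^m$. (II) For each $i=1,\dots,\nu$ and each $(t,x_1,\dots,x_i)\in[t_0,T]\times\mathbf R^{m_1}\times\dots\times\mathbf R^{m_i}$, the map $f_i(t,x_1,\dots,x_i,\cdot)$ is of class $C^{m_{i+1}-m_i+1}(\mathbf R^{m_{i+1}};\mathbf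 R^{m_i})$ and is onto $\mathbf R^{m_i}$. Let $x_i^*\in\mathbf R^{m_i}$ ($1\le i\le\nu+1$) and $z_i^*\in\mathbf R^{m_i}$ ($1\le i\le\nu$) satisfy $$z_i^*=f_i(t_1,x_1^*,\dots,x_{i+1}^*),\qquad \operatorname{rank}\frac{\partial f_i}{\partial x_{i+1}}(t_1,x_1^*,\dots,x_{i+1}^*)=m_i,\qquad i=1,\dots,\nu,$$ and let $z_{\nu+1}^*\in\mathbf R^{m_{\nu+1}}$ be arbitrary. Let $p\in\{1,\dots,\nu\}$, $k=m_1+\dots+m_p$, $y^*=(x_1^*,\dots,x_p^*)\in\mathbf R^k$, $J=[t_1,T]$, and consider the $k$-dimensional control system $$\dot y(t)=\varphi(t,y(t),v(t)),\quad t\in J,\qquad \varphi(t,x_1,\dots,x_p,v)=\bigl(f_1(t,x_1,x_2),\dots,f_{p-1}(t,x_1,\dots,x_p),\,f_p(t,x_1,\dots,x_p,v)\bigr),\tag{$*$}$$ with state $y=(x_1,\dots,x_p)\in\mathbf R^k$ and control $v\in\mathbf R^{m_{p+1}}$. Suppose that there is a family $\{y(\xi,\cdot)=(x_1(\xi,\cdot),\dots,x_p(\xi,\cdot))\}_{\xi\in\mathbf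 R^k}$ of functions $J\to\mathbf R^k$ such that: 1) for each $i=1,\dots,p$ the map $\xi\mapsto x_i(\xi,\cdot)$ is of class $C(\mathbf R^k;C^1(J;\mathbf R^{m_i}))$; 2) for each $\xi\in\mathbf R^k$, $\dot x_i(\xi,t)=f_i(t,x_1(\xi,t),\dots,x_{i+1}(\xi,t))$ for all $1\le i\le p-1$ and $t\in J$; 3) for each $\xi\in\mathbf R^k$, $y(\xi,t_1)=y^*$, $y(\xi,T)=\xi$ and $\dot x_p(\xi,t_1)=z_p^*$. Then there is a family of controls $\{\hat v_{(\xi,\beta)}\}_{(\xi,\beta)\in\mathbf R^k\times\mathbf R^{m_{p+1}}}$ such that: 4) the map $(\xi,\beta)\mapsto\hat v_{(\xi,\beta)}$ is of class $C(\mathbf R^k\times\mathbf R^{m_{p+1}};C^1(J;\mathbf R^{m_{p+1}}))$; 5) for each $(\xi,\beta)$, $\hat v_{(\xi,\beta)}(T)=\beta$, $\hat v_{(\xi,\beta)}(t_1)=x_{p+1}^*$ and $\frac{d}{dt}\hat v_{(\xi,\beta)}(t_1)=z_{p+1}^*$; 6) for each $(\xi,\beta)$, the trajectory of $(*)$ with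 control $\hat v_{(\xi,\beta)}$ that starts at $y^*$ at time $t_1$ is defined on all of $J$ and equals $\xi$ at time $T$. -/

import Mathlib

open Set Filter Topology

namespace TriangularControl

/-- The `i`-th block space `ℝ^{m i}`, with the Euclidean norm.  Blocks are numbered from `0`, so that
`Block m 0` is the space of the block usually written `x₁`. -/
abbrev Block (m : ℕ → ℕ) (i : ℕ) : Type := EuclideanSpace ℝ (Fin (m i))

/-- Tuples of the first `r` blocks: `ℝ^{m 0} × ⋯ × ℝ^{m (r-1)}`, i.e. `ℝ^{m 0 + ⋯ + m (r-1)}`.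
Only the topology and the linear structure of this finite-dimensional space are used. -/
abbrev State (m : ℕ → ℕ) (r : ℕ) : Type := (i : Fin r) → Block m i

/-- The first `r` blocks of a tuple of `s ≥ r` blocks. -/
def trunc {m : ℕ → ℕ} {r s : ℕ} (h : r ≤ s) (x : State m s) : State m r :=
  fun j => x (Fin.castLE h j)

/-- The tuple `(x, v)`: one more block is appended to a tuple of `r` blocks. -/
def extend {m : ℕ → ℕ} {r : ℕ} (x : State m r) (v : Block m r) : State m (r + 1) :=
  Fin.snoc (α := fun j : Fin (r + 1) => Block m j) x v

/-- The triangular right-hand side with `r` blocks built from the components `f i`, where `f i`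
depends on `t` and on the blocks `0, …, i + 1` only: its `i`-th block is `f i (t, x₀, …, x_{i+1})`,
and the role of block number `r` is played by the control `v`. -/
def field {m : ℕ → ℕ} (f : (i : ℕ) → ℝ → State m (i + 2) → Block m i) (r : ℕ)
    (t : ℝ) (y : State m r) (v : Block m r) : State m r :=
  fun i => f i t (trunc (by have := i.2; omega) (extend y v))

/-- The full right-hand side (with `ν` blocks) and its partial derivatives with respect to the
state and the control exist and are continuous in `(t, x, u)`, `t ∈ [t₀, T]`. -/
structure RegularField {m : ℕ → ℕ} (ν : ℕ) (f : (i : ℕ) → ℝ → State m (i + 2) → Block m i)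
    (t₀ T : ℝ) : Prop where
  continuousOn :
    ContinuousOn (fun q : ℝ × State m ν × Block m ν => field f ν q.1 q.2.1 q.2.2)
      (Icc t₀ T ×ˢ univ)
  differentiable_state : ∀ t ∈ Icc t₀ T, ∀ (x : State m ν) (u : Block m ν),
    DifferentiableAt ℝ (fun x' => field f ν t x' u) x
  continuousOn_fderiv_state :
    ContinuousOn (fun q : ℝ × State m ν × Block m ν =>
      fderiv ℝ (fun x' => field f ν q.1 x' q.2.2) q.2.1) (Icc t₀ T ×ˢ univ)
  differentiable_control : ∀ t ∈ Icc t₀ T, ∀ (x : State m ν) (u : Block m ν),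
    DifferentiableAt ℝ (fun u' => field f ν t x u') u
  continuousOn_fderiv_control :
    ContinuousOn (fun q : ℝ × State m ν × Block m ν =>
      fderiv ℝ (fun u' => field f ν q.1 q.2.1 u') q.2.2) (Icc t₀ T ×ˢ univ)

/-- Each `f i (t, x₀, …, x_i, ·)` is of class `C^{m (i+1) - m i + 1}` and maps `ℝ^{m (i+1)}` onto
`ℝ^{m i}`. -/
def SurjectiveBlocks {m : ℕ → ℕ} (ν : ℕ) (f : (i : ℕ) → ℝ → State m (i + 2) → Block m i)
    (t₀ T : ℝ) : Prop :=
  ∀ i < ν, ∀ t ∈ Icc t₀ T, ∀ x : State m (i + 1),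
    ContDiff ℝ ((m (i + 1) - m i + 1 : ℕ) : WithTop ℕ∞) (fun v => f i t (extend x v)) ∧
    Function.Surjective (fun v : Block m (i + 1) => f i t (extend x v))

/-- `ξ ↦ g ξ` is a continuous map into the Banach space `C¹([a, b]; E)`: every `g ξ` is `C¹` on
`[a, b]` (one-sided derivatives at the end points), and `g ξ → g ξ₀`, `(g ξ)' → (g ξ₀)'` uniformly
on `[a, b]` as `ξ → ξ₀`. -/
structure ContinuousC1Family {X E : Type*} [TopologicalSpace X] [NormedAddCommGroup E]
    [NormedSpace ℝ E] (a b : ℝ) (g : X → ℝ → E) : Prop where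
  contDiffOn : ∀ ξ, ContDiffOn ℝ 1 (g ξ) (Icc a b)
  tendsto : ∀ ξ₀, TendstoUniformlyOn g (g ξ₀) (𝓝 ξ₀) (Icc a b)
  tendsto_deriv : ∀ ξ₀, TendstoUniformlyOn (fun ξ => derivWithin (g ξ) (Icc a b))
    (derivWithin (g ξ₀) (Icc a b)) (𝓝 ξ₀) (Icc a b)

/-- `y` is a trajectory, defined on the whole of `[a, b]`, of the system with right-hand side
`field f r` and (continuous) control `v`, and `y` starts at `y₀` at time `a`. -/
structure IsTrajectory {m : ℕ → ℕ} (f : (i : ℕ) → ℝ → State m (i + 2) → Block m i) (r : ℕ)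
    (a b : ℝ) (y₀ : State m r) (v : ℝ → Block m r) (y : ℝ → State m r) : Prop where
  initial : y a = y₀
  ode : ∀ t ∈ Icc a b, HasDerivWithinAt y (field f r t (y t) (v t)) (Icc a b) t

end TriangularControl

/-! The curves `y ξ` already satisfy all equations of the triangular system but the last one,
whose right-hand side is onto in the control. So finitely many constant controls suffice to make,
with weights from a partition of unity, the averaged defect of the last equation along `y ξ`
vanish; chattering rapidly between these values gives a smooth control, continuous in `ξ`, whose
defect has a small integral. Solving the system with this control backwards from `(T, ξ)` keeps
the condition at `T` exact and yields a solution close to `y ξ` down to a time `t₁ + δ`.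

The resulting small error at `t₁ + δ` is corrected on `[t₁, t₁ + δ]`. After time is divided by `δ`
and the blocks are dilated anisotropically, the system along `y ξ` is there a small perturbation
of the linear chain whose arrows are the partial derivatives `∂f i / ∂x (i + 1)` at the reference
point. By the rank condition these arrows are onto, so the chain is controllable, by controls that
vanish near both ends of the interval; a contraction argument carries this over to the perturbed
system, continuously in the parameters. Near `t₁` the control is affine with the prescribed value
and velocity. -/

namespace TriangularControl

section ODE

open Metric
open scoped NNReal

variable {E : Type*} [NormedAddCommGroup E] [NormedSpace ℝ E] {a b : ℝ}

/-- The radial retraction of a normed space onto the closed ball of radius `ρ` around `0`, used to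
replace a vector field that is Lipschitz near a curve by a globally Lipschitz one. -/
noncomputable def radialClamp (ρ : ℝ) (x : E) : E := (ρ / max ρ ‖x‖) • x

theorem radialClamp_of_norm_le {ρ : ℝ} (hρ : 0 < ρ) {x : E} (hx : ‖x‖ ≤ ρ) :
    radialClamp ρ x = x := by
  rw [radialClamp, max_eq_left hx, div_self hρ.ne', one_smul]

theorem norm_radialClamp_le_norm {ρ : ℝ} (hρ : 0 < ρ) (x : E) : ‖radialClamp ρ x‖ ≤ ‖x‖ := by
  have h : 0 < max ρ ‖x‖ := lt_max_of_lt_left hρ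
  rw [radialClamp, norm_smul, Real.norm_of_nonneg (by positivity)]
  exact mul_le_of_le_one_left (norm_nonneg _) ((div_le_one h).2 (le_max_left _ _))

theorem norm_radialClamp_le {ρ : ℝ} (hρ : 0 < ρ) (x : E) : ‖radialClamp ρ x‖ ≤ ρ := by
  have h : 0 < max ρ ‖x‖ := lt_max_of_lt_left hρ
  rw [radialClamp, norm_smul, Real.norm_of_nonneg (by positivity), div_mul_eq_mul_div,
    div_le_iff₀ h]
  exact mul_le_mul_of_nonneg_left (le_max_right _ _) hρ.le

theorem lipschitzWith_radialClamp {ρ : ℝ} (hρ : 0 < ρ) :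
    LipschitzWith 2 (radialClamp ρ : E → E) := by
  refine LipschitzWith.of_dist_le_mul fun x y => ?_
  set α := max ρ ‖x‖
  set β := max ρ ‖y‖
  have hα : 0 < α := lt_max_of_lt_left hρ
  have hβ : 0 < β := lt_max_of_lt_left hρ
  have hαβ : |β - α| ≤ ‖x - y‖ := by
    simp only [α, β, max_comm ρ]
    refine (abs_max_sub_max_le_abs _ _ _).trans ?_
    rw [abs_sub_comm]
    exact abs_norm_sub_norm_le x y
  have hsplit : radialClamp ρ x - radialClamp ρ y
      = (ρ / α) • ((x - y) + ((β - α) / β) • y) := by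
    have h : ρ / β = ρ / α - ρ / α * ((β - α) / β) := by field_simp; ring
    simp only [radialClamp]
    rw [h, smul_add, smul_sub, smul_smul, sub_smul]
    abel
  have hy : ‖((β - α) / β) • y‖ ≤ |β - α| := by
    rw [norm_smul, Real.norm_eq_abs, abs_div, abs_of_pos hβ, div_mul_eq_mul_div]
    exact div_le_of_le_mul₀ hβ.le (abs_nonneg _)
      (mul_le_mul_of_nonneg_left (le_max_right _ _) (abs_nonneg _))
  rw [dist_eq_norm, dist_eq_norm, hsplit, norm_smul, Real.norm_of_nonneg (by positivity)]
  calc ρ / α * ‖(x - y) + ((β - α) / β) • y‖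
      ≤ 1 * (‖x - y‖ + |β - α|) := by
        gcongr
        · exact (div_le_one hα).2 (le_max_left _ _)
        · exact (norm_add_le _ _).trans (by gcongr)
    _ ≤ 2 * ‖x - y‖ := by linarith

theorem hasDerivWithinAt_Ici_of_Icc {x : ℝ → E} {x' : E} {t : ℝ} (ht : t ∈ Ico a b)
    (hx : HasDerivWithinAt x x' (Icc a b) t) : HasDerivWithinAt x x' (Ici t) t :=
  hx.mono_of_mem_nhdsWithin (Icc_mem_nhdsGE_of_mem ht)

theorem exists_primitive_on_Icc [CompleteSpace E] (hab : a ≤ b) {g : ℝ → E}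
    (hg : ContinuousOn g (Icc a b)) (x₀ : E) :
    ∃ w : ℝ → E, w a = x₀ ∧ ∀ t ∈ Icc a b, HasDerivWithinAt w (g t) (Icc a b) t := by
  refine ⟨ODE.picard (fun s _ => g s) a x₀ 0, by simp [ODE.picard], fun t ht => ?_⟩
  exact ODE.hasDerivWithinAt_picard_Icc (f := fun s (_ : E) => g s) (u := univ)
    (left_mem_Icc.2 hab) (hg.comp continuousOn_fst fun _ hq => hq.1) continuousOn_const
    (fun _ _ => mem_univ _) x₀ ht

theorem exists_isIntegralCurveOn_of_lipschitzWith_of_bounded [CompleteSpace E] (hab : a ≤ b)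
    {F : ℝ → E → E} {L M : ℝ≥0} (hF : ∀ x, ContinuousOn (fun t => F t x) (Icc a b))
    (hL : ∀ t ∈ Icc a b, LipschitzWith L (F t)) (hM : ∀ t ∈ Icc a b, ∀ x, ‖F t x‖ ≤ M) (x₀ : E) :
    ∃ x : ℝ → E, x a = x₀ ∧ IsIntegralCurveOn x F (Icc a b) := by
  have hba : 0 ≤ b - a := sub_nonneg.2 hab
  have hPL :
      IsPicardLindelof F (⟨a, left_mem_Icc.2 hab⟩ : Icc a b) x₀ (M * (b - a).toNNReal) 0 M L :=
    ⟨fun t ht => (hL t ht).lipschitzOnWith, fun x _ => hF x, fun t ht x _ => hM t ht x, by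
      simp [hba]⟩
  exact hPL.exists_eq_forall_mem_Icc_hasDerivWithinAt₀

theorem gronwallBound_zero_mul (K ε x : ℝ) :
    gronwallBound 0 K (K * ε) x = ε * (Real.exp (K * x) - 1) := by
  by_cases hK : K = 0
  · simp [hK, gronwallBound_K0]
  · rw [gronwallBound_of_K_ne_0 hK]
    field_simp
    ring

theorem gronwallBound_self_eq_mul (δ K x : ℝ) :
    gronwallBound δ K δ x = δ * gronwallBound 1 K 1 x := by
  by_cases hK : K = 0
  · simp only [hK, gronwallBound_K0]
    ring
  · simp only [gronwallBound_of_K_ne_0 hK]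
    ring

theorem gronwallBound_zero_le {K ε : ℝ} (hK : 0 ≤ K) (hε : 0 ≤ ε) (x : ℝ) :
    gronwallBound 0 K ε x ≤ ε * x * Real.exp (K * x) := by
  rcases hK.eq_or_lt with rfl | hK
  · simp [gronwallBound_K0]
  · have hexp : Real.exp (K * x) - 1 ≤ K * x * Real.exp (K * x) := by
      have h := mul_le_mul_of_nonneg_right (Real.add_one_le_exp (-(K * x)))
        (Real.exp_nonneg (K * x))
      rw [← Real.exp_add, neg_add_cancel, Real.exp_zero] at h
      linarith
    rw [← mul_div_cancel_left₀ ε hK.ne', mul_div_assoc, gronwallBound_zero_mul]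
    calc ε / K * (Real.exp (K * x) - 1) ≤ ε / K * (K * x * Real.exp (K * x)) := by gcongr
      _ = K * (ε / K) * x * Real.exp (K * x) := by ring

/-- Only the primitive of the speed prescribed along `z` has to be close to `z`, not the speed
itself: `z` may be driven by a rapidly oscillating control. -/
theorem norm_sub_le_mul_exp_of_norm_sub_primitive_le {x z w x' w' : ℝ → E} {L : ℝ≥0} {ε : ℝ}
    (hx : ∀ t ∈ Icc a b, HasDerivWithinAt x (x' t) (Icc a b) t)
    (hw : ∀ t ∈ Icc a b, HasDerivWithinAt w (w' t) (Icc a b) t) (ha : x a = w a)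
    (hzw : ∀ t ∈ Icc a b, ‖z t - w t‖ ≤ ε)
    (hL : ∀ t ∈ Icc a b, ‖x' t - w' t‖ ≤ L * ‖x t - z t‖) :
    ∀ t ∈ Icc a b, ‖x t - z t‖ ≤ ε * Real.exp (L * (t - a)) := by
  have htri : ∀ t ∈ Icc a b, ‖x t - z t‖ ≤ ‖x t - w t‖ + ε := fun t ht => by
    rw [← sub_sub_sub_cancel_right (x t) (z t) (w t)]
    exact (norm_sub_le _ _).trans (by gcongr; exact hzw t ht)
  have hxw : ∀ t ∈ Icc a b, ‖x t - w t‖ ≤ gronwallBound 0 L (L * ε) (t - a) := by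
    refine norm_le_gronwallBound_of_norm_deriv_right_le
      (fun t ht => ((hx t ht).sub (hw t ht)).continuousWithinAt)
      (fun t ht => hasDerivWithinAt_Ici_of_Icc ht
        ((hx t (Ico_subset_Icc_self ht)).sub (hw t (Ico_subset_Icc_self ht))))
      (by simp [ha]) fun t ht => ?_
    have ht' := Ico_subset_Icc_self ht
    rw [← mul_add]
    exact (hL t ht').trans (by gcongr; exact htri t ht')
  intro t ht
  have h := hxw t ht
  rw [gronwallBound_zero_mul] at h
  linarith [htri t ht]

theorem exists_isIntegralCurveOn_near [CompleteSpace E] (hab : a ≤ b) {F : ℝ → E → E}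
    (hF : ContinuousOn (Function.uncurry F) (Icc a b ×ˢ univ)) {z w : ℝ → E}
    (hz : ContinuousOn z (Icc a b))
    (hw : ∀ t ∈ Icc a b, HasDerivWithinAt w (F t (z t)) (Icc a b) t)
    {L : ℝ≥0} {ρ ε : ℝ} (hρ : 0 < ρ)
    (hL : ∀ t ∈ Icc a b, LipschitzOnWith L (F t) (closedBall (z t) ρ))
    (hzw : ∀ t ∈ Icc a b, ‖z t - w t‖ ≤ ε) (hε : ε * Real.exp (L * (b - a)) ≤ ρ) :
    ∃ x : ℝ → E, x a = w a ∧ IsIntegralCurveOn x F (Icc a b) ∧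
      ∀ t ∈ Icc a b, ‖x t - z t‖ ≤ ε * Real.exp (L * (b - a)) := by
  have hε0 : 0 ≤ ε := (norm_nonneg _).trans (hzw a (left_mem_Icc.2 hab))
  let ψ : ℝ → E → E := fun t x => z t + radialClamp ρ (x - z t)
  have hψL : ∀ t, LipschitzWith 2 (ψ t) := fun t => LipschitzWith.of_dist_le_mul fun x x' => by
    simpa [ψ] using (lipschitzWith_radialClamp (E := E) hρ).dist_le_mul (x - z t) (x' - z t)
  have hψ : ∀ t x, ψ t x ∈ closedBall (z t) ρ := fun t x => by
    simpa [ψ, mem_closedBall_iff_norm] using norm_radialClamp_le hρ (x - z t)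
  have hFz : ∀ t ∈ Icc a b, ∀ x, ‖F t (ψ t x) - F t (z t)‖ ≤ L * ‖radialClamp ρ (x - z t)‖ :=
    fun t ht x => by
      simpa [ψ] using (hL t ht).norm_sub_le (hψ t x) (mem_closedBall_self hρ.le)
  obtain ⟨C, hC⟩ := isCompact_Icc.exists_bound_of_continuousOn
    (hF.comp (continuousOn_id.prodMk hz) fun t ht => ⟨ht, mem_univ _⟩)
  have hbound : ∀ t ∈ Icc a b, ∀ x, ‖F t (ψ t x)‖ ≤ (L * ρ + C).toNNReal := fun t ht x => by
    refine le_trans ?_ (Real.le_coe_toNNReal _)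
    rw [← sub_add_cancel (F t (ψ t x)) (F t (z t))]
    refine (norm_add_le _ _).trans (add_le_add ((hFz t ht x).trans ?_) (hC t ht))
    gcongr
    exact norm_radialClamp_le hρ _
  obtain ⟨x, hxa, hx⟩ := exists_isIntegralCurveOn_of_lipschitzWith_of_bounded hab
    (F := fun t x => F t (ψ t x)) (L := L * 2)
    (fun x => hF.comp (continuousOn_id.prodMk (hz.add
      ((lipschitzWith_radialClamp hρ).continuous.comp_continuousOn (continuousOn_const.sub hz))))
      fun t ht => ⟨ht, mem_univ _⟩)
    (fun t ht => lipschitzOnWith_univ.1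
      ((hL t ht).comp (hψL t).lipschitzOnWith fun x _ => hψ t x)) hbound (w a)
  have hxz : ∀ t ∈ Icc a b, ‖x t - z t‖ ≤ ε * Real.exp (L * (b - a)) := fun t ht =>
    (norm_sub_le_mul_exp_of_norm_sub_primitive_le hx hw hxa hzw (fun t ht => (hFz t ht _).trans
      (by gcongr; exact norm_radialClamp_le_norm hρ _)) t ht).trans (by gcongr; exact ht.2)
  refine ⟨x, hxa, fun t ht => ?_, hxz⟩
  simpa [ψ, radialClamp_of_norm_le hρ ((hxz t ht).trans hε)] using hx t ht

theorem exists_isIntegralCurveOn_near_of_norm_deriv_sub_le [CompleteSpace E] (hab : a ≤ b)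
    {F : ℝ → E → E} (hF : ContinuousOn (Function.uncurry F) (Icc a b ×ˢ univ)) {z z' : ℝ → E}
    (hz : ∀ t ∈ Icc a b, HasDerivWithinAt z (z' t) (Icc a b) t) {L : ℝ≥0} {ρ ε : ℝ} (hρ : 0 < ρ)
    (hL : ∀ t ∈ Icc a b, LipschitzOnWith L (F t) (closedBall (z t) ρ))
    (hz' : ∀ t ∈ Icc a b, ‖z' t - F t (z t)‖ ≤ ε)
    (hε : ε * (b - a) * Real.exp (L * (b - a)) ≤ ρ) :
    ∃ x : ℝ → E, x a = z a ∧ IsIntegralCurveOn x F (Icc a b) ∧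
      ∀ t ∈ Icc a b, ‖x t - z t‖ ≤ ε * (b - a) * Real.exp (L * (b - a)) := by
  have hzc : ContinuousOn z (Icc a b) := fun t ht => (hz t ht).continuousWithinAt
  have hε0 : 0 ≤ ε := (norm_nonneg _).trans (hz' a (left_mem_Icc.2 hab))
  obtain ⟨w, hwa, hw⟩ := exists_primitive_on_Icc hab
    (hF.comp (continuousOn_id.prodMk hzc) fun t ht => ⟨ht, mem_univ _⟩) (z a)
  have hzw : ∀ t ∈ Icc a b, ‖z t - w t‖ ≤ ε * (b - a) := fun t ht => by
    have h := norm_image_sub_le_of_norm_deriv_le_segment' (f := z - w)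
      (fun t ht => (hz t ht).sub (hw t ht)) (fun t ht => hz' t (Ico_subset_Icc_self ht)) t ht
    simp only [Pi.sub_apply, hwa, sub_self, sub_zero] at h
    exact h.trans (by gcongr; exact ht.2)
  simpa [hwa] using exists_isIntegralCurveOn_near hab hF hzc hw hρ hL hzw hε

theorem eqOn_of_isIntegralCurveOn_of_lipschitzOnWith_closedBall {F : ℝ → E → E}
    (hF : ∀ R : ℝ, ∃ L : ℝ≥0, ∀ t ∈ Icc a b, LipschitzOnWith L (F t) (closedBall 0 R))
    {x y : ℝ → E} (hx : IsIntegralCurveOn x F (Icc a b)) (hy : IsIntegralCurveOn y F (Icc a b))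
    (ha : x a = y a) : EqOn x y (Icc a b) := by
  obtain ⟨C, hC⟩ := isCompact_Icc.exists_bound_of_continuousOn hx.continuousOn
  obtain ⟨D, hD⟩ := isCompact_Icc.exists_bound_of_continuousOn hy.continuousOn
  obtain ⟨L, hL⟩ := hF (max C D)
  refine ODE_solution_unique_of_mem_Icc_right (v := F) (s := fun _ => closedBall 0 (max C D))
    (K := L) (fun t ht => hL t (Ico_subset_Icc_self ht))
    hx.continuousOn (fun t ht => hasDerivWithinAt_Ici_of_Icc ht (hx t (Ico_subset_Icc_self ht)))
    (fun t ht => mem_closedBall_zero_iff.2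
      ((hC t (Ico_subset_Icc_self ht)).trans (le_max_left _ _)))
    hy.continuousOn (fun t ht => hasDerivWithinAt_Ici_of_Icc ht (hy t (Ico_subset_Icc_self ht)))
    (fun t ht => mem_closedBall_zero_iff.2
      ((hD t (Ico_subset_Icc_self ht)).trans (le_max_right _ _))) ha

theorem continuous_isIntegralCurveOn_endpoint {P : Type*} [TopologicalSpace P] (hab : a ≤ b)
    {F : P → ℝ → E → E}
    (hF : ContinuousOn (fun q : P × ℝ × E => F q.1 q.2.1 q.2.2) (univ ×ˢ Icc a b ×ˢ univ))
    {x : P → ℝ → E} (hx : ∀ p, IsIntegralCurveOn (x p) (F p) (Icc a b))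
    (hxa : Continuous fun p => x p a)
    (hL : ∀ p₀, ∃ (L : ℝ≥0) (s : Set E), ∀ᶠ p in 𝓝 p₀, ∀ t ∈ Icc a b,
      LipschitzOnWith L (F p t) s ∧ x p t ∈ s) :
    Continuous fun p => x p b := by
  refine continuous_iff_continuousAt.2 fun p₀ => ?_
  obtain ⟨L, s, hLs⟩ := hL p₀
  have hfar : ∀ δ > 0, ∀ᶠ p in 𝓝 p₀, ‖x p b - x p₀ b‖ ≤ gronwallBound δ L δ (b - a) := by
    intro δ hδ
    have hFδ : ∀ᶠ p in 𝓝 p₀, ∀ t ∈ Icc a b, dist (F p t (x p₀ t)) (F p₀ t (x p₀ t)) < δ := by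
      have hc : ContinuousOn (Function.uncurry fun (p : P) (t : ℝ) => F p t (x p₀ t))
          (univ ×ˢ Icc a b) :=
        hF.comp (f := fun q : P × ℝ => (q.1, q.2, x p₀ q.2))
          (continuousOn_fst.prodMk (continuousOn_snd.prodMk
            ((hx p₀).continuousOn.comp continuousOn_snd fun q hq => hq.2)))
          fun q hq => ⟨mem_univ _, hq.2, mem_univ _⟩
      obtain ⟨v, hv, hv'⟩ := isCompact_Icc.mem_uniformity_of_prod hc (mem_univ p₀)
        (dist_mem_uniformity hδ)
      rw [nhdsWithin_univ] at hv
      filter_upwards [hv] with p hp t ht using hv' p hp t ht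
    filter_upwards [hLs, hFδ, Metric.continuousAt_iff'.1 hxa.continuousAt δ hδ] with p hp hpF hpa
    have hp₀ := hLs.self_of_nhds
    have h := dist_le_of_approx_trajectories_ODE_of_mem (v := F p) (s := fun _ => s) (δ := δ)
      (fun t ht => (hp t (Ico_subset_Icc_self ht)).1) (hx p).continuousOn
      (fun t ht => hasDerivWithinAt_Ici_of_Icc ht (hx p t (Ico_subset_Icc_self ht)))
      (fun t _ => (dist_self _).le) (fun t ht => (hp t (Ico_subset_Icc_self ht)).2)
      (hx p₀).continuousOn
      (fun t ht => hasDerivWithinAt_Ici_of_Icc ht (hx p₀ t (Ico_subset_Icc_self ht)))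
      (fun t ht => (dist_comm _ _).trans_le (hpF t (Ico_subset_Icc_self ht)).le)
      (fun t ht => (hp₀ t (Ico_subset_Icc_self ht)).2) hpa.le b (right_mem_Icc.2 hab)
    rwa [zero_add, dist_eq_norm] at h
  rw [Metric.continuousAt_iff']
  intro ε hε
  have hg : 0 < gronwallBound 1 L 1 (b - a) + 1 := by
    have h := gronwallBound_mono zero_le_one zero_le_one L.coe_nonneg (sub_nonneg.2 hab)
    rw [gronwallBound_x0] at h
    linarith
  filter_upwards [hfar _ (div_pos hε hg)] with p hp
  rw [dist_eq_norm]
  refine hp.trans_lt ?_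
  rw [gronwallBound_self_eq_mul, div_mul_eq_mul_div, div_lt_iff₀ hg]
  nlinarith

theorem isIntegralCurveOn_comp_affine {x : ℝ → E} {F : ℝ → E → E} {s s' : Set ℝ}
    (hx : IsIntegralCurveOn x F s) {α β : ℝ} (h : MapsTo (fun t => α * t + β) s' s) :
    IsIntegralCurveOn (fun t => x (α * t + β)) (fun t z => α • F (α * t + β) z) s' :=
  fun t ht => HasDerivWithinAt.scomp (h := fun t => α * t + β) t (hx _ (h ht))
    (by simpa using ((hasDerivWithinAt_id t s').const_mul α).add_const β) h

theorem exists_isIntegralCurveOn_near_right [CompleteSpace E] (hab : a ≤ b) {F : ℝ → E → E}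
    (hF : ContinuousOn (Function.uncurry F) (Icc a b ×ˢ univ)) {z w : ℝ → E}
    (hz : ContinuousOn z (Icc a b))
    (hw : ∀ t ∈ Icc a b, HasDerivWithinAt w (F t (z t)) (Icc a b) t)
    {L : ℝ≥0} {ρ ε : ℝ} (hρ : 0 < ρ)
    (hL : ∀ t ∈ Icc a b, LipschitzOnWith L (F t) (closedBall (z t) ρ))
    (hzw : ∀ t ∈ Icc a b, ‖z t - w t‖ ≤ ε) (hε : ε * Real.exp (L * (b - a)) ≤ ρ) :
    ∃ x : ℝ → E, x b = w b ∧ IsIntegralCurveOn x F (Icc a b) ∧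
      ∀ t ∈ Icc a b, ‖x t - z t‖ ≤ ε * Real.exp (L * (b - a)) := by
  have hrev : MapsTo (fun t => -1 * t + (a + b)) (Icc a b) (Icc a b) := fun t ht =>
    ⟨by linarith [ht.2], by linarith [ht.1]⟩
  have hinv : ∀ t, -1 * (-1 * t + (a + b)) + (a + b) = t := fun t => by ring
  obtain ⟨x, hxa, hx, hxz⟩ := exists_isIntegralCurveOn_near hab
    (F := fun t x => (-1 : ℝ) • F (-1 * t + (a + b)) x)
    ((hF.comp (f := fun q : ℝ × E => (-1 * q.1 + (a + b), q.2)) (by fun_prop)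
      fun q hq => ⟨hrev hq.1, mem_univ _⟩).const_smul (-1 : ℝ))
    (hz.comp (by fun_prop) hrev)
    (isIntegralCurveOn_comp_affine (F := fun t _ => F t (z t)) hw hrev) hρ
    (fun t ht => LipschitzOnWith.of_dist_le_mul fun u hu v hv => by
      simpa using (hL _ (hrev ht)).dist_le_mul u hu v hv)
    (fun t ht => hzw _ (hrev ht)) hε
  refine ⟨fun t => x (-1 * t + (a + b)), ?_, fun t ht => ?_, fun t ht => ?_⟩
  · beta_reduce
    rw [show -1 * b + (a + b) = a by ring, hxa, show -1 * a + (a + b) = b by ring]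
  · simpa only [hinv, neg_smul, one_smul, neg_neg] using isIntegralCurveOn_comp_affine hx hrev t ht
  · simpa only [Function.comp_apply, hinv] using hxz _ (hrev ht)

theorem continuous_isIntegralCurveOn_left_endpoint {P : Type*} [TopologicalSpace P]
    {F : P → ℝ → E → E} {c : P → ℝ} (hc : Continuous c) (hac : ∀ p, a ≤ c p) (hcb : ∀ p, c p ≤ b)
    (hF : ContinuousOn (fun q : P × ℝ × E => F q.1 q.2.1 q.2.2) (univ ×ˢ Icc a b ×ˢ univ))
    {x : P → ℝ → E} (hx : ∀ p, IsIntegralCurveOn (x p) (F p) (Icc (c p) b))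
    (hxb : Continuous fun p => x p b)
    (hL : ∀ p₀, ∃ (L : ℝ≥0) (s : Set E), ∀ᶠ p in 𝓝 p₀, ∀ t ∈ Icc (c p) b,
      LipschitzOnWith L (F p t) s ∧ x p t ∈ s) :
    Continuous fun p => x p (c p) := by
  have hmaps : ∀ p, MapsTo (fun s => (c p - b) * s + b) (Icc 0 1) (Icc (c p) b) := fun p s hs =>
    ⟨by nlinarith [hs.2, hcb p], by nlinarith [hs.1, hcb p]⟩
  have hend := continuous_isIntegralCurveOn_endpoint zero_le_one
    (F := fun p s z => (c p - b) • F p ((c p - b) * s + b) z)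
    (ContinuousOn.fun_smul (by fun_prop) (hF.comp
      (f := fun q : P × ℝ × E => (q.1, (c q.1 - b) * q.2.1 + b, q.2.2)) (by fun_prop)
      fun q hq => ⟨mem_univ _, Icc_subset_Icc_left (hac _) (hmaps _ hq.2.1), mem_univ _⟩))
    (fun p => isIntegralCurveOn_comp_affine (hx p) (hmaps p)) (by simpa using hxb)
    fun p₀ => by
      obtain ⟨L, s, hLs⟩ := hL p₀
      refine ⟨(b - a).toNNReal * L, s, hLs.mono fun p hp t ht => ⟨?_, (hp _ (hmaps p ht)).2⟩⟩
      refine LipschitzOnWith.of_dist_le_mul fun u hu v hv => ?_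
      have h := (hp _ (hmaps p ht)).1.dist_le_mul u hu v hv
      have hle : |c p - b| ≤ b - a := abs_le.2 ⟨by linarith [hac p], by linarith [hac p, hcb p]⟩
      rw [dist_smul₀, Real.norm_eq_abs, NNReal.coe_mul, mul_assoc,
        Real.coe_toNNReal _ ((abs_nonneg _).trans hle)]
      exact mul_le_mul hle h dist_nonneg ((abs_nonneg _).trans hle)
  simpa using hend

end ODE

section Steering

open Metric
open scoped NNReal

variable {E U P : Type*} [NormedAddCommGroup E] [NormedSpace ℝ E]
  [NormedAddCommGroup U] [NormedSpace ℝ U] [TopologicalSpace P]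

theorem exists_continuous_rightInverse_of_approximatesLinearOn_id [CompleteSpace E]
    {Θ : P → E → E} {η : P → E} {q : ℝ≥0} (hq : q < 1) {ρ : ℝ} (hρ : 0 ≤ ρ)
    (hΘ : ∀ p, ApproximatesLinearOn (Θ p) (ContinuousLinearMap.id ℝ E) (closedBall 0 ρ) q)
    (hΘc : ∀ c ∈ closedBall 0 ρ, Continuous fun p => Θ p c) (hη : Continuous η)
    (h0 : ∀ p, ‖η p - Θ p 0‖ ≤ (1 - q) * ρ) :
    ∃ c : P → E, Continuous c ∧ ∀ p, c p ∈ closedBall 0 ρ ∧ Θ p (c p) = η p := by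
  let R : (ContinuousLinearMap.id ℝ E).NonlinearRightInverse := ⟨id, 1, by simp, by simp⟩
  have hsurj : ∀ p, ∃ c ∈ closedBall 0 ρ, Θ p c = η p := fun p =>
    (hΘ p).surjOn_closedBall_of_nonlinearRightInverse R hρ Subset.rfl
      (by simpa [R, dist_eq_norm] using h0 p)
  choose c hc hcη using hsurj
  refine ⟨c, continuous_iff_continuousAt.2 fun p₀ => ?_, fun p => ⟨hc p, hcη p⟩⟩
  have hq' : (0 : ℝ) < 1 - q := sub_pos.2 hq
  have hlim : Tendsto (fun p => ‖η p - Θ p (c p₀)‖ / (1 - q)) (𝓝 p₀) (𝓝 0) := by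
    have h : Continuous fun p => ‖η p - Θ p (c p₀)‖ / (1 - q) :=
      (hη.sub (hΘc _ (hc p₀))).norm.div_const _
    simpa [hcη p₀] using h.tendsto p₀
  refine tendsto_iff_norm_sub_tendsto_zero.2 (squeeze_zero (fun _ => norm_nonneg _)
    (fun p => ?_) hlim)
  have h := hΘ p _ (hc p) _ (hc p₀)
  rw [hcη p, ContinuousLinearMap.id_apply, norm_sub_rev] at h
  rw [le_div_iff₀ hq']
  linarith [norm_sub_norm_le (c p - c p₀) (η p - Θ p (c p₀))]

/-- The trajectories `s ↦ QX s c` and controls `s ↦ QU s c`, `0 ≤ s ≤ 1`, steer the linear system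
`x' = A x + B u` from `0` to an arbitrary `c`. -/
structure SteeringCurves (A : E →L[ℝ] E) (B : U →L[ℝ] E) (QX : ℝ → E →L[ℝ] E)
    (QU : ℝ → E →L[ℝ] U) : Prop where
  hasDerivAt : ∀ s, HasDerivAt QX (A ∘L QX s + B ∘L QU s) s
  continuous_control : Continuous QU
  zero : QX 0 = 0
  one : QX 1 = ContinuousLinearMap.id ℝ E

variable {A : E →L[ℝ] E} {B : U →L[ℝ] E} {QX : ℝ → E →L[ℝ] E} {QU : ℝ → E →L[ℝ] U}

namespace SteeringCurves

theorem hasDerivAt_apply (hQ : SteeringCurves A B QX QU) (c : E) (s : ℝ) :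
    HasDerivAt (fun s => QX s c) (A.coprod B (QX s c, QU s c)) s := by
  simpa using (hQ.hasDerivAt s).clm_apply (hasDerivAt_const s c)

theorem continuous_trajectory (hQ : SteeringCurves A B QX QU) : Continuous QX :=
  continuous_iff_continuousAt.2 fun s => (hQ.hasDerivAt s).continuousAt

theorem exists_bound (hQ : SteeringCurves A B QX QU) :
    ∃ K : ℝ, 1 ≤ K ∧ ∀ s ∈ Icc (0 : ℝ) 1, ∀ c, ‖(QX s c, QU s c)‖ ≤ K * ‖c‖ := by
  obtain ⟨K, hK⟩ := isCompact_Icc.exists_bound_of_continuousOn (s := Icc (0 : ℝ) 1)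
    (hQ.continuous_trajectory.prodMk hQ.continuous_control).continuousOn
  refine ⟨max K 1, le_max_right _ _, fun s hs c => ?_⟩
  have h : ‖QX s‖ ≤ max K 1 ∧ ‖QU s‖ ≤ max K 1 := by
    exact max_le_iff.1 ((hK s hs).trans (le_max_left _ _))
  exact max_le ((QX s).le_of_opNorm_le h.1 c) ((QU s).le_of_opNorm_le h.2 c)

end SteeringCurves

/-- The constants of the steering argument: `K` bounds the steering curves, and `κ` is the size,
relative to the radius of the ball considered, of the admissible perturbations of `A.coprod B`. -/
structure SteeringConstants (A : E →L[ℝ] E) (B : U →L[ℝ] E) (QX : ℝ → E →L[ℝ] E)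
    (QU : ℝ → E →L[ℝ] U) (K : ℝ) (κ : ℝ≥0) : Prop where
  one_le : 1 ≤ K
  norm_le : ∀ s ∈ Icc (0 : ℝ) 1, ∀ c, ‖(QX s c, QU s c)‖ ≤ K * ‖c‖
  pos : 0 < κ
  mul_exp_le : 32 * κ * K * Real.exp (‖A.coprod B‖₊ + κ : ℝ≥0) ≤ 1

theorem SteeringCurves.exists_steeringConstants (hQ : SteeringCurves A B QX QU) :
    ∃ K κ, SteeringConstants A B QX QU K κ := by
  obtain ⟨K, hK, hKQ⟩ := hQ.exists_bound
  have hcont : Tendsto (fun κ : ℝ≥0 => 32 * (κ : ℝ) * K * Real.exp (‖A.coprod B‖₊ + κ : ℝ≥0))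
      (𝓝[>] 0) (𝓝 0) := by
    have h : Continuous fun κ : ℝ≥0 =>
      32 * (κ : ℝ) * K * Real.exp (‖A.coprod B‖₊ + κ : ℝ≥0) := by fun_prop
    simpa using (h.tendsto 0).mono_left nhdsWithin_le_nhds
  obtain ⟨κ, hκ, hκ0⟩ := ((hcont.eventually_le_const one_pos).and self_mem_nhdsWithin).exists
  exact ⟨K, κ, hK, hKQ, hκ0, hκ⟩

namespace SteeringConstants

variable {K : ℝ} {κ : ℝ≥0} {r : ℝ}

theorem norm_le_of_mul_le (hC : SteeringConstants A B QX QU K κ) {c : E}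
    (hc : K * ‖c‖ ≤ r) {s : ℝ} (hs : s ∈ Icc (0 : ℝ) 1) : ‖QX s c‖ ≤ r ∧ ‖QU s c‖ ≤ r := by
  have h := (hC.norm_le s hs c).trans hc
  exact ⟨(norm_fst_le _).trans h, (norm_snd_le _).trans h⟩

theorem mul_norm_le_of_mem_closedBall (hC : SteeringConstants A B QX QU K κ) {c : E}
    (hc : c ∈ closedBall 0 (r / (8 * K))) : K * ‖c‖ ≤ r / 8 := by
  have hK : 0 < K := one_pos.trans_le hC.one_le
  rw [mem_closedBall_zero_iff, le_div_iff₀ (by positivity)] at hc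
  linarith

theorem mul_le_div (hC : SteeringConstants A B QX QU K κ) (hr : 0 ≤ r) :
    κ * r ≤ r / (32 * K) := by
  have hK : 0 < K := one_pos.trans_le hC.one_le
  have hκK : 32 * κ * K ≤ 1 :=
    (le_mul_of_one_le_right (by positivity) (Real.one_le_exp NNReal.zero_le_coe)).trans
      hC.mul_exp_le
  rw [le_div_iff₀ (by positivity)]
  nlinarith

end SteeringConstants

/-- The field `g` on `[0, 1]` is a perturbation of the linear one `A x + B u` on the ball of
radius `r` (for the sup norm of `E × U`), of Lipschitz size `κ` and of size `κ r` at the origin. -/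
structure NearLinearField (A : E →L[ℝ] E) (B : U →L[ℝ] E) (κ : ℝ≥0) (r : ℝ)
    (g : ℝ → E → U → E) : Prop where
  continuousOn : ContinuousOn (fun q : ℝ × E × U => g q.1 q.2.1 q.2.2) (Icc 0 1 ×ˢ univ)
  approximatesLinearOn : ∀ s ∈ Icc (0 : ℝ) 1,
    ApproximatesLinearOn (fun q : E × U => g s q.1 q.2) (A.coprod B) (closedBall 0 r) κ
  norm_zero_le : ∀ s ∈ Icc (0 : ℝ) 1, ‖g s 0 0‖ ≤ κ * r

namespace NearLinearField

variable {κ : ℝ≥0} {r : ℝ} {g : ℝ → E → U → E}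

theorem continuousOn_control (hg : NearLinearField A B κ r g) {u : ℝ → U} (hu : Continuous u) :
    ContinuousOn (Function.uncurry fun s x => g s x (u s)) (Icc 0 1 ×ˢ univ) :=
  hg.continuousOn.comp (f := fun q : ℝ × E => (q.1, q.2, u q.1)) (by fun_prop)
    fun _ hq => ⟨hq.1, mem_univ _⟩

theorem lipschitzOnWith (hg : NearLinearField A B κ r g) {s : ℝ} (hs : s ∈ Icc (0 : ℝ) 1) {u : U}
    (hu : ‖u‖ ≤ r) :
    LipschitzOnWith (‖A.coprod B‖₊ + κ) (fun x => g s x u) (closedBall 0 r) := by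
  have h := (lipschitzOnWith_iff_restrict.2 (hg.approximatesLinearOn s hs).lipschitz).comp
    ((LipschitzWith.prodMk_right u).lipschitzOnWith (s := closedBall (0 : E) r))
    fun x hx => ?_
  · simpa [Function.comp_def] using h
  · rw [mem_closedBall_zero_iff] at hx ⊢
    exact max_le hx hu

variable {K : ℝ} (hg : NearLinearField A B κ r g) (hQ : SteeringCurves A B QX QU)
  (hC : SteeringConstants A B QX QU K κ) (hr : 0 < r)
include hg hQ hC

include hr in
theorem exists_response [CompleteSpace E] {c : E} (hc : K * ‖c‖ ≤ r / 8) :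
    ∃ X : ℝ → E, X 0 = 0 ∧ IsIntegralCurveOn X (fun s x => g s x (QU s c)) (Icc 0 1) ∧
      ∀ s ∈ Icc (0 : ℝ) 1, ‖X s - QX s c‖ ≤ r / (16 * K) := by
  have hK : 0 < K := one_pos.trans_le hC.one_le
  have hκ := hC.mul_exp_le
  set e := Real.exp (‖A.coprod B‖₊ + κ : ℝ≥0)
  have hdefect : ∀ s ∈ Icc (0 : ℝ) 1,
      ‖A.coprod B (QX s c, QU s c) - g s (QX s c) (QU s c)‖ ≤ 2 * κ * r := fun s hs => by
    have hq := (hC.norm_le s hs c).trans hc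
    have h := hg.approximatesLinearOn s hs (QX s c, QU s c) 
      (mem_closedBall_zero_iff.2 (by linarith)) 0 (mem_closedBall_self hr.le)
    simp only [sub_zero, Prod.fst_zero, Prod.snd_zero] at h
    have h0 := hg.norm_zero_le s hs
    rw [norm_sub_rev, ← sub_add_cancel (g s (QX s c) (QU s c)) (g s 0 0), add_sub_right_comm]
    refine (norm_add_le _ _).trans ?_
    nlinarith [κ.coe_nonneg]
  have hsmall : 2 * κ * r * (1 - 0) * Real.exp ((‖A.coprod B‖₊ + κ : ℝ≥0) * (1 - 0))
      ≤ r / (16 * K) := by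
    rw [le_div_iff₀ (by positivity), sub_zero, mul_one, mul_one]
    nlinarith
  have hle : r / (16 * K) ≤ r / 2 :=
    div_le_div_of_nonneg_left hr.le two_pos (by linarith [hC.one_le])
  obtain ⟨X, hX0, hX, hXQ⟩ := exists_isIntegralCurveOn_near_of_norm_deriv_sub_le zero_le_one
    (hg.continuousOn_control (hQ.continuous_control.clm_apply continuous_const))
    (fun s _ => (hQ.hasDerivAt_apply c s).hasDerivWithinAt) (half_pos hr)
    (fun s hs => (hg.lipschitzOnWith hs
        ((hC.norm_le_of_mul_le hc hs).2.trans (by linarith))).mono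
      (closedBall_subset_closedBall' (by
        rw [dist_zero_right]; linarith [(hC.norm_le_of_mul_le hc hs).1])))
    hdefect (hsmall.trans hle)
  exact ⟨X, by simp [hX0, hQ.zero], hX, fun s hs => (hXQ s hs).trans hsmall⟩

theorem norm_response_sub_le {X X' : ℝ → E} {c c' : E}
    (hc : K * ‖c‖ ≤ r / 8) (hc' : K * ‖c'‖ ≤ r / 8) (hX0 : X 0 = 0) (hX0' : X' 0 = 0)
    (hX : IsIntegralCurveOn X (fun s x => g s x (QU s c)) (Icc 0 1))
    (hX' : IsIntegralCurveOn X' (fun s x => g s x (QU s c')) (Icc 0 1))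
    (hXr : ∀ s ∈ Icc (0 : ℝ) 1, ‖X s‖ ≤ r / 4) (hXr' : ∀ s ∈ Icc (0 : ℝ) 1, ‖X' s‖ ≤ r / 4) :
    ‖X 1 - X' 1 - (c - c')‖ ≤ 1 / 4 * ‖c - c'‖ := by
  have hr : 0 ≤ r / 4 := (norm_nonneg _).trans (hXr 0 ⟨le_rfl, zero_le_one⟩)
  have hK : 0 < K := one_pos.trans_le hC.one_le
  have hκ := hC.mul_exp_le
  set L : ℝ≥0 := ‖A.coprod B‖₊ + κ
  have hcc : K * ‖c - c'‖ ≤ r / 4 := by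
    nlinarith [norm_sub_le c c', norm_nonneg (c - c')]
  have hz : ∀ s ∈ Icc (0 : ℝ) 1, ‖X' s + QX s (c - c')‖ ≤ r := fun s hs => by
    linarith [norm_add_le (X' s) (QX s (c - c')), hXr' s hs, (hC.norm_le_of_mul_le hcc hs).1]
  have hdefect : ∀ s ∈ Icc (0 : ℝ) 1,
      ‖g s (X' s) (QU s c') + A.coprod B (QX s (c - c'), QU s (c - c'))
        - g s (X' s + QX s (c - c')) (QU s c)‖ ≤ κ * (K * ‖c - c'‖) := fun s hs => by
    have h := hg.approximatesLinearOn s hs (X' s + QX s (c - c'), QU s c)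
      (mem_closedBall_zero_iff.2 (max_le (hz s hs)
        ((hC.norm_le_of_mul_le hc hs).2.trans (by linarith))))
      (X' s, QU s c') (mem_closedBall_zero_iff.2 (max_le ((hXr' s hs).trans (by linarith))
        ((hC.norm_le_of_mul_le hc' hs).2.trans (by linarith))))
    rw [Prod.mk_sub_mk, add_sub_cancel_left, ← map_sub (QU s)] at h
    rw [norm_sub_rev, ← sub_sub]
    exact h.trans (by gcongr; exact hC.norm_le s hs _)
  have hgron := dist_le_of_approx_trajectories_ODE_of_mem (v := fun s x => g s x (QU s c))
    (s := fun _ => closedBall 0 r) (δ := 0) (g := fun s => X' s + QX s (c - c')) (K := L)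
    (fun s hs => hg.lipschitzOnWith (Ico_subset_Icc_self hs)
      ((hC.norm_le_of_mul_le hc (Ico_subset_Icc_self hs)).2.trans (by linarith)))
    hX.continuousOn (fun s hs => hasDerivWithinAt_Ici_of_Icc hs (hX s (Ico_subset_Icc_self hs)))
    (fun s _ => (dist_self _).le)
    (fun s hs => mem_closedBall_zero_iff.2 ((hXr s (Ico_subset_Icc_self hs)).trans (by linarith)))
    (hX'.continuousOn.add (hQ.continuous_trajectory.clm_apply continuous_const).continuousOn)
    (fun s hs => (hasDerivWithinAt_Ici_of_Icc hs (hX' s (Ico_subset_Icc_self hs))).add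
      (hQ.hasDerivAt_apply _ s).hasDerivWithinAt)
    (fun s hs => (dist_eq_norm _ _).trans_le (hdefect s (Ico_subset_Icc_self hs)))
    (fun s hs => mem_closedBall_zero_iff.2 (hz s (Ico_subset_Icc_self hs)))
    (by simp [hX0, hX0', hQ.zero]) 1 (right_mem_Icc.2 zero_le_one)
  rw [dist_eq_norm, ← sub_sub, hQ.one, ContinuousLinearMap.id_apply, zero_add, sub_zero] at hgron
  refine hgron.trans ((gronwallBound_zero_le L.coe_nonneg (by positivity) _).trans ?_)
  rw [mul_one, mul_one]
  nlinarith [norm_nonneg (c - c')]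

end NearLinearField

/-- With the control `QU · c`, the perturbed system reaches at time `1` a contraction perturbation
of `c`. -/
theorem SteeringCurves.exists_steering [CompleteSpace E] (hQ : SteeringCurves A B QX QU) :
    ∃ κ : ℝ≥0, 0 < κ ∧ ∀ r > 0, ∀ (G : P → ℝ → E → U → E) (η : P → E),
      ContinuousOn (fun q : P × ℝ × E × U => G q.1 q.2.1 q.2.2.1 q.2.2.2)
        (univ ×ˢ Icc 0 1 ×ˢ univ) →
      (∀ p, NearLinearField A B κ r (G p)) → Continuous η → (∀ p, ‖η p‖ ≤ κ * r) →
      ∃ c : P → E, Continuous c ∧ ∀ p, ∃ X : ℝ → E, X 0 = 0 ∧ X 1 = η p ∧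
        IsIntegralCurveOn X (fun s x => G p s x (QU s (c p))) (Icc 0 1) := by
  obtain ⟨K, κ, hC⟩ := hQ.exists_steeringConstants
  have hK : 0 < K := one_pos.trans_le hC.one_le
  refine ⟨κ, hC.pos, fun r hr G η hGc hG hη hηr => ?_⟩
  have hc : ∀ c ∈ closedBall (0 : E) (r / (8 * K)), K * ‖c‖ ≤ r / 8 := fun c =>
    hC.mul_norm_le_of_mem_closedBall
  have hresp : ∀ p c, ∃ X : ℝ → E, c ∈ closedBall 0 (r / (8 * K)) →
      X 0 = 0 ∧ IsIntegralCurveOn X (fun s x => G p s x (QU s c)) (Icc 0 1) ∧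
      ∀ s ∈ Icc (0 : ℝ) 1, ‖X s - QX s c‖ ≤ r / (16 * K) := fun p c => by
    by_cases h : c ∈ closedBall 0 (r / (8 * K))
    · exact ((hG p).exists_response hQ hC hr (hc c h)).imp fun X hX _ => hX
    · exact ⟨0, fun h' => absurd h' h⟩
  choose X hX using hresp
  have hXr : ∀ p, ∀ c ∈ closedBall 0 (r / (8 * K)), ∀ s ∈ Icc (0 : ℝ) 1, ‖X p c s‖ ≤ r / 4 := by
    intro p c h s hs
    have hle : r / (16 * K) ≤ r / 16 :=
      div_le_div_of_nonneg_left hr.le (by norm_num) (by linarith [hC.one_le])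
    have := norm_sub_norm_le (X p c s) (QX s c)
    linarith [(hX p c h).2.2 s hs, (hC.norm_le_of_mul_le (hc c h) hs).1]
  have hX1 : ∀ c ∈ closedBall 0 (r / (8 * K)), Continuous fun p => X p c 1 := fun c h =>
    continuous_isIntegralCurveOn_endpoint zero_le_one
      (hGc.comp (f := fun q : P × ℝ × E => (q.1, q.2.1, q.2.2, QU q.2.1 c))
        (by have := hQ.continuous_control; fun_prop) fun q hq => ⟨mem_univ _, hq.2.1, mem_univ _⟩)
      (fun p => (hX p c h).2.1) (by simp only [(hX _ c h).1, continuous_const])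
      fun p₀ => ⟨‖A.coprod B‖₊ + κ, closedBall 0 r, Eventually.of_forall fun p s hs =>
        ⟨(hG p).lipschitzOnWith hs
          ((hC.norm_le_of_mul_le (hc c h) hs).2.trans (by linarith)),
        mem_closedBall_zero_iff.2 ((hXr p c h s hs).trans (by linarith))⟩⟩
  have hη0 : ∀ p, ‖η p - X p 0 1‖ ≤ (1 - (1 / 4 : ℝ≥0)) * (r / (8 * K)) := fun p => by
    have h := (hX p 0 (mem_closedBall_self (by positivity))).2.2 1 (right_mem_Icc.2 zero_le_one)
    rw [map_zero, sub_zero] at h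
    calc ‖η p - X p 0 1‖ ≤ r / (32 * K) + r / (16 * K) :=
          (norm_sub_le _ _).trans (add_le_add ((hηr p).trans (hC.mul_le_div hr.le)) h)
      _ = (1 - (1 / 4 : ℝ≥0)) * (r / (8 * K)) := by push_cast; field_simp; norm_num
  obtain ⟨c, hcc, hcη⟩ := exists_continuous_rightInverse_of_approximatesLinearOn_id
    (Θ := fun p c => X p c 1) (q := 1 / 4) (by rw [← NNReal.coe_lt_coe]; norm_num) (by positivity)
    (fun p c h c' h' => by
      simpa using (hG p).norm_response_sub_le hQ hC (hc c h) (hc c' h') (hX p c h).1 (hX p c' h').1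
        (hX p c h).2.1 (hX p c' h').2.1 (hXr p c h) (hXr p c' h')) hX1 hη hη0
  exact ⟨c, hcc, fun p => ⟨X p (c p), (hX p _ (hcη p).1).1, (hcη p).2, (hX p _ (hcη p).1).2.1⟩⟩

end Steering

section CompactParameters

variable {X Z F : Type*} [TopologicalSpace X] [TopologicalSpace Z] {K : Set Z}

theorem tendstoUniformlyOn_of_isCompact [UniformSpace F] (hK : IsCompact K) {g : X → Z → F}
    (hg : ContinuousOn (fun q : X × Z => g q.1 q.2) (univ ×ˢ K)) (x₀ : X) :
    TendstoUniformlyOn g (g x₀) (𝓝 x₀) K := by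
  intro u hu
  obtain ⟨v, hv, hv'⟩ := hK.mem_uniformity_of_prod hg (mem_univ x₀) (symm_le_uniformity hu)
  rw [nhdsWithin_univ] at hv
  filter_upwards [hv] with x hx z hz using hv' x hx z hz

theorem exists_eventually_norm_le_of_isCompact [SeminormedAddCommGroup F] (hK : IsCompact K)
    {g : X → Z → F} (hg : ContinuousOn (fun q : X × Z => g q.1 q.2) (univ ×ˢ K)) (x₀ : X) :
    ∃ M, ∀ᶠ x in 𝓝 x₀, ∀ z ∈ K, ‖g x z‖ ≤ M := by
  obtain ⟨M, hM⟩ := hK.exists_bound_of_continuousOn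
    (hg.comp (f := fun z => (x₀, z)) (by fun_prop) fun z hz => ⟨mem_univ _, hz⟩)
  refine ⟨M + 1, (Metric.tendstoUniformlyOn_iff.1 (tendstoUniformlyOn_of_isCompact hK hg x₀) 1
    one_pos).mono fun x hx z hz => (norm_le_norm_add_norm_sub (g x₀ z) _).trans ?_⟩
  exact add_le_add (hM z hz) (by simpa [dist_eq_norm] using (hx z hz).le)

end CompactParameters

section JointC1

variable {Y Y' F G : Type*} [TopologicalSpace Y] [TopologicalSpace Y'] [NormedAddCommGroup F]
  [NormedSpace ℝ F] [NormedAddCommGroup G] [NormedSpace ℝ G]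

/-- A family of curves is jointly `C¹` if the curves are differentiable, and if their values and
their velocities depend continuously on the parameter and on time. -/
structure JointC1 (g : Y → ℝ → F) : Prop where
  continuous : Continuous fun q : Y × ℝ => g q.1 q.2
  differentiable : ∀ y, Differentiable ℝ (g y)
  continuous_deriv : Continuous fun q : Y × ℝ => deriv (g q.1) q.2

namespace JointC1

theorem of_hasDerivAt {g g' : Y → ℝ → F} (hg : Continuous fun q : Y × ℝ => g q.1 q.2)
    (hg' : Continuous fun q : Y × ℝ => g' q.1 q.2) (h : ∀ y t, HasDerivAt (g y) (g' y t) t) :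
    JointC1 g :=
  ⟨hg, fun y t => (h y t).differentiableAt, by simpa only [(h _ _).deriv] using hg'⟩

theorem of_eventuallyEq {g : Y → ℝ → F}
    (h : ∀ y₀ t₀, ∃ g₁ : Y → ℝ → F, JointC1 g₁ ∧
      ∀ᶠ q : Y × ℝ in 𝓝 (y₀, t₀), g q.1 q.2 = g₁ q.1 q.2) : JointC1 g := by
  have hslice : ∀ {g₁ : Y → ℝ → F} {q₀ : Y × ℝ},
      (∀ᶠ q : Y × ℝ in 𝓝 q₀, g q.1 q.2 = g₁ q.1 q.2) → g q₀.1 =ᶠ[𝓝 q₀.2] g₁ q₀.1 := by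
    intro g₁ q₀ hq
    exact (Continuous.prodMk_right q₀.1).tendsto q₀.2 |>.eventually hq
  refine ⟨continuous_iff_continuousAt.2 fun q₀ => ?_, fun y t => ?_,
    continuous_iff_continuousAt.2 fun q₀ => ?_⟩
  · obtain ⟨g₁, hg₁, he⟩ := h q₀.1 q₀.2
    exact hg₁.continuous.continuousAt.congr (he.mono fun q hq => hq.symm)
  · obtain ⟨g₁, hg₁, he⟩ := h y t
    exact (hg₁.differentiable y t).congr_of_eventuallyEq (hslice he)
  · obtain ⟨g₁, hg₁, he⟩ := h q₀.1 q₀.2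
    refine hg₁.continuous_deriv.continuousAt.congr ?_
    filter_upwards [he.eventually_nhds] with q hq
    exact (hslice hq).deriv_eq.symm

theorem const {c : Y → F} (hc : Continuous c) : JointC1 fun y (_ : ℝ) => c y :=
  of_hasDerivAt (by fun_prop) continuous_const fun _ t => hasDerivAt_const t _

theorem add {g₁ g₂ : Y → ℝ → F} (h₁ : JointC1 g₁) (h₂ : JointC1 g₂) :
    JointC1 fun y t => g₁ y t + g₂ y t :=
  of_hasDerivAt (h₁.continuous.add h₂.continuous)
    (h₁.continuous_deriv.add h₂.continuous_deriv)
    fun y t => (h₁.differentiable y t).hasDerivAt.add (h₂.differentiable y t).hasDerivAt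

theorem sub {g₁ g₂ : Y → ℝ → F} (h₁ : JointC1 g₁) (h₂ : JointC1 g₂) :
    JointC1 fun y t => g₁ y t - g₂ y t :=
  of_hasDerivAt (h₁.continuous.sub h₂.continuous)
    (h₁.continuous_deriv.sub h₂.continuous_deriv)
    fun y t => (h₁.differentiable y t).hasDerivAt.sub (h₂.differentiable y t).hasDerivAt

theorem smul {g₁ : Y → ℝ → ℝ} {g₂ : Y → ℝ → F} (h₁ : JointC1 g₁) (h₂ : JointC1 g₂) :
    JointC1 fun y t => g₁ y t • g₂ y t :=
  of_hasDerivAt (h₁.continuous.smul h₂.continuous)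
    ((h₁.continuous.smul h₂.continuous_deriv).add (h₁.continuous_deriv.smul h₂.continuous))
    fun y t => (h₁.differentiable y t).hasDerivAt.smul (h₂.differentiable y t).hasDerivAt

theorem sum {ι : Type*} (s : Finset ι) {g : ι → Y → ℝ → F} (h : ∀ i ∈ s, JointC1 (g i)) :
    JointC1 fun y t => ∑ i ∈ s, g i y t :=
  of_hasDerivAt (continuous_finsetSum s fun i hi => (h i hi).continuous)
    (continuous_finsetSum s fun i hi => (h i hi).continuous_deriv)
    fun y t => HasDerivAt.fun_sum fun i hi => ((h i hi).differentiable y t).hasDerivAt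

theorem comp_affine {g : Y → ℝ → F} (hg : JointC1 g) {π : Y' → Y} (hπ : Continuous π)
    {α β : Y' → ℝ} (hα : Continuous α) (hβ : Continuous β) :
    JointC1 fun y t => g (π y) (α y * t + β y) :=
  of_hasDerivAt (g' := fun y t => α y • deriv (g (π y)) (α y * t + β y))
    (hg.continuous.comp (f := fun q : Y' × ℝ => (π q.1, α q.1 * q.2 + β q.1)) (by fun_prop))
    (Continuous.smul (by fun_prop)
      (hg.continuous_deriv.comp (f := fun q : Y' × ℝ => (π q.1, α q.1 * q.2 + β q.1))
        (by fun_prop)))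
    fun y t => by
      have h1 : HasDerivAt (fun t => α y * t + β y) (α y) t := by
        simpa using ((hasDerivAt_id t).const_mul (α y)).add_const (β y)
      exact (hg.differentiable (π y) _).hasDerivAt.scomp t h1

theorem comp {g : Y → ℝ → F} (hg : JointC1 g) {π : Y' → Y} (hπ : Continuous π) :
    JointC1 fun y => g (π y) := by
  simpa only [one_mul, add_zero] using
    hg.comp_affine hπ (α := fun _ => 1) continuous_const (β := fun _ => 0) continuous_const

theorem of_contDiff {f : ℝ → F} (hf : ContDiff ℝ 1 f) : JointC1 fun (_ : Y) t => f t :=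
  of_hasDerivAt (hf.continuous.comp continuous_snd)
    ((contDiff_one_iff_deriv.1 hf).2.comp continuous_snd)
    fun _ t => (hf.differentiable one_ne_zero t).hasDerivAt

theorem clm_apply {A : Y → ℝ → G →L[ℝ] F} (hA : JointC1 A) {c : Y → G} (hc : Continuous c) :
    JointC1 fun y t => A y t (c y) :=
  of_hasDerivAt (g' := fun y t => deriv (A y) t (c y))
    (hA.continuous.clm_apply (by fun_prop))
    (hA.continuous_deriv.clm_apply (by fun_prop))
    fun y t => by
      simpa using (hA.differentiable y t).hasDerivAt.clm_apply (hasDerivAt_const t (c y))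

theorem continuousC1Family {g : Y → ℝ → F} (hg : JointC1 g) {a b : ℝ} (hab : a < b) :
    ContinuousC1Family a b g := by
  have hunif : ∀ {k : Y → ℝ → F}, (Continuous fun q : Y × ℝ => k q.1 q.2) → ∀ y₀,
      TendstoUniformlyOn k (k y₀) (𝓝 y₀) (Icc a b) := fun hk =>
    tendstoUniformlyOn_of_isCompact isCompact_Icc hk.continuousOn
  have hdw : ∀ y, ∀ t ∈ Icc a b, derivWithin (g y) (Icc a b) t = deriv (g y) t := fun y t ht =>
    (hg.differentiable y t).derivWithin (uniqueDiffOn_Icc hab t ht)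
  refine ⟨fun y => ?_, fun y₀ => hunif hg.continuous y₀, fun y₀ => ?_⟩
  · refine ContDiff.contDiffOn (contDiff_one_iff_deriv.2 ⟨hg.differentiable y, ?_⟩)
    exact hg.continuous_deriv.comp (f := fun t : ℝ => (y, t)) (by fun_prop)
  · intro u hu
    filter_upwards [hunif (k := fun y => deriv (g y)) hg.continuous_deriv y₀ u hu] with y hy t ht
    rw [hdw y t ht, hdw y₀ t ht]
    exact hy t ht

end JointC1

end JointC1

section Weights

open Metric

theorem eventually_zero_mem_convexHull_range {ι E : Type*} [Finite ι] [NormedAddCommGroup E]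
    [NormedSpace ℝ E] {u₀ : ι → E} (h₀ : (0 : E) ∈ interior (convexHull ℝ (range u₀))) :
    ∀ᶠ u in 𝓝 u₀, (0 : E) ∈ convexHull ℝ (range u) := by
  have := Fintype.ofFinite ι
  obtain ⟨i₀⟩ : Nonempty ι := range_nonempty_iff_nonempty.1
    ((convexHull_nonempty_iff (𝕜 := ℝ)).1 ⟨0, interior_subset h₀⟩)
  obtain ⟨r, hr, hball⟩ := Metric.mem_nhds_iff.1 (mem_interior_iff_mem_nhds.1 h₀)
  filter_upwards [ball_mem_nhds u₀ (half_pos hr)] with u hu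
  by_contra hmem
  obtain ⟨f, s, hs, hf⟩ := geometric_hahn_banach_point_closed (convex_convexHull ℝ (range u))
    ((finite_range u).isClosed_convexHull ℝ) hmem
  have hfu : ∀ i, 0 < f (u i) := fun i =>
    (map_zero f ▸ hs).trans (hf _ (subset_convexHull ℝ _ ⟨i, rfl⟩))
  have hfu₀ : ∀ i, -(‖f‖ * (r / 2)) < f (u₀ i) := by
    intro i
    have hi : ‖u i - u₀ i‖ ≤ r / 2 := by
      rw [← dist_eq_norm]
      exact (dist_le_pi_dist u u₀ i).trans hu.le
    have hle : f (u i) - f (u₀ i) ≤ ‖f‖ * (r / 2) := by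
      rw [← map_sub]
      exact (le_abs_self _).trans (f.le_opNorm_of_le hi)
    linarith [hfu i]
  have hlow : ∀ x ∈ ball (0 : E) r, -(‖f‖ * (r / 2)) < f x := fun x hx =>
    convexHull_min (t := f ⁻¹' Ioi _) (range_subset_iff.2 hfu₀)
      ((convex_Ioi _).linear_preimage f.toLinearMap) (hball hx)
  have habs : ∀ x ∈ ball (0 : E) r, ‖f x‖ < ‖f‖ * (r / 2) := by
    intro x hx
    have hneg := hlow (-x) (by simpa using hx)
    rw [map_neg] at hneg
    exact abs_lt.2 ⟨hlow x hx, by linarith⟩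
  have hf0 : 0 < ‖f‖ := norm_pos_iff.2 fun h => (hfu i₀).ne' (by simp [h])
  obtain ⟨x, hx, hfx⟩ := f.exists_lt_apply_of_lt_opNorm (half_lt_self hf0)
  have hrx := habs (r • x) (by
    rw [mem_ball_zero_iff, norm_smul, Real.norm_of_nonneg hr.le]
    nlinarith)
  rw [map_smul, norm_smul, Real.norm_of_nonneg hr.le] at hrx
  nlinarith

theorem exists_eventually_zero_mem_convexHull_range (E : Type*) [NormedAddCommGroup E]
    [NormedSpace ℝ E] [FiniteDimensional ℝ E] :
    ∃ (n : ℕ) (u₀ : Fin n → E), ∀ᶠ u in 𝓝 u₀, (0 : E) ∈ convexHull ℝ (range u) := by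
  obtain ⟨b, hb, -⟩ := exists_mem_interior_convexHull_affineBasis (univ_mem (f := 𝓝 (0 : E)))
  exact ⟨_, b, eventually_zero_mem_convexHull_range hb⟩

/-- The probability weights carried by the first `n` indices. -/
def weights (n : ℕ) : Set (ℕ → ℝ) :=
  {w | (∀ j, 0 ≤ w j) ∧ (∀ j, n ≤ j → w j = 0) ∧ ∑ j ∈ Finset.range n, w j = 1}

theorem weights_mono {n n' : ℕ} (h : n ≤ n') : weights n ⊆ weights n' := by
  rintro w ⟨hw, hw0, hw1⟩
  refine ⟨hw, fun j hj => hw0 j (h.trans hj), ?_⟩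
  rw [← hw1]
  exact (Finset.sum_subset (Finset.range_mono h) fun j _ hj => hw0 j (by simpa using hj)).symm

theorem sum_smul_eq_of_mem_weights {E : Type*} [AddCommGroup E] [Module ℝ E] {n n' : ℕ}
    (h : n ≤ n') {w : ℕ → ℝ} (hw : w ∈ weights n) (e : ℕ → E) :
    ∑ j ∈ Finset.range n', w j • e j = ∑ j ∈ Finset.range n, w j • e j :=
  (Finset.sum_subset (Finset.range_mono h) fun j _ hj => by
    rw [hw.2.1 j (by simpa using hj), zero_smul]).symm

theorem convex_weights (n : ℕ) : Convex ℝ (weights n) := by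
  rintro w ⟨hw, hw0, hw1⟩ w' ⟨hw', hw0', hw1'⟩ s s' hs hs' hss
  refine ⟨fun j => ?_, fun j hj => ?_, ?_⟩
  · exact add_nonneg (mul_nonneg hs (hw j)) (mul_nonneg hs' (hw' j))
  · simp [hw0 j hj, hw0' j hj]
  · simp only [Pi.add_apply, Pi.smul_apply, smul_eq_mul]
    rw [Finset.sum_add_distrib, ← Finset.mul_sum, ← Finset.mul_sum, hw1, hw1', mul_one, mul_one,
      hss]

theorem isLinearMap_sum_smul {E : Type*} [AddCommGroup E] [Module ℝ E] (e : ℕ → E) (n : ℕ) :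
    IsLinearMap ℝ fun w : ℕ → ℝ => ∑ j ∈ Finset.range n, w j • e j :=
  ⟨fun w w' => by simp [add_smul, Finset.sum_add_distrib],
    fun s w => by simp [mul_smul, Finset.smul_sum]⟩

theorem exists_mem_weights_of_mem_convexHull {E : Type*} [AddCommGroup E] [Module ℝ E]
    {e : ℕ → E} {n : ℕ} {x : E} (hx : x ∈ convexHull ℝ (e '' Iio n)) :
    ∃ w ∈ weights n, ∑ j ∈ Finset.range n, w j • e j = x := by
  refine convexHull_min ?_ ((convex_weights n).is_linear_image (isLinearMap_sum_smul e n)) hx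
  rintro _ ⟨i, hi, rfl⟩
  have hi : i < n := hi
  refine ⟨Pi.single i 1, ⟨fun j => ?_, fun j hj => ?_, ?_⟩, ?_⟩
  · by_cases h : j = i <;> simp [h]
  · simp [(hi.trans_le hj).ne']
  · simp [Pi.single_apply, hi]
  · simp [Pi.single_apply, ite_smul, hi]

theorem exists_continuous_weights {Z E : Type*} [TopologicalSpace Z] [NormalSpace Z]
    [ParacompactSpace Z] [NormedAddCommGroup E] [NormedSpace ℝ E] {ψ : ℕ → Z → E}
    (hψ : ∀ j, Continuous (ψ j)) {N ε : Z → ℝ} (hN : Continuous N) (hε : Continuous ε)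
    (hε0 : ∀ z, 0 < ε z) (h0 : ∀ z, (0 : E) ∈ convexHull ℝ ((fun j => ψ j z) '' Iio ⌈N z⌉₊)) :
    ∃ a : Z → ℕ → ℝ, Continuous a ∧ ∀ z, a z ∈ weights ⌈N z + 1⌉₊ ∧
      ‖∑ j ∈ Finset.range ⌈N z + 1⌉₊, a z j • ψ j z‖ ≤ ε z := by
  have hconvex : ∀ z, Convex ℝ {w ∈ weights ⌈N z + 1⌉₊ |
      ‖∑ j ∈ Finset.range ⌈N z + 1⌉₊, w j • ψ j z‖ ≤ ε z} := fun z => by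
    have hball := (convex_closedBall (0 : E) (ε z)).is_linear_preimage
      (isLinearMap_sum_smul (fun j => ψ j z) ⌈N z + 1⌉₊)
    simp only [preimage, mem_closedBall_zero_iff] at hball
    exact (convex_weights _).inter hball
  obtain ⟨a, ha⟩ := exists_continuous_forall_mem_convex_of_local_const hconvex fun z₀ => by
    obtain ⟨w, hw, hw0⟩ := exists_mem_weights_of_mem_convexHull (h0 z₀)
    refine ⟨w, ?_⟩
    have hN₀ : ∀ᶠ z in 𝓝 z₀, N z₀ < N z + 1 :=
      continuousAt_const.eventually_lt (by fun_prop) (by simp)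
    have hsum : ∀ᶠ z in 𝓝 z₀, ‖∑ j ∈ Finset.range ⌈N z₀⌉₊, w j • ψ j z‖ < ε z := by
      refine ContinuousAt.eventually_lt (by fun_prop) hε.continuousAt ?_
      rw [hw0, norm_zero]
      exact hε0 z₀
    filter_upwards [hN₀, hsum] with z hz hzε
    have hle : ⌈N z₀⌉₊ ≤ ⌈N z + 1⌉₊ := Nat.ceil_le_ceil hz.le
    refine ⟨weights_mono hle hw, ?_⟩
    rw [sum_smul_eq_of_mem_weights hle hw]
    exact hzε.le
  exact ⟨a, a.continuous, ha⟩

theorem exists_continuous_zero_mem_convexHull {Z E : Type*} [TopologicalSpace Z] [NormalSpace Z]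
    [ParacompactSpace Z] [NormedAddCommGroup E] [NormedSpace ℝ E] [FiniteDimensional ℝ E]
    {ψ : ℕ → Z → E} (hψ : ∀ j, Continuous (ψ j)) (hdense : ∀ z, DenseRange fun j => ψ j z) :
    ∃ N : Z → ℝ, Continuous N ∧ ∀ z, (0 : E) ∈ convexHull ℝ ((fun j => ψ j z) '' Iio ⌈N z⌉₊) := by
  obtain ⟨k, u₀, hu₀⟩ := exists_eventually_zero_mem_convexHull_range E
  have hmono : ∀ z {x x' : ℝ}, x ≤ x' → (0 : E) ∈ convexHull ℝ ((fun j => ψ j z) '' Iio ⌈x⌉₊) →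
      (0 : E) ∈ convexHull ℝ ((fun j => ψ j z) '' Iio ⌈x'⌉₊) := fun z x x' hx h =>
    convexHull_mono (image_mono (Iio_subset_Iio (Nat.ceil_le_ceil hx))) h
  obtain ⟨N, hN⟩ := exists_continuous_forall_mem_convex_of_local_const
    (t := fun z => {x : ℝ | (0 : E) ∈ convexHull ℝ ((fun j => ψ j z) '' Iio ⌈x⌉₊)})
    (fun z => (IsUpperSet.ordConnected fun x x' => hmono z).convex) fun z₀ => by
      obtain ⟨J, hJ⟩ := (DenseRange.piMap fun _ : Fin k => hdense z₀).exists_mem_open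
        isOpen_interior ⟨u₀, mem_interior_iff_mem_nhds.2 hu₀⟩
      refine ⟨(Finset.univ.sup J + 1 : ℕ), ?_⟩
      have hcont : Continuous fun z => fun i => ψ (J i) z := continuous_pi fun i => hψ (J i)
      filter_upwards [hcont.continuousAt.eventually_mem (isOpen_interior.mem_nhds hJ)] with z hz
      have hz0 := interior_subset hz
      refine convexHull_mono (range_subset_iff.2 fun i => ?_) (mem_ofPred_eq ▸ hz0)
      rw [Nat.ceil_natCast]
      exact ⟨J i, Nat.lt_succ_of_le (Finset.le_sup (Finset.mem_univ i)), rfl⟩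
  exact ⟨N, N.continuous, hN⟩

theorem exists_continuous_zero_mem_convexHull_of_compact {X K E : Type*} [TopologicalSpace X]
    [TopologicalSpace K] [CompactSpace K] [NormalSpace (X × K)] [ParacompactSpace (X × K)]
    [NormedAddCommGroup E] [NormedSpace ℝ E] [FiniteDimensional ℝ E] {ψ : ℕ → X × K → E}
    (hψ : ∀ j, Continuous (ψ j)) (hdense : ∀ z, DenseRange fun j => ψ j z) :
    ∃ N : X → ℝ, Continuous N ∧
      ∀ z, (0 : E) ∈ convexHull ℝ ((fun j => ψ j z) '' Iio ⌈N z.1⌉₊) := by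
  obtain ⟨N, hN, hN0⟩ := exists_continuous_zero_mem_convexHull hψ hdense
  refine ⟨fun x => sSup ((fun t => N (x, t)) '' univ), isCompact_univ.continuous_sSup hN,
    fun z => convexHull_mono (image_mono (Iio_subset_Iio (Nat.ceil_le_ceil ?_))) (hN0 z)⟩
  exact le_csSup (isCompact_univ.image (by fun_prop)).bddAbove (mem_image_of_mem _ (mem_univ z.2))

theorem exists_relaxed_weights {X E U : Type*} [MetricSpace X] [NormedAddCommGroup E]
    [NormedSpace ℝ E] [FiniteDimensional ℝ E] [TopologicalSpace U] [Nonempty U]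
    [TopologicalSpace.SeparableSpace U] {a b : ℝ} (hab : a ≤ b) {φ : X → ℝ → U → E}
    (hφ : ContinuousOn (fun q : X × ℝ × U => φ q.1 q.2.1 q.2.2) (univ ×ˢ Icc a b ×ˢ univ))
    (hsurj : ∀ ξ, ∀ t ∈ Icc a b, Function.Surjective (φ ξ t)) :
    ∃ (v : ℕ → U) (n : X → ℕ) (α : X × Ioi (0 : ℝ) → ℝ → ℕ → ℝ),
      (∀ ξ₀, ∃ M, ∀ᶠ ξ in 𝓝 ξ₀, n ξ ≤ M) ∧ (Continuous fun q : (X × Ioi (0 : ℝ)) × ℝ => α q.1 q.2) ∧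
      ∀ q t, α q t ∈ weights (n q.1) ∧
        (t ∈ Icc a b → ‖∑ j ∈ Finset.range (n q.1), α q t j • φ q.1 t (v j)‖ ≤ q.2) := by
  set v := TopologicalSpace.denseSeq U
  have hφz : Continuous fun q : (X × Icc a b) × U => φ q.1.1 q.1.2 q.2 :=
    hφ.comp_continuous (f := fun q : (X × Icc a b) × U => (q.1.1, (q.1.2 : ℝ), q.2)) (by fun_prop)
      fun q => ⟨mem_univ _, q.1.2.2, mem_univ _⟩
  obtain ⟨N, hN, hN0⟩ := exists_continuous_zero_mem_convexHull_of_compact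
    (ψ := fun j (z : X × Icc a b) => φ z.1 z.2 (v j))
    (fun j => hφz.comp (f := fun z => (z, v j)) (by fun_prop)) fun z =>
      (hsurj z.1 z.2 z.2.2).denseRange.comp (TopologicalSpace.denseRange_denseSeq U)
        (hφz.comp (f := fun u => (z, u)) (by fun_prop))
  obtain ⟨α, hα, hαw⟩ := exists_continuous_weights
    (ψ := fun j (z : (X × Ioi (0 : ℝ)) × Icc a b) => φ z.1.1 z.2 (v j))
    (N := fun z => N z.1.1) (ε := fun z => z.1.2)
    (fun j => hφz.comp (f := fun z : (X × Ioi (0 : ℝ)) × Icc a b => ((z.1.1, z.2), v j))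
      (by fun_prop)) (by fun_prop) (by fun_prop) (fun z => z.1.2.2) fun z => hN0 (z.1.1, z.2)
  refine ⟨v, fun ξ => ⌈N ξ + 1⌉₊, fun q t => α (q, projIcc a b hab t), fun ξ₀ =>
    ⟨⌈N ξ₀ + 2⌉₊, ?_⟩, by fun_prop, fun q t => ⟨(hαw _).1, fun ht => ?_⟩⟩
  · have hlt : ∀ᶠ ξ in 𝓝 ξ₀, N ξ < N ξ₀ + 1 :=
      hN.continuousAt.eventually_lt continuousAt_const (by simp)
    exact hlt.mono fun ξ hξ => Nat.ceil_le_ceil (by linarith)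
  · have hle := (hαw (q, projIcc a b hab t)).2
    simpa only [projIcc_of_mem hab ht] using hle

end Weights

section Chattering

open MeasureTheory

/-- A smooth approximation of the indicator function of `[c, c']`, which is `0` outside of the
interval and `1` at distance `≥ w` from its complement. -/
noncomputable def bump (w c c' θ : ℝ) : ℝ :=
  Real.smoothTransition ((θ - c) / w) * Real.smoothTransition ((c' - θ) / w)

theorem bump_nonneg (w c c' θ : ℝ) : 0 ≤ bump w c c' θ :=
  mul_nonneg (Real.smoothTransition.nonneg _) (Real.smoothTransition.nonneg _)

theorem bump_le_one (w c c' θ : ℝ) : bump w c c' θ ≤ 1 :=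
  mul_le_one₀ (Real.smoothTransition.le_one _) (Real.smoothTransition.nonneg _)
    (Real.smoothTransition.le_one _)

theorem bump_of_le {w c c' θ : ℝ} (hw : 0 < w) (h : θ ≤ c) : bump w c c' θ = 0 := by
  rw [bump, Real.smoothTransition.zero_of_nonpos
    (div_nonpos_of_nonpos_of_nonneg (sub_nonpos.2 h) hw.le), zero_mul]

theorem bump_of_ge {w c c' θ : ℝ} (hw : 0 < w) (h : c' ≤ θ) : bump w c c' θ = 0 := by
  rw [bump, Real.smoothTransition.zero_of_nonpos (x := (c' - θ) / w)
    (div_nonpos_of_nonpos_of_nonneg (sub_nonpos.2 h) hw.le), mul_zero]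

theorem bump_eq_one {w c c' θ : ℝ} (hw : 0 < w) (h : c + w ≤ θ) (h' : θ ≤ c' - w) :
    bump w c c' θ = 1 := by
  rw [bump, Real.smoothTransition.one_of_one_le ((one_le_div hw).2 (by linarith)),
    Real.smoothTransition.one_of_one_le ((one_le_div hw).2 (by linarith)), mul_one]

theorem bump_self {w c : ℝ} (hw : 0 < w) (θ : ℝ) : bump w c c θ = 0 :=
  (le_total θ c).elim (bump_of_le hw) (bump_of_ge hw)

theorem contDiff_bump (w c c' : ℝ) : ContDiff ℝ 1 (bump w c c') :=
  (Real.smoothTransition.contDiff.comp (by fun_prop)).mul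
    (Real.smoothTransition.contDiff.comp (by fun_prop))

theorem jointC1_bump {Y : Type*} [TopologicalSpace Y] {w c c' : Y → ℝ} (hw : Continuous w)
    (hw0 : ∀ y, 0 < w y) (hc : Continuous c) (hc' : Continuous c') :
    JointC1 fun y θ => bump (w y) (c y) (c' y) θ := by
  have hS : JointC1 fun (_ : Unit) t => Real.smoothTransition t :=
    JointC1.of_contDiff Real.smoothTransition.contDiff
  have hwi : Continuous fun y => (w y)⁻¹ := hw.inv₀ fun y => (hw0 y).ne'
  have h1 := hS.comp_affine (Y' := Y) (π := fun _ => ()) (by fun_prop) hwi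
    (β := fun y => -(c y * (w y)⁻¹)) (by fun_prop)
  have h2 := hS.comp_affine (Y' := Y) (π := fun _ => ()) (by fun_prop) hwi.neg
    (β := fun y => c' y * (w y)⁻¹) (by fun_prop)
  convert! h1.smul h2 using 3 with y θ
  rw [bump, smul_eq_mul]
  congr 2 <;> · simp only [div_eq_mul_inv, Pi.neg_apply]; ring

variable {E U : Type*} [NormedAddCommGroup E] [NormedSpace ℝ E]
  [NormedAddCommGroup U] [NormedSpace ℝ U]

theorem norm_bump_smul_le (w c c' θ : ℝ) (v : U) : ‖bump w c c' θ • v‖ ≤ ‖v‖ := by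
  rw [norm_smul, Real.norm_of_nonneg (bump_nonneg _ _ _ _)]
  exact mul_le_of_le_one_left (norm_nonneg _) (bump_le_one _ _ _ _)

theorem norm_integral_bump_sub_le [CompleteSpace E] {ψ : U → E} (hψ : Continuous ψ) {M R : ℝ}
    (hM : ∀ u, ‖u‖ ≤ R → ‖ψ u‖ ≤ M) {v : U} (hv : ‖v‖ ≤ R) {w c c' : ℝ} (hw : 0 < w)
    (hc : c ≤ c') :
    ‖(∫ θ in c..c', ψ (bump w c c' θ • v)) - (c' - c) • ψ v‖ ≤ 4 * M * w := by
  have hM0 : 0 ≤ M := (norm_nonneg _).trans (hM v hv)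
  have hbc := (contDiff_bump w c c').continuous
  rw [← intervalIntegral.integral_const, ← intervalIntegral.integral_sub
    ((by fun_prop : Continuous fun θ => ψ (bump w c c' θ • v)).intervalIntegrable _ _)
    intervalIntegrable_const]
  set g : ℝ → E := fun θ => ψ (bump w c c' θ • v) - ψ v with hg
  have hgc : Continuous g := by fun_prop
  have hg2 : ∀ θ, ‖g θ‖ ≤ 2 * M := fun θ => (norm_sub_le _ _).trans <| by
    linarith [hM _ ((norm_bump_smul_le w c c' θ v).trans hv), hM v hv]
  have hlen : ∀ a b, a ≤ b → ‖∫ θ in a..b, g θ‖ ≤ 2 * M * (b - a) := fun a b hab => by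
    simpa only [abs_of_nonneg (sub_nonneg.2 hab)] using
      intervalIntegral.norm_integral_le_of_norm_le_const (a := a) (b := b) fun θ _ => hg2 θ
  rcases le_total (c' - c) (2 * w) with h | h
  · refine (hlen c c' hc).trans ?_
    nlinarith
  · have hmid : ∫ θ in (c + w)..(c' - w), g θ = 0 := by
      rw [← intervalIntegral.integral_zero (a := c + w) (b := c' - w) (μ := volume)]
      refine intervalIntegral.integral_congr fun θ hθ => ?_
      rw [uIcc_of_le (by linarith)] at hθ
      simp [hg, bump_eq_one hw hθ.1 hθ.2]
    rw [← intervalIntegral.integral_add_adjacent_intervals (hgc.intervalIntegrable c (c + w))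
      (hgc.intervalIntegrable _ _), ← intervalIntegral.integral_add_adjacent_intervals
      (hgc.intervalIntegrable (c + w) (c' - w)) (hgc.intervalIntegrable _ _), hmid, zero_add]
    refine (norm_add_le _ _).trans ?_
    linarith [hlen c (c + w) (by linarith), hlen (c' - w) c' (by linarith)]

/-- The curve that dwells at the points `v 0, …, v (m - 1)` during the consecutive intervals
`[C j, C (j + 1)]`, up to transitions of length `w`. -/
noncomputable def dwell (w : ℝ) (C : ℕ → ℝ) (m : ℕ) (v : ℕ → U) (θ : ℝ) : U :=
  ∑ j ∈ Finset.range m, bump w (C j) (C (j + 1)) θ • v j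

theorem continuous_dwell (w : ℝ) (C : ℕ → ℝ) (m : ℕ) (v : ℕ → U) :
    Continuous (dwell w C m v) :=
  continuous_finsetSum _ fun j _ => (contDiff_bump w (C j) (C (j + 1))).continuous.smul
    continuous_const

variable {w : ℝ} {C : ℕ → ℝ}

theorem dwell_eq (hw : 0 < w) (hC : Monotone C) {m : ℕ} (v : ℕ → U) {θ : ℝ} {j : ℕ} (hj : j < m)
    (h : C j ≤ θ) (h' : θ ≤ C (j + 1)) :
    dwell w C m v θ = bump w (C j) (C (j + 1)) θ • v j := by
  refine Finset.sum_eq_single j (fun i _ hij => ?_) fun hj' => ?_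
  · rcases hij.lt_or_gt with hij | hij
    · rw [bump_of_ge hw ((hC hij).trans h), zero_smul]
    · rw [bump_of_le hw (h'.trans (hC hij)), zero_smul]
  · exact absurd (Finset.mem_range.2 hj) hj'

theorem dwell_of_le (hw : 0 < w) (hC : Monotone C) (m : ℕ) (v : ℕ → U) {θ : ℝ} (h : θ ≤ C 0) :
    dwell w C m v θ = 0 :=
  Finset.sum_eq_zero fun j _ => by rw [bump_of_le hw (h.trans (hC (Nat.zero_le j))), zero_smul]

theorem dwell_of_ge (hw : 0 < w) (hC : Monotone C) (m : ℕ) (v : ℕ → U) {θ : ℝ} (h : C m ≤ θ) :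
    dwell w C m v θ = 0 :=
  Finset.sum_eq_zero fun j hj => by
    rw [bump_of_ge hw ((hC (Finset.mem_range.1 hj)).trans h), zero_smul]

theorem norm_dwell_le (hw : 0 < w) (hC : Monotone C) {m : ℕ} {v : ℕ → U} {R : ℝ} (hR : 0 ≤ R)
    (hv : ∀ j < m, ‖v j‖ ≤ R) (θ : ℝ) : ‖dwell w C m v θ‖ ≤ R := by
  induction m with
  | zero => simpa [dwell] using hR
  | succ m ih =>
    have hsucc : dwell w C (m + 1) v θ
        = dwell w C m v θ + bump w (C m) (C (m + 1)) θ • v m := Finset.sum_range_succ _ _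
    rw [hsucc]
    rcases le_total θ (C m) with h | h
    · rw [bump_of_le hw h, zero_smul, add_zero]
      exact ih fun j hj => hv j (hj.trans (Nat.lt_succ_self m))
    · rw [dwell_of_ge hw hC m v h, zero_add]
      exact (norm_bump_smul_le _ _ _ _ _).trans (hv m (Nat.lt_succ_self m))

theorem norm_integral_dwell_sub_le [CompleteSpace E] {ψ : U → E} (hψ : Continuous ψ) {M R : ℝ}
    (hM : ∀ u, ‖u‖ ≤ R → ‖ψ u‖ ≤ M) (hw : 0 < w) (hC : Monotone C) {m : ℕ} {v : ℕ → U}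
    (hv : ∀ j < m, ‖v j‖ ≤ R) :
    ‖(∫ θ in C 0..C m, ψ (dwell w C m v θ))
      - ∑ j ∈ Finset.range m, (C (j + 1) - C j) • ψ (v j)‖ ≤ m * (4 * M * w) := by
  have hcont : Continuous fun θ => ψ (dwell w C m v θ) := hψ.comp (continuous_dwell w C m v)
  rw [← intervalIntegral.sum_integral_adjacent_intervals fun k _ =>
    hcont.intervalIntegrable _ _, ← Finset.sum_sub_distrib]
  refine (norm_sum_le _ _).trans ?_
  rw [← nsmul_eq_mul]
  refine (Finset.sum_le_card_nsmul _ _ (4 * M * w) fun j hj => ?_).trans_eq (by simp)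
  have hj' := Finset.mem_range.1 hj
  have hj_eq : ∫ θ in C j..C (j + 1), ψ (dwell w C m v θ)
      = ∫ θ in C j..C (j + 1), ψ (bump w (C j) (C (j + 1)) θ • v j) := by
    refine intervalIntegral.integral_congr fun θ hθ => ?_
    rw [uIcc_of_le (hC (Nat.le_succ j))] at hθ
    simp only [dwell_eq hw hC v hj' hθ.1 hθ.2]
  rw [hj_eq]
  exact norm_integral_bump_sub_le hψ hM (hv j hj') hw (hC (Nat.le_succ j))

/-- The time at which the chattering curve of period `h` started at time `a` reaches its `j`-th
point during its `k`-th period, where `α t` gives the proportions spent at the different points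
during a period starting at time `t`. -/
noncomputable def switchTime (a h : ℝ) (α : ℝ → ℕ → ℝ) (k j : ℕ) : ℝ :=
  a + h * (k + ∑ i ∈ Finset.range j, α (a + h * k) i)

/-- The chattering curve of period `h` started at time `a`: during a period starting at time `t` it
dwells at each point `v j`, `j < n`, for the proportion `α t j` of the period, up to transitions of
length `h ^ 2`. -/
noncomputable def chatter (a h : ℝ) (α : ℝ → ℕ → ℝ) (n : ℕ) (v : ℕ → U) (t : ℝ) : U :=
  dwell (h ^ 2) (switchTime a h α ⌊(t - a) / h⌋₊) n v t

variable {a h : ℝ} {α : ℝ → ℕ → ℝ} {n : ℕ} {v : ℕ → U}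

theorem switchTime_zero (a h : ℝ) (α : ℝ → ℕ → ℝ) (k : ℕ) : switchTime a h α k 0 = a + h * k := by
  simp [switchTime]

theorem switchTime_of_mem_weights (hα : ∀ t, α t ∈ weights n) (k : ℕ) :
    switchTime a h α k n = a + h * (k + 1) := by
  rw [switchTime, (hα _).2.2]

theorem switchTime_succ_sub (a h : ℝ) (α : ℝ → ℕ → ℝ) (k j : ℕ) :
    switchTime a h α k (j + 1) - switchTime a h α k j = h * α (a + h * k) j := by
  simp only [switchTime, Finset.sum_range_succ]
  ring

theorem monotone_switchTime (hh : 0 < h) (hα : ∀ t, α t ∈ weights n) (k : ℕ) :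
    Monotone (switchTime a h α k) :=
  monotone_nat_of_le_succ fun j => sub_nonneg.1 <|
    (mul_nonneg hh.le ((hα _).1 j)).trans_eq (switchTime_succ_sub a h α k j).symm

theorem dwell_switchTime_of_le (hh : 0 < h) (hα : ∀ t, α t ∈ weights n) {k : ℕ} {t : ℝ}
    (ht : t ≤ a + h * k) : dwell (h ^ 2) (switchTime a h α k) n v t = 0 :=
  dwell_of_le (pow_pos hh 2) (monotone_switchTime hh hα k) _ _ (by rwa [switchTime_zero])

theorem dwell_switchTime_of_ge (hh : 0 < h) (hα : ∀ t, α t ∈ weights n) {k : ℕ} {t : ℝ}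
    (ht : a + h * (k + 1) ≤ t) : dwell (h ^ 2) (switchTime a h α k) n v t = 0 :=
  dwell_of_ge (pow_pos hh 2) (monotone_switchTime hh hα k) _ _
    (by rwa [switchTime_of_mem_weights hα])

theorem chatter_eq_sum (hh : 0 < h) (hα : ∀ t, α t ∈ weights n) {K : ℕ} {t : ℝ}
    (ht : t < a + h * K) :
    chatter a h α n v t = ∑ k ∈ Finset.range K, dwell (h ^ 2) (switchTime a h α k) n v t := by
  have hge : ∀ k < ⌊(t - a) / h⌋₊, a + h * (k + 1) ≤ t := by
    intro k hk
    have := (Nat.le_floor_iff' (Nat.succ_ne_zero k)).1 hk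
    rw [le_div_iff₀ hh, Nat.cast_succ] at this
    linarith
  have hle : ∀ k, ⌊(t - a) / h⌋₊ < k → t ≤ a + h * k := by
    intro k hk
    have := Nat.lt_of_floor_lt hk
    rw [div_lt_iff₀ hh] at this
    linarith
  symm
  refine Finset.sum_eq_single _ (fun k _ hk => ?_) fun hK => ?_
  · exact hk.lt_or_gt.elim (fun hk => dwell_switchTime_of_ge hh hα (hge k hk))
      fun hk => dwell_switchTime_of_le hh hα (hle k hk)
  · rw [Finset.mem_range, not_lt] at hK
    refine dwell_switchTime_of_le hh hα (ht.le.trans ?_)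
    gcongr

theorem chatter_eq_dwell (hh : 0 < h) (hα : ∀ t, α t ∈ weights n) {k : ℕ} {t : ℝ}
    (ht : t ∈ Icc (a + h * k) (a + h * (k + 1))) :
    chatter a h α n v t = dwell (h ^ 2) (switchTime a h α k) n v t := by
  rw [chatter_eq_sum hh hα (K := k + 2) (by push_cast; linarith [ht.2])]
  refine Finset.sum_eq_single _ (fun i _ hi => ?_) fun hk => ?_
  · rcases hi.lt_or_gt with hi | hi
    · refine dwell_switchTime_of_ge hh hα (le_trans ?_ ht.1)
      have : (i : ℝ) + 1 ≤ k := by exact_mod_cast hi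
      gcongr
    · refine dwell_switchTime_of_le hh hα (ht.2.trans ?_)
      have : (k : ℝ) + 1 ≤ i := by exact_mod_cast hi
      gcongr
  · exact absurd (Finset.mem_range.2 (by omega)) hk

theorem norm_chatter_le (hh : 0 < h) (hα : ∀ t, α t ∈ weights n) {R : ℝ} (hR : 0 ≤ R)
    (hv : ∀ j < n, ‖v j‖ ≤ R) (t : ℝ) : ‖chatter a h α n v t‖ ≤ R :=
  norm_dwell_le (pow_pos hh 2) (monotone_switchTime hh hα _) hR hv t

theorem jointC1_chatter {Y : Type*} [TopologicalSpace Y] {h : Y → ℝ} {α : Y → ℝ → ℕ → ℝ}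
    {n : Y → ℕ} (a : ℝ) (hh : Continuous h) (hh0 : ∀ y, 0 < h y)
    (hα : Continuous fun q : Y × ℝ => α q.1 q.2) (hαn : ∀ y t, α y t ∈ weights (n y))
    (hn : ∀ y₀, ∃ N, ∀ᶠ y in 𝓝 y₀, n y ≤ N) (v : ℕ → U) :
    JointC1 fun y t => chatter a (h y) (α y) (n y) v t := by
  have hswitch : ∀ k j, Continuous fun y => switchTime a (h y) (α y) k j := fun k j => by
    have hαi : ∀ i, Continuous fun y => α y (a + h y * k) i := fun i =>
      (continuous_apply i).comp (hα.comp (f := fun y => (y, a + h y * k)) (by fun_prop))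
    exact continuous_const.add <| hh.mul <| continuous_const.add <|
      continuous_finsetSum _ fun i _ => hαi i
  refine JointC1.of_eventuallyEq fun y₀ t₀ => ?_
  obtain ⟨N, hN⟩ := hn y₀
  obtain ⟨K, hK⟩ := exists_nat_gt ((t₀ - a) / h y₀)
  rw [div_lt_iff₀ (hh0 y₀)] at hK
  have hbump : JointC1 fun y t => ∑ k ∈ Finset.range K, ∑ j ∈ Finset.range N,
      bump (h y ^ 2) (switchTime a (h y) (α y) k j) (switchTime a (h y) (α y) k (j + 1)) t • v j :=
    JointC1.sum _ fun k _ => JointC1.sum _ fun j _ =>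
      (jointC1_bump (hh.pow 2) (fun y => pow_pos (hh0 y) 2) (hswitch k j)
        (hswitch k (j + 1))).smul (JointC1.const continuous_const)
  refine ⟨_, hbump, ?_⟩
  have hlt : ∀ᶠ q : Y × ℝ in 𝓝 (y₀, t₀), q.2 < a + h q.1 * K :=
    continuous_snd.continuousAt.eventually_lt
      (continuous_const.add ((hh.comp continuous_fst).mul continuous_const)).continuousAt
      (by linarith)
  filter_upwards [(continuous_fst.tendsto (y₀, t₀)).eventually hN, hlt] with q hqN hq
  rw [chatter_eq_sum (hh0 q.1) (hαn q.1) hq]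
  refine Finset.sum_congr rfl fun k _ =>
    Finset.sum_subset (Finset.range_mono hqN) fun j _ hj => ?_
  rw [Finset.mem_range, not_lt] at hj
  have hstep := switchTime_succ_sub a (h q.1) (α q.1) k j
  rw [(hαn _ _).2.1 j hj, mul_zero, sub_eq_zero] at hstep
  rw [hstep, bump_self (pow_pos (hh0 q.1) 2), zero_smul]

theorem norm_integral_comp_chatter_le [CompleteSpace E] {ψ : U → E} (hψ : Continuous ψ) {M R ε : ℝ}
    (hM : ∀ u, ‖u‖ ≤ R → ‖ψ u‖ ≤ M) (hh : 0 < h) (hα : ∀ t, α t ∈ weights n)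
    (hv : ∀ j < n, ‖v j‖ ≤ R) {k : ℕ}
    (hε : ‖∑ j ∈ Finset.range n, α (a + h * k) j • ψ (v j)‖ ≤ ε) :
    ‖∫ t in (a + h * k)..(a + h * (k + 1)), ψ (chatter a h α n v t)‖ ≤
      (ε + 4 * n * M * h) * h := by
  have hdwell : ∫ t in (a + h * k)..(a + h * (k + 1)), ψ (chatter a h α n v t) =
      ∫ t in (a + h * k)..(a + h * (k + 1)), ψ (dwell (h ^ 2) (switchTime a h α k) n v t) := by
    refine intervalIntegral.integral_congr fun t ht => ?_
    rw [uIcc_of_le (by linarith)] at ht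
    simp only [chatter_eq_dwell hh hα ht]
  have hsub := norm_integral_dwell_sub_le hψ hM (pow_pos hh 2)
    (monotone_switchTime (a := a) hh hα k) hv
  simp only [switchTime_zero, switchTime_of_mem_weights hα, switchTime_succ_sub, mul_smul,
    ← Finset.smul_sum] at hsub
  have hsum := norm_smul_le h (∑ j ∈ Finset.range n, α (a + h * k) j • ψ (v j))
  rw [Real.norm_of_nonneg hh.le] at hsum
  rw [hdwell]
  refine (norm_le_norm_add_norm_sub' _ _).trans ((add_le_add hsum hsub).trans ?_)
  nlinarith

theorem norm_integral_le_of_periods {g : ℝ → E} {b M η : ℝ} (hg : ContinuousOn g (Icc a b))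
    (hh : 0 < h) (hη : 0 ≤ η) (hM : ∀ t ∈ Icc a b, ‖g t‖ ≤ M)
    (hper : ∀ k : ℕ, a + h * (k + 1) ≤ b → ‖∫ s in (a + h * k)..(a + h * (k + 1)), g s‖ ≤ η * h)
    {t : ℝ} (ht : t ∈ Icc a b) : ‖∫ s in a..t, g s‖ ≤ η * (b - a) + M * h := by
  set N : ℕ := ⌊(t - a) / h⌋₊
  have hN : h * N ≤ t - a := by
    rw [mul_comm, ← le_div_iff₀ hh]
    exact Nat.floor_le (div_nonneg (sub_nonneg.2 ht.1) hh.le)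
  have hN' : t - a < h * (N + 1) := by
    rw [mul_comm, ← div_lt_iff₀ hh]
    exact Nat.lt_floor_add_one _
  have hhN : 0 ≤ h * N := by positivity
  have hint : ∀ {c d}, c ∈ Icc a b → d ∈ Icc a b → IntervalIntegrable g volume c d := fun hc hd =>
    (hg.mono (uIcc_subset_Icc hc hd)).intervalIntegrable
  have hnode : ∀ k ≤ N, a + h * k ∈ Icc a b := fun k hk => by
    have : h * k ≤ h * N := by gcongr
    exact ⟨by nlinarith [hh, k.cast_nonneg (α := ℝ)], by linarith [ht.2]⟩
  have hfull : ‖∫ s in a..(a + h * N), g s‖ ≤ N * (η * h) := by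
    have hsum := intervalIntegral.sum_integral_adjacent_intervals (n := N) (f := g) (μ := volume)
      (a := fun k : ℕ => a + h * k) fun k hk => hint (hnode k hk.le) (hnode (k + 1) hk)
    simp only [Nat.cast_zero, mul_zero, add_zero, Nat.cast_succ] at hsum
    rw [← hsum, ← nsmul_eq_mul]
    refine (norm_sum_le _ _).trans
      ((Finset.sum_le_card_nsmul _ _ (η * h) fun k hk => hper k ?_).trans_eq (by simp))
    exact_mod_cast (hnode (k + 1) (Finset.mem_range.1 hk)).2
  have hrest : ‖∫ s in (a + h * N)..t, g s‖ ≤ M * (t - (a + h * N)) := by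
    rw [← abs_of_nonneg (show 0 ≤ t - (a + h * N) by linarith)]
    refine intervalIntegral.norm_integral_le_of_norm_le_const fun s hs => hM s ?_
    rw [uIoc_of_le (by linarith)] at hs
    exact ⟨by linarith [hs.1], hs.2.trans ht.2⟩
  have hM0 : 0 ≤ M := (norm_nonneg _).trans (hM t ht)
  rw [← intervalIntegral.integral_add_adjacent_intervals
    (hint ⟨le_rfl, ht.1.trans ht.2⟩ (hnode N le_rfl)) (hint (hnode N le_rfl) ht)]
  refine (norm_add_le _ _).trans ((add_le_add hfull hrest).trans (add_le_add ?_ ?_))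
  · nlinarith [ht.2]
  · exact mul_le_mul_of_nonneg_left (by linarith) hM0

omit [NormedSpace ℝ E] [NormedSpace ℝ U] in
theorem exists_eventually_norm_le_and_norm_sub_le [ProperSpace U] {X : Type*} [TopologicalSpace X]
    {b : ℝ} {φ : X → ℝ → U → E}
    (hφ : ContinuousOn (fun q : X × ℝ × U => φ q.1 q.2.1 q.2.2) (univ ×ˢ Icc a b ×ˢ univ))
    (ξ₀ : X) (R : ℝ) :
    (∃ M, ∀ᶠ ξ in 𝓝 ξ₀, ∀ t ∈ Icc a b, ∀ u, ‖u‖ ≤ R → ‖φ ξ t u‖ ≤ M) ∧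
      ∀ ε > 0, ∃ δ > 0, ∀ᶠ ξ in 𝓝 ξ₀, ∀ t ∈ Icc a b, ∀ t' ∈ Icc a b, |t - t'| < δ →
        ∀ u, ‖u‖ ≤ R → ‖φ ξ t u - φ ξ t' u‖ ≤ ε := by
  set K : Set (ℝ × U) := Icc a b ×ˢ Metric.closedBall 0 R
  have hK : IsCompact K := isCompact_Icc.prod (isCompact_closedBall _ _)
  have hmem : ∀ {t u}, t ∈ Icc a b → ‖u‖ ≤ R → (t, u) ∈ K := fun ht hu =>
    ⟨ht, mem_closedBall_zero_iff.2 hu⟩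
  have hφK : ContinuousOn (fun q : X × ℝ × U => φ q.1 q.2.1 q.2.2) (univ ×ˢ K) :=
    hφ.mono (prod_mono_right (prod_mono_right (subset_univ _)))
  have hφ₀ : ContinuousOn (fun q : ℝ × U => φ ξ₀ q.1 q.2) K :=
    hφK.comp (f := fun q : ℝ × U => (ξ₀, q)) (by fun_prop) fun q hq => ⟨mem_univ _, hq⟩
  refine ⟨?_, fun ε hε => ?_⟩
  · obtain ⟨M, hM⟩ := exists_eventually_norm_le_of_isCompact (g := fun ξ q => φ ξ q.1 q.2) hK hφK ξ₀
    exact ⟨M, hM.mono fun ξ hξ t ht u hu => hξ _ (hmem ht hu)⟩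
  · obtain ⟨δ, hδ, hδK⟩ := Metric.uniformContinuousOn_iff.1
      (hK.uniformContinuousOn_of_continuous hφ₀) (ε / 3) (by positivity)
    have hunif := Metric.tendstoUniformlyOn_iff.1
      (tendstoUniformlyOn_of_isCompact (g := fun ξ q => φ ξ q.1 q.2) hK hφK ξ₀)
      (ε / 3) (by positivity)
    refine ⟨δ, hδ, hunif.mono fun ξ hξ t ht t' ht' htt' u hu => ?_⟩
    have hξ₀ := hδK _ (hmem ht hu) _ (hmem ht' hu)
      (by simpa [Prod.dist_eq, Real.dist_eq] using htt')
    simp only [dist_eq_norm] at hξ₀ hξ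
    have htri := norm_sub_le_norm_sub_add_norm_sub (φ ξ t u) (φ ξ₀ t u) (φ ξ t' u)
    have htri' := norm_sub_le_norm_sub_add_norm_sub (φ ξ₀ t u) (φ ξ₀ t' u) (φ ξ t' u)
    rw [norm_sub_rev (φ ξ t u) (φ ξ₀ t u)] at htri
    linarith [hξ _ (hmem ht hu), hξ _ (hmem ht' hu)]

theorem norm_integral_chatter_le [CompleteSpace E] {f : ℝ → U → E} {b M R ε ω : ℝ}
    (hf : ContinuousOn (fun q : ℝ × U => f q.1 q.2) (Icc a b ×ˢ univ))
    (hM : ∀ t ∈ Icc a b, ∀ u, ‖u‖ ≤ R → ‖f t u‖ ≤ M) (hR : 0 ≤ R) (hε : 0 ≤ ε) (hω : 0 ≤ ω)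
    (hosc : ∀ t ∈ Icc a b, ∀ t' ∈ Icc a b, |t - t'| ≤ h → ∀ u, ‖u‖ ≤ R → ‖f t u - f t' u‖ ≤ ω)
    (hh : 0 < h) (hα : ∀ t, α t ∈ weights n)
    (hαf : ∀ t ∈ Icc a b, ‖∑ j ∈ Finset.range n, α t j • f t (v j)‖ ≤ ε)
    (hv : ∀ j < n, ‖v j‖ ≤ R) (hchatter : Continuous (chatter a h α n v)) {t : ℝ}
    (ht : t ∈ Icc a b) :
    ‖∫ s in a..t, f s (chatter a h α n v s)‖ ≤
      (ω + ε + 4 * n * M * h) * (b - a) + M * h := by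
  have hM0 : 0 ≤ M := (norm_nonneg _).trans (hM t ht 0 (by simpa using hR))
  have hV := norm_chatter_le (a := a) hh hα hR hv
  have hfV : ContinuousOn (fun s => f s (chatter a h α n v s)) (Icc a b) :=
    hf.comp (f := fun s => (s, chatter a h α n v s)) (by fun_prop) fun s hs => ⟨hs, mem_univ _⟩
  refine norm_integral_le_of_periods hfV hh (by positivity) (fun s hs => hM s hs _ (hV s))
    (fun k hk => ?_) ht
  have hka : a + h * k ∈ Icc a b :=
    ⟨by nlinarith [k.cast_nonneg (α := ℝ)], by linarith⟩
  have hperiod : Icc (a + h * k) (a + h * (k + 1)) ⊆ Icc a b := Icc_subset_Icc hka.1 hk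
  have hle : a + h * k ≤ a + h * (k + 1) := by linarith
  have hψ : Continuous (f (a + h * k)) := continuousOn_univ.1 <|
    hf.comp (f := fun u => (a + h * k, u)) (by fun_prop) fun u _ => ⟨hka, mem_univ _⟩
  have hψV : Continuous fun s => f (a + h * k) (chatter a h α n v s) := hψ.comp hchatter
  have hfrozen := norm_integral_comp_chatter_le hψ (hM _ hka) hh hα hv (hαf _ hka)
  have hdiff : ‖∫ s in (a + h * k)..(a + h * (k + 1)), (f s (chatter a h α n v s) -
      f (a + h * k) (chatter a h α n v s))‖ ≤ ω * h := by
    have := intervalIntegral.norm_integral_le_of_norm_le_const (C := ω)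
      (a := a + h * k) (b := a + h * (k + 1)) (f := fun s => f s (chatter a h α n v s) -
        f (a + h * k) (chatter a h α n v s)) fun s hs => by
        rw [uIoc_of_le hle] at hs
        refine hosc s (hperiod ⟨hs.1.le, hs.2⟩) _ hka ?_ _ (hV s)
        rw [abs_of_nonneg (by linarith [hs.1])]
        linarith [hs.2]
    rwa [show a + h * (k + 1) - (a + h * k) = h by ring, abs_of_pos hh] at this
  rw [intervalIntegral.integral_sub
    (((uIcc_of_le hle).symm ▸ hfV.mono hperiod : ContinuousOn _ (uIcc _ _)).intervalIntegrable)
    (hψV.intervalIntegrable _ _)] at hdiff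
  refine (norm_le_norm_add_norm_sub' _ _).trans ((add_le_add hfrozen hdiff).trans_eq ?_)
  ring

theorem exists_chattering {X : Type*} [MetricSpace X] [FiniteDimensional ℝ E] [ProperSpace U]
    {a b : ℝ} (hab : a ≤ b) {φ : X → ℝ → U → E}
    (hφ : ContinuousOn (fun q : X × ℝ × U => φ q.1 q.2.1 q.2.2) (univ ×ˢ Icc a b ×ˢ univ))
    (hsurj : ∀ ξ, ∀ t ∈ Icc a b, Function.Surjective (φ ξ t)) :
    ∃ V : X × Ioi (0 : ℝ) → ℝ → U, JointC1 V ∧ ∀ ξ₀,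
      (∃ R, ∀ᶠ ξ in 𝓝 ξ₀, ∀ h t, ‖V (ξ, h) t‖ ≤ R) ∧
      ∀ ε > 0, ∃ h₀ > 0, ∀ᶠ ξ in 𝓝 ξ₀, ∀ h : Ioi (0 : ℝ), (h : ℝ) ≤ h₀ → ∀ t ∈ Icc a b,
        ‖∫ s in a..t, φ ξ s (V (ξ, h) s)‖ ≤ ε := by
  have := FiniteDimensional.complete ℝ E
  obtain ⟨v, n, α, hn, hα, hαφ⟩ := exists_relaxed_weights hab hφ hsurj
  have hV : JointC1 fun q t => chatter a (q.2 : ℝ) (α q) (n q.1) v t :=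
    jointC1_chatter a (by fun_prop) (fun q : X × Ioi (0 : ℝ) => q.2.2) hα
      (fun q t => (hαφ q t).1)
      (fun q₀ => (hn q₀.1).imp fun N hN => (continuous_fst.tendsto q₀).eventually hN) v
  refine ⟨_, hV, fun ξ₀ => ?_⟩
  obtain ⟨N, hN⟩ := hn ξ₀
  set R : ℝ := ∑ j ∈ Finset.range N, ‖v j‖
  have hR : 0 ≤ R := Finset.sum_nonneg fun j _ => norm_nonneg _
  have hvR : ∀ ξ, n ξ ≤ N → ∀ j < n ξ, ‖v j‖ ≤ R := fun ξ hξ j hj =>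
    Finset.single_le_sum (f := fun j => ‖v j‖) (fun j _ => norm_nonneg _)
      (Finset.mem_range.2 (hj.trans_le hξ))
  refine ⟨⟨R, hN.mono fun ξ hξ h =>
    norm_chatter_le h.2 (fun t => (hαφ (ξ, h) t).1) hR (hvR ξ hξ)⟩, fun ε hε => ?_⟩
  obtain ⟨⟨M, hM⟩, hosc⟩ := exists_eventually_norm_le_and_norm_sub_le hφ ξ₀ R
  obtain ⟨δ, hδ, hoscδ⟩ := hosc (ε / (2 * (b - a + 1))) (div_pos hε (by linarith))
  have hsmall : ∀ᶠ h in 𝓝 (0 : ℝ), h < δ ∧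
      (ε / (2 * (b - a + 1)) + h + 4 * N * M * h) * (b - a) + M * h < ε := by
    refine (eventually_lt_nhds hδ).and (ContinuousAt.eventually_lt (by fun_prop) (by fun_prop) ?_)
    have : ε / (2 * (b - a + 1)) * (b - a) ≤ ε / 2 := by
      rw [div_mul_eq_mul_div, div_le_div_iff₀ (by linarith) two_pos]
      nlinarith
    linarith
  obtain ⟨h₀, hh₀, hball⟩ := Metric.eventually_nhds_iff.1 hsmall
  refine ⟨h₀ / 2, half_pos hh₀, ?_⟩
  filter_upwards [hN, hM, hoscδ] with ξ hξN hξM hξδ h hh t ht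
  have hh0 : (0 : ℝ) < h := h.2
  obtain ⟨hhδ, hhε⟩ := hball (y := h) (by rw [Real.dist_eq, sub_zero, abs_of_pos hh0]; linarith)
  refine (norm_integral_chatter_le
    (hφ.comp (f := fun q : ℝ × U => (ξ, q)) (by fun_prop) fun q hq => ⟨mem_univ _, hq⟩) hξM hR
    hh0.le (div_pos hε (by linarith)).le
    (fun s hs s' hs' hss => hξδ s hs s' hs' (hss.trans_lt hhδ)) hh0
    (fun s => (hαφ (ξ, h) s).1) (fun s hs => (hαφ (ξ, h) s).2 hs) (hvR ξ hξN)
    (hV.continuous.comp (f := fun s : ℝ => ((ξ, h), s)) (by fun_prop)) ht).trans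
    (le_trans ?_ hhε.le)
  have hM0 : 0 ≤ M := (norm_nonneg _).trans (hξM t ht 0 (by simpa using hR))
  have : 0 ≤ b - a := by linarith
  gcongr

end Chattering

section SpatialC1

open scoped NNReal

variable {A B C : Type*} [NormedAddCommGroup A] [NormedSpace ℝ A] [NormedAddCommGroup B]
  [NormedSpace ℝ B] [NormedAddCommGroup C] [NormedSpace ℝ C] {s : Set ℝ} {F : ℝ → A → B}

/-- `F` and its derivative with respect to the second variable are continuous on `s × A`: the
regularity required of a time-dependent vector field. -/
structure SpatialC1 (s : Set ℝ) (F : ℝ → A → B) : Prop where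
  continuousOn : ContinuousOn (fun q : ℝ × A => F q.1 q.2) (s ×ˢ univ)
  differentiable : ∀ t ∈ s, Differentiable ℝ (F t)
  continuousOn_fderiv : ContinuousOn (fun q : ℝ × A => fderiv ℝ (F q.1) q.2) (s ×ˢ univ)

namespace SpatialC1

theorem mono {s' : Set ℝ} (hF : SpatialC1 s F) (h : s' ⊆ s) : SpatialC1 s' F where
  continuousOn := hF.continuousOn.mono (prod_mono_left h)
  differentiable t ht := hF.differentiable t (h ht)
  continuousOn_fderiv := hF.continuousOn_fderiv.mono (prod_mono_left h)

theorem comp_clm (hF : SpatialC1 s F) (L : C →L[ℝ] A) : SpatialC1 s fun t x => F t (L x) where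
  continuousOn := hF.continuousOn.comp (f := fun q : ℝ × C => (q.1, L q.2)) (by fun_prop)
    fun q hq => ⟨hq.1, mem_univ _⟩
  differentiable t ht := (hF.differentiable t ht).comp L.differentiable
  continuousOn_fderiv := by
    have h := hF.continuousOn_fderiv.comp (f := fun q : ℝ × C => (q.1, L q.2))
      (s := s ×ˢ univ) (by fun_prop) fun q hq => ⟨hq.1, mem_univ _⟩
    refine (h.clm_comp (continuousOn_const (c := L))).congr fun q hq => ?_
    exact ((hF.differentiable q.1 hq.1 _).hasFDerivAt.comp q.2 L.hasFDerivAt).fderiv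

theorem clm_comp (hF : SpatialC1 s F) (L : B →L[ℝ] C) : SpatialC1 s fun t x => L (F t x) where
  continuousOn := L.continuous.comp_continuousOn hF.continuousOn
  differentiable t ht := L.differentiable.comp (hF.differentiable t ht)
  continuousOn_fderiv := by
    refine (continuousOn_const (c := L).clm_comp hF.continuousOn_fderiv).congr fun q hq => ?_
    exact (L.hasFDerivAt.comp q.2 (hF.differentiable q.1 hq.1 _).hasFDerivAt).fderiv

theorem pi {ι : Type*} [Fintype ι] {E : ι → Type*} [∀ i, NormedAddCommGroup (E i)]
    [∀ i, NormedSpace ℝ (E i)] {F : ℝ → A → ∀ i, E i}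
    (hF : ∀ i, SpatialC1 s fun t x => F t x i) : SpatialC1 s F where
  continuousOn := continuousOn_pi.2 fun i => (hF i).continuousOn
  differentiable t ht := differentiable_pi.2 fun i => (hF i).differentiable t ht
  continuousOn_fderiv := by
    have h : ∀ q ∈ s ×ˢ (univ : Set A), fderiv ℝ (F q.1) q.2
        = ContinuousLinearMap.pi fun i => fderiv ℝ (fun x => F q.1 x i) q.2 := fun q hq =>
      fderiv_pi fun i => (hF i).differentiable q.1 hq.1 q.2
    refine ContinuousOn.congr ?_ h
    exact (ContinuousLinearMap.piEquivL ℝ A E).continuous.comp_continuousOn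
      (continuousOn_pi.2 fun i => (hF i).continuousOn_fderiv)

theorem of_partial {F : ℝ → A → B → C}
    (hF : ContinuousOn (fun q : ℝ × A × B => F q.1 q.2.1 q.2.2) (s ×ˢ univ))
    (hA : ∀ t ∈ s, ∀ x u, DifferentiableAt ℝ (fun x' => F t x' u) x)
    (hA' : ContinuousOn (fun q : ℝ × A × B => fderiv ℝ (fun x' => F q.1 x' q.2.2) q.2.1)
      (s ×ˢ univ))
    (hB : ∀ t ∈ s, ∀ x u, DifferentiableAt ℝ (fun u' => F t x u') u)
    (hB' : ContinuousOn (fun q : ℝ × A × B => fderiv ℝ (fun u' => F q.1 q.2.1 u') q.2.2)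
      (s ×ˢ univ)) :
    SpatialC1 s fun t (q : A × B) => F t q.1 q.2 := by
  have hslice : ∀ t ∈ s, ∀ q : A × B, (t, q) ∈ s ×ˢ univ := fun t ht q => ⟨ht, mem_univ _⟩
  have hderiv : ∀ t ∈ s, ∀ q : A × B, HasFDerivAt (fun q : A × B => F t q.1 q.2)
      ((fderiv ℝ (fun x => F t x q.2) q.1).coprod (fderiv ℝ (fun u => F t q.1 u) q.2)) q :=
    fun t ht q => (hasStrictFDerivAt_uncurry_coprod (𝕜 := ℝ) (f := F t)
      (f₁ := fun x u => fderiv ℝ (fun x => F t x u) x)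
      (f₂ := fun x u => fderiv ℝ (fun u => F t x u) u)
      (.of_forall fun q => (hA t ht q.1 q.2).hasFDerivAt)
      (.of_forall fun q => (hB t ht q.1 q.2).hasFDerivAt)
      (hA'.comp_continuous (.prodMk_right t) (hslice t ht)).continuousAt
      (hB'.comp_continuous (.prodMk_right t) (hslice t ht)).continuousAt).hasFDerivAt
  refine ⟨hF, fun t ht q => (hderiv t ht q).differentiableAt, ?_⟩
  have hcoprod : Continuous fun L : (A →L[ℝ] C) × (B →L[ℝ] C) => L.1.coprod L.2 :=
    (ContinuousLinearMap.coprodEquivL ℝ).continuous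
  exact (hcoprod.comp_continuousOn (hA'.prodMk hB')).congr fun q hq => (hderiv _ hq.1 _).fderiv

theorem exists_lipschitzOnWith_closedBall [ProperSpace A] (hF : SpatialC1 s F) (hs : IsCompact s)
    (R : ℝ) : ∃ L : ℝ≥0, ∀ t ∈ s, LipschitzOnWith L (F t) (Metric.closedBall 0 R) := by
  obtain ⟨L, hL⟩ := (hs.prod (isCompact_closedBall (0 : A) R)).exists_bound_of_continuousOn
    (hF.continuousOn_fderiv.mono (prod_mono_right (subset_univ _)))
  refine ⟨L.toNNReal, fun t ht => (convex_closedBall _ _).lipschitzOnWith_of_nnnorm_fderiv_le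
    (fun x _ => hF.differentiable t ht x) fun x hx => ?_⟩
  exact NNReal.le_toNNReal_of_coe_le (hL (t, x) ⟨ht, hx⟩)

theorem exists_lipschitzOnWith_closedBall_left [ProperSpace A] [ProperSpace B] {F : ℝ → A → B → C}
    (hF : SpatialC1 s fun t (q : A × B) => F t q.1 q.2) (hs : IsCompact s) (R : ℝ) :
    ∃ L : ℝ≥0, ∀ t ∈ s, ∀ u, ‖u‖ ≤ R →
      LipschitzOnWith L (fun x => F t x u) (Metric.closedBall 0 R) := by
  obtain ⟨L, hL⟩ := hF.exists_lipschitzOnWith_closedBall hs R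
  refine ⟨L, fun t ht u hu => ?_⟩
  simpa only [mul_one, Function.comp_def] using
    (hL t ht).comp (LipschitzWith.prodMk_right u).lipschitzOnWith
      fun x hx => by simpa [Prod.norm_def, hu] using hx

theorem exists_approximatesLinearOn (hF : SpatialC1 s F) {t₀ : ℝ} (ht₀ : t₀ ∈ s) (x₀ : A)
    {κ : ℝ≥0} (hκ : 0 < κ) : ∃ r > 0, ∀ t ∈ s, |t - t₀| ≤ r →
      ApproximatesLinearOn (F t) (fderiv ℝ (F t₀) x₀) (Metric.closedBall x₀ r) κ := by
  obtain ⟨r, hr, h⟩ := Metric.continuousOn_iff.1 hF.continuousOn_fderiv (t₀, x₀)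
    ⟨ht₀, mem_univ _⟩ κ (mod_cast hκ)
  refine ⟨r / 2, by positivity, fun t ht htr x hx y hy => ?_⟩
  refine (convex_closedBall x₀ (r / 2)).norm_image_sub_le_of_norm_fderiv_le'
    (fun z _ => hF.differentiable t ht z) (fun z hz => ?_) hy hx
  refine ((dist_eq_norm _ _).symm.trans_lt (h (t, z) ⟨ht, mem_univ _⟩ ?_)).le
  exact (max_le htr hz).trans_lt (half_lt_self hr)

end SpatialC1

end SpatialC1

section Blocks

variable {m : ℕ → ℕ} {r s : ℕ}

theorem extend_of_lt (x : State m r) (v : Block m r) {j : ℕ} (h : j < r) (h' : j < r + 1) :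
    extend x v ⟨j, h'⟩ = x ⟨j, h⟩ :=
  Fin.snoc_castSucc (α := fun j : Fin (r + 1) => Block m j) v x ⟨j, h⟩

theorem extend_last (x : State m r) (v : Block m r) (h : r < r + 1) : extend x v ⟨r, h⟩ = v :=
  Fin.snoc_last (α := fun j : Fin (r + 1) => Block m j) v x

theorem extend_trunc (h : r + 1 ≤ s) (x : State m s) :
    extend (trunc (r.le_succ.trans h) x) (x ⟨r, h⟩) = trunc h x := by
  funext ⟨j, hj⟩
  obtain hj' | rfl := Nat.lt_succ_iff_lt_or_eq.1 hj
  · exact extend_of_lt _ _ hj' hj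
  · exact extend_last _ _ hj

theorem norm_trunc_le (h : r ≤ s) (x : State m s) : ‖trunc h x‖ ≤ ‖x‖ :=
  (pi_norm_le_iff_of_nonneg (norm_nonneg _)).2 fun j => norm_le_pi_norm x (Fin.castLE h j)

theorem norm_extend_le (x : State m r) (v : Block m r) : ‖extend x v‖ ≤ max ‖x‖ ‖v‖ := by
  refine (pi_norm_le_iff_of_nonneg (le_max_of_le_left (norm_nonneg _))).2 fun ⟨j, hj⟩ => ?_
  obtain hj' | rfl := Nat.lt_succ_iff_lt_or_eq.1 hj
  · rw [extend_of_lt x v hj']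
    exact le_max_of_le_left (norm_le_pi_norm x ⟨j, hj'⟩)
  · rw [extend_last]
    exact le_max_right _ _

/-- `trunc` as a continuous linear map. -/
noncomputable def truncL (m : ℕ → ℕ) (h : r ≤ s) : State m s →L[ℝ] State m r :=
  ContinuousLinearMap.pi fun j => ContinuousLinearMap.proj (Fin.castLE h j)

/-- `extend` as a continuous linear map. -/
noncomputable def extendL (m : ℕ → ℕ) (r : ℕ) : State m r × Block m r →L[ℝ] State m (r + 1) :=
  LinearMap.toContinuousLinearMap
    { toFun := fun q => extend q.1 q.2
      map_add' := fun q q' => by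
        funext j
        refine Fin.lastCases ?_ (fun j => ?_) j <;> simp [extend]
      map_smul' := fun c q => by
        funext j
        refine Fin.lastCases ?_ (fun j => ?_) j <;> simp [extend] }

/-- The linear map that completes a tuple of `r` blocks by zero blocks to a tuple of `s` blocks. -/
noncomputable def padL (m : ℕ → ℕ) (r s : ℕ) : State m r →L[ℝ] State m s :=
  ContinuousLinearMap.pi fun j : Fin s =>
    if h : (j : ℕ) < r then
      ContinuousLinearMap.proj (R := ℝ) (φ := fun k : Fin r => Block m k) ⟨j, h⟩ else 0

theorem trunc_padL (h : r ≤ s) (x : State m r) : trunc h (padL m r s x) = x := by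
  funext j
  simp [trunc, padL]

theorem padL_eq_trunc (h : r ≤ s) (x : State m s) : padL m s r x = trunc h x := by
  funext j
  have hj : (j : ℕ) < s := j.2.trans_le h
  simp [trunc, padL, hj]
  rfl

end Blocks

section Regularity

variable {m : ℕ → ℕ} {ν : ℕ} {f : (i : ℕ) → ℝ → State m (i + 2) → Block m i}

theorem RegularField.spatialC1_field {t₀ T : ℝ} (hI : RegularField ν f t₀ T) :
    SpatialC1 (Icc t₀ T) fun t (q : State m ν × Block m ν) => field f ν t q.1 q.2 :=
  .of_partial hI.continuousOn hI.differentiable_state hI.continuousOn_fderiv_state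
    hI.differentiable_control hI.continuousOn_fderiv_control

theorem SpatialC1.component {s : Set ℝ}
    (h : SpatialC1 s fun t (q : State m ν × Block m ν) => field f ν t q.1 q.2) {i : ℕ}
    (hi : i < ν) : SpatialC1 s (f i) := by
  let split : State m (i + 2) →L[ℝ] State m ν × Block m ν :=
    ((truncL m ν.le_succ).prod (ContinuousLinearMap.proj (Fin.last ν))).comp
      (padL m (i + 2) (ν + 1))
  have hf : ∀ t z, field f ν t (split z).1 (split z).2 ⟨i, hi⟩ = f i t z := fun t z =>
    congrArg (f i t) ((congrArg _ (extend_trunc le_rfl (padL m (i + 2) (ν + 1) z))).trans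
      (trunc_padL (Nat.succ_le_succ hi) z))
  simpa only [ContinuousLinearMap.proj_apply, hf] using
    (h.comp_clm split).clm_comp (ContinuousLinearMap.proj (⟨i, hi⟩ : Fin ν))

theorem spatialC1_field {s : Set ℝ} {p : ℕ} (h : ∀ i < p, SpatialC1 s (f i)) :
    SpatialC1 s fun t (q : State m p × Block m p) => field f p t q.1 q.2 :=
  .pi fun i => (h i i.2).comp_clm ((truncL m (Nat.succ_le_succ i.2)).comp (extendL m p))

end Regularity

section Jets

open scoped Nat

/-- A smooth function that vanishes near `0` and coincides with `(s - 1) ^ j / j!` near `1`, so that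
its derivatives of all orders can be prescribed at `0` and `1`. -/
noncomputable def jet (j : ℕ) (s : ℝ) : ℝ :=
  (s - 1) ^ j / j ! * Real.smoothTransition (3 * s - 1)

theorem contDiff_jet (j n : ℕ) : ContDiff ℝ n (jet j) :=
  ContDiff.mul (by fun_prop)
    ((Real.smoothTransition.contDiff (n := (n : ℕ∞))).comp (by fun_prop))

theorem hasDerivAt_iteratedDeriv_jet (j l : ℕ) (s : ℝ) :
    HasDerivAt (iteratedDeriv l (jet j)) (iteratedDeriv (l + 1) (jet j) s) s := by
  rw [iteratedDeriv_succ]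
  exact ((contDiff_jet j (l + 1)).differentiable_iteratedDeriv l
    (by exact_mod_cast Nat.lt_succ_self l) s).hasDerivAt

theorem iteratedDeriv_jet_of_lt (j l : ℕ) {s : ℝ} (hs : s < 1 / 3) :
    iteratedDeriv l (jet j) s = 0 := by
  have h : jet j =ᶠ[𝓝 s] fun _ => 0 := by
    filter_upwards [gt_mem_nhds hs] with u hu
    rw [jet, Real.smoothTransition.zero_of_nonpos (by linarith), mul_zero]
  rw [h.iteratedDeriv_eq]
  simp

theorem iteratedDeriv_jet_of_ge (j l : ℕ) {s : ℝ} (hs : 1 ≤ s) :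
    iteratedDeriv l (jet j) s = j.descFactorial l * (s - 1) ^ (j - l) / j ! := by
  have h : jet j =ᶠ[𝓝 s] fun s => (s - 1) ^ j / j ! := by
    filter_upwards [lt_mem_nhds (show 2 / 3 < s by linarith)] with u hu
    rw [jet, Real.smoothTransition.one_of_one_le (by linarith), mul_one]
  rw [h.iteratedDeriv_eq, iteratedDeriv_div_const,
    iteratedDeriv_comp_sub_const (f := fun x : ℝ => x ^ j)]
  exact congrArg (· / (j ! : ℝ)) (iteratedDeriv_pow j l)

theorem iteratedDeriv_jet_one (j l : ℕ) : iteratedDeriv l (jet j) 1 = if l = j then 1 else 0 := by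
  rw [iteratedDeriv_jet_of_ge j l le_rfl, sub_self]
  obtain h | rfl | h := lt_trichotomy l j
  · simp [h.ne, Nat.sub_ne_zero_of_lt h]
  · simp [Nat.descFactorial_self, Nat.factorial_ne_zero]
  · simp [h.ne', Nat.descFactorial_of_lt h]

end Jets

section Chain

theorem exists_compatible_family {F : Type*} [NormedAddCommGroup F] [NormedSpace ℝ F]
    {E : ℕ → Type*} [∀ l, NormedAddCommGroup (E l)] [∀ l, NormedSpace ℝ (E l)] {p : ℕ}
    {B : (l : ℕ) → E (l + 1) →L[ℝ] E l} {C : (l : ℕ) → E l →L[ℝ] E (l + 1)}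
    (hC : ∀ l < p, B l ∘L C l = .id ℝ (E l)) :
    ∀ (j : ℕ) (π : F →L[ℝ] E j),
      ∃ A : (l : ℕ) → F →L[ℝ] E l, A j = π ∧ ∀ l < p, A l = B l ∘L A (l + 1)
  | 0, π => ⟨Nat.rec π fun l Al => C l ∘L Al, rfl, fun l hl => by
      rw [← ContinuousLinearMap.comp_assoc, hC l hl, ContinuousLinearMap.id_comp]⟩
  | j + 1, π => by
    obtain ⟨A, hA, hAl⟩ := exists_compatible_family (E := fun l => E (l + 1)) (p := p - 1)
      (B := fun l => B (l + 1)) (C := fun l => C (l + 1)) (fun l hl => hC _ (by omega)) j π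
    refine ⟨Nat.rec (B 0 ∘L A 0) fun l _ => A l, hA, fun l hl => ?_⟩
    cases l with
    | zero => rfl
    | succ l => exact hAl l (by omega)

/-- A curve in the space of linear maps into the `l`-th block.  If the maps `A j` are compatible
with the arrows `B l` of a chain, then the derivative of the `l`-th curve is the image of the
`(l + 1)`-st one. -/
noncomputable def chainCurve {F : Type*} [NormedAddCommGroup F] [NormedSpace ℝ F]
    {E : ℕ → Type*} [∀ l, NormedAddCommGroup (E l)] [∀ l, NormedSpace ℝ (E l)] {p : ℕ}
    (A : Fin p → (l : ℕ) → F →L[ℝ] E l) (l : ℕ) (s : ℝ) : F →L[ℝ] E l :=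
  ∑ j : Fin p, iteratedDeriv l (jet j) s • A j l

section chainCurve

variable {F : Type*} [NormedAddCommGroup F] [NormedSpace ℝ F] {E : ℕ → Type*}
  [∀ l, NormedAddCommGroup (E l)] [∀ l, NormedSpace ℝ (E l)] {p : ℕ}
  (A : Fin p → (l : ℕ) → F →L[ℝ] E l)

theorem hasDerivAt_chainCurve {l : ℕ} {B : E (l + 1) →L[ℝ] E l}
    (hA : ∀ j, A j l = B ∘L A j (l + 1)) (s : ℝ) :
    HasDerivAt (chainCurve A l) (B ∘L chainCurve A (l + 1) s) s := by
  have h : B ∘L chainCurve A (l + 1) s = ∑ j : Fin p, iteratedDeriv (l + 1) (jet j) s • A j l := by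
    simp only [chainCurve, ContinuousLinearMap.comp_finsetSum, ContinuousLinearMap.comp_smul, hA]
  rw [h]
  exact .fun_sum fun j _ => (hasDerivAt_iteratedDeriv_jet j l s).smul_const (A j l)

theorem contDiff_chainCurve (l : ℕ) : ContDiff ℝ 1 (chainCurve A l) := by
  refine ContDiff.sum fun j _ => ContDiff.fun_smul ?_ contDiff_const
  rw [contDiff_one_iff_deriv, ← iteratedDeriv_succ]
  exact ⟨fun s => (hasDerivAt_iteratedDeriv_jet j l s).differentiableAt,
    continuous_iff_continuousAt.2 fun s => (hasDerivAt_iteratedDeriv_jet j (l + 1) s).continuousAt⟩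

theorem chainCurve_of_lt (l : ℕ) {s : ℝ} (hs : s < 1 / 3) : chainCurve A l s = 0 :=
  Finset.sum_eq_zero fun j _ => by rw [iteratedDeriv_jet_of_lt _ _ hs, zero_smul]

theorem chainCurve_one (l : Fin p) : chainCurve A l 1 = A l l := by
  simp [chainCurve, iteratedDeriv_jet_one, Fin.val_inj]

theorem chainCurve_of_ge {s : ℝ} (hs : 1 ≤ s) : chainCurve A p s = 0 :=
  Finset.sum_eq_zero fun j _ => by
    rw [iteratedDeriv_jet_of_ge _ _ hs, Nat.descFactorial_of_lt j.2, Nat.cast_zero, zero_mul,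
      zero_div, zero_smul]

end chainCurve

variable {m : ℕ → ℕ}

/-- The linear triangular field whose `i`-th block is `B i` applied to block number `i + 1` of the
tuple made of the state and the control. -/
noncomputable def chainL (B : (i : ℕ) → Block m (i + 1) →L[ℝ] Block m i) (p : ℕ) :
    State m p × Block m p →L[ℝ] State m p :=
  ContinuousLinearMap.pi fun i : Fin p => B i ∘L ContinuousLinearMap.proj i.succ ∘L extendL m p

theorem chainL_apply (B : (i : ℕ) → Block m (i + 1) →L[ℝ] Block m i) {p : ℕ}
    (q : State m p × Block m p) (i : Fin p) : chainL B p q i = B i (extend q.1 q.2 i.succ) := rfl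

theorem extend_restrict (y : (l : ℕ) → Block m l) (p : ℕ) :
    extend (fun j : Fin p => y j) (y p) = fun j : Fin (p + 1) => y j := by
  funext ⟨j, hj⟩
  obtain hj' | rfl := Nat.lt_succ_iff_lt_or_eq.1 hj
  · exact extend_of_lt _ _ hj' hj
  · exact extend_last _ _ hj

theorem exists_steeringCurves_chainL {p : ℕ} (B : (i : ℕ) → Block m (i + 1) →L[ℝ] Block m i)
    (hB : ∀ i < p, Function.Surjective (B i)) :
    ∃ (QX : ℝ → State m p →L[ℝ] State m p) (QU : ℝ → State m p →L[ℝ] Block m p),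
      SteeringCurves (chainL B p ∘L .inl ℝ _ _) (chainL B p ∘L .inr ℝ _ _) QX QU ∧
      ContDiff ℝ 1 QU ∧ (∀ s < 1 / 3, QU s = 0) ∧ ∀ s, 1 ≤ s → QU s = 0 := by
  have hC : ∀ i, ∃ C : Block m i →L[ℝ] Block m (i + 1), i < p → B i ∘L C = .id ℝ _ := fun i => by
    by_cases hi : i < p
    · obtain ⟨C, hC⟩ := (B i).toLinearMap.exists_rightInverse_of_surjective
        (LinearMap.range_eq_top.2 (hB i hi))
      exact ⟨LinearMap.toContinuousLinearMap C, fun _ =>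
        ContinuousLinearMap.ext fun x => LinearMap.congr_fun hC x⟩
    · exact ⟨0, fun h => absurd h hi⟩
  choose C hC using hC
  choose A hAj hAl using fun j : Fin p => exists_compatible_family (F := State m p) hC j
    (ContinuousLinearMap.proj (R := ℝ) (φ := fun k : Fin p => Block m k) j)
  refine ⟨fun s => ContinuousLinearMap.pi fun i : Fin p => chainCurve A i s, chainCurve A p,
    ⟨fun s => ?_, (contDiff_chainCurve A p).continuous, ?_, ?_⟩, contDiff_chainCurve A p,
    fun s => chainCurve_of_lt A p, fun s => chainCurve_of_ge A⟩
  · have h : HasDerivAt (fun s => fun i : Fin p => chainCurve A i s)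
        (fun i : Fin p => B i ∘L chainCurve A (i + 1) s) s :=
      hasDerivAt_pi.2 fun i => hasDerivAt_chainCurve A (fun j => hAl j i i.2) s
    convert! (ContinuousLinearMap.piEquivL ℝ (State m p) fun i : Fin p => Block m i).hasFDerivAt
      |>.comp_hasDerivAt s h using 1
    rw [ContinuousLinearMap.comp_assoc, ContinuousLinearMap.comp_assoc,
      ← ContinuousLinearMap.comp_add]
    ext1 x
    funext i
    have hsum : (ContinuousLinearMap.inl ℝ (State m p) (Block m p) ∘L
        (ContinuousLinearMap.pi fun i : Fin p => chainCurve A i s) +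
        ContinuousLinearMap.inr ℝ (State m p) (Block m p) ∘L chainCurve A p s) x
        = (fun j : Fin p => chainCurve A j s x, chainCurve A p s x) := by
      simp
    rw [ContinuousLinearMap.comp_apply, hsum, chainL_apply,
      extend_restrict fun l => chainCurve A l s x]
    rfl
  · ext1 x
    funext i
    simp [chainCurve_of_lt A _ (show (0 : ℝ) < 1 / 3 by norm_num)]
  · ext1 x
    funext i
    simp [chainCurve_one, hAj]

end Chain

section ApproximatesLinearOn

open Metric
open scoped NNReal

variable {E F Q : Type*} [NormedAddCommGroup E] [NormedSpace ℝ E] [NormedAddCommGroup F]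
  [NormedSpace ℝ F] [NormedAddCommGroup Q] [NormedSpace ℝ Q]

theorem approximatesLinearOn_of_norm_sub_le {g : E → F} {D D' : E →L[ℝ] F} {s : Set E} {c κ : ℝ≥0}
    (hg : ApproximatesLinearOn g D s c) (h : c + ‖D - D'‖ ≤ κ) : ApproximatesLinearOn g D' s κ := by
  intro x hx y hy
  calc ‖g x - g y - D' (x - y)‖ = ‖(g x - g y - D (x - y)) + (D - D') (x - y)‖ := by
        rw [sub_apply, sub_add_sub_cancel]
    _ ≤ c * ‖x - y‖ + ‖D - D'‖ * ‖x - y‖ :=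
        norm_add_le_of_le (hg x hx y hy) ((D - D').le_opNorm _)
    _ = (c + ‖D - D'‖) * ‖x - y‖ := (add_mul _ _ _).symm
    _ ≤ κ * ‖x - y‖ := by gcongr

theorem approximatesLinearOn_pi {ι : Type*} [Fintype ι] {F : ι → Type*}
    [∀ i, NormedAddCommGroup (F i)] [∀ i, NormedSpace ℝ (F i)] {g : E → ∀ i, F i}
    {D : E →L[ℝ] ∀ i, F i} {s : Set E} {κ : ℝ≥0}
    (h : ∀ i, ApproximatesLinearOn (fun x => g x i) (ContinuousLinearMap.proj i ∘L D) s κ) :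
    ApproximatesLinearOn g D s κ := fun x hx y hy =>
  (pi_norm_le_iff_of_nonneg (by positivity)).2 fun i => h i x hx y hy

theorem approximatesLinearOn_inv_smul {g : E → F} {D : E →L[ℝ] F} {z₀ z : E} {ρ : ℝ} {c : ℝ≥0}
    (hg : ApproximatesLinearOn g D (closedBall z₀ ρ) c) (hz : ‖z - z₀‖ ≤ ρ / 2) {N : Q →L[ℝ] E}
    (hN : ∀ q, ‖N q‖ ≤ ‖q‖) {a : ℝ} (ha : 0 < a) (ha' : a ≤ 1) (w : F) :
    ApproximatesLinearOn (fun q => a⁻¹ • (g (z + a • N q) - w)) (D ∘L N) (closedBall 0 (ρ / 2))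
      c := by
  have hmem : ∀ q ∈ closedBall (0 : Q) (ρ / 2), z + a • N q ∈ closedBall z₀ ρ := fun q hq => by
    rw [mem_closedBall_zero_iff] at hq
    rw [mem_closedBall_iff_norm, add_sub_right_comm, ← add_halves ρ]
    refine norm_add_le_of_le hz ?_
    rw [norm_smul, Real.norm_of_nonneg ha.le]
    exact (mul_le_of_le_one_left (norm_nonneg _) ha').trans ((hN q).trans hq)
  intro q hq q' hq'
  have hdiff : z + a • N q - (z + a • N q') = a • N (q - q') := by
    rw [add_sub_add_left_eq_sub, ← smul_sub, map_sub]
  have hg := hg _ (hmem q hq) _ (hmem q' hq')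
  rw [hdiff, map_smul, norm_smul, Real.norm_of_nonneg ha.le] at hg
  calc ‖a⁻¹ • (g (z + a • N q) - w) - a⁻¹ • (g (z + a • N q') - w) - (D ∘L N) (q - q')‖
      = a⁻¹ * ‖g (z + a • N q) - g (z + a • N q') - a • D (N (q - q'))‖ := by
        rw [← norm_smul_of_nonneg (inv_nonneg.2 ha.le), smul_sub _ (_ - _) (a • _),
          inv_smul_smul₀ ha.ne', ← smul_sub, sub_sub_sub_cancel_right,
          ContinuousLinearMap.comp_apply]
    _ ≤ a⁻¹ * (c * (a * ‖N (q - q')‖)) := by gcongr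
    _ = c * ‖N (q - q')‖ := by field_simp
    _ ≤ c * ‖q - q'‖ := by gcongr; exact hN _

end ApproximatesLinearOn

section Scaling

open Metric
open scoped NNReal

variable {m : ℕ → ℕ}

/-- The anisotropic dilation that multiplies block number `j` by `δ ^ (p - j)`; it is used for
tuples of at most `p + 1` blocks, for which the subtraction does not truncate. -/
noncomputable def dilate (δ : ℝ) (p : ℕ) {r : ℕ} : State m r →L[ℝ] State m r :=
  ContinuousLinearMap.pi fun j => δ ^ (p - j : ℕ) • ContinuousLinearMap.proj j

theorem dilate_apply (δ : ℝ) (p : ℕ) {r : ℕ} (Z : State m r) (j : Fin r) :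
    dilate δ p Z j = δ ^ (p - j : ℕ) • Z j := rfl

theorem norm_dilate_le {δ : ℝ} (h0 : 0 ≤ δ) (h1 : δ ≤ 1) (p : ℕ) {r : ℕ} (Z : State m r) :
    ‖dilate δ p Z‖ ≤ ‖Z‖ := by
  refine (pi_norm_le_iff_of_nonneg (norm_nonneg _)).2 fun j => ?_
  rw [dilate_apply, norm_smul, Real.norm_of_nonneg (by positivity)]
  exact (mul_le_of_le_one_left (norm_nonneg _) (pow_le_one₀ h0 h1)).trans (norm_le_pi_norm Z j)

theorem continuous_dilate (p : ℕ) {r : ℕ} : Continuous fun q : ℝ × State m r => dilate q.1 p q.2 :=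
  continuous_pi fun j => (continuous_fst.pow _).smul ((continuous_apply j).comp continuous_snd)

theorem norm_dilate_sub_le {δ : ℝ} (h0 : 0 ≤ δ) (h1 : δ ≤ 1) {r : ℕ} (Z : State m (r + 1)) :
    ‖dilate δ r Z - extend (r := r) 0 (Z (Fin.last r))‖ ≤ δ * ‖Z‖ := by
  refine (pi_norm_le_iff_of_nonneg (by positivity)).2 fun ⟨j, hj⟩ => ?_
  rw [Pi.sub_apply, dilate_apply]
  obtain hj' | rfl := Nat.lt_succ_iff_lt_or_eq.1 hj
  · rw [extend_of_lt _ _ hj', Pi.zero_apply, sub_zero, norm_smul,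
      Real.norm_of_nonneg (by positivity)]
    exact mul_le_mul (pow_le_of_le_one h0 h1 (Nat.sub_ne_zero_of_lt hj')) (norm_le_pi_norm Z _)
      (norm_nonneg _) h0
  · rw [extend_last, Nat.sub_self, pow_zero, one_smul]
    exact (norm_eq_zero.2 (sub_self _)).trans_le (by positivity)

theorem extend_add_dilate (δ : ℝ) {p : ℕ} (e x : State m p) (w v : Block m p) (j : Fin (p + 1)) :
    extend (e + dilate δ p x) (w + v) j = extend e w j + δ ^ (p - j : ℕ) • extend x v j := by
  obtain ⟨j, hj⟩ := j
  obtain hj' | rfl := Nat.lt_succ_iff_lt_or_eq.1 hj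
  · simp only [extend_of_lt _ _ hj', Pi.add_apply, dilate_apply]
  · simp only [extend_last, Nat.sub_self, pow_zero, one_smul]

theorem trunc_extend_add_dilate (δ : ℝ) {p i : ℕ} (hi : i < p) (e x : State m p)
    (w v : Block m p) :
    trunc (Nat.succ_le_succ hi) (extend (e + dilate δ p x) (w + v))
      = trunc (Nat.succ_le_succ hi) (extend e w)
        + δ ^ (p - 1 - i) • dilate δ (i + 1) (trunc (Nat.succ_le_succ hi) (extend x v)) := by
  funext j
  have hj : p - j = (p - 1 - i) + (i + 1 - j) := by omega
  rw [Pi.add_apply, Pi.smul_apply, dilate_apply, smul_smul, ← pow_add, ← hj]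
  exact extend_add_dilate δ e x w v _

variable {f : (i : ℕ) → ℝ → State m (i + 2) → Block m i}

/-- The right-hand side of the equation satisfied by `X` when `x (t₁ + δ s) = y + dilate δ p (X s)`
solves the triangular system with control `v₀ + V`: here `e`, `W`, `w` stand for the values at
`t = t₁ + δ s` of `y`, of its velocity, and of `v₀`. -/
noncomputable def rescaledField (f : (i : ℕ) → ℝ → State m (i + 2) → Block m i) {p : ℕ}
    (δ t : ℝ) (e W : State m p) (w : Block m p) (X : State m p) (V : Block m p) : State m p :=
  fun i => (δ ^ (p - 1 - i : ℕ))⁻¹ • (field f p t (e + dilate δ p X) (w + V) i - W i)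

/-- The partial derivative of `f i (t₁, ·)` with respect to its last block at the initial part of
`z`; `padL` stands for the truncation, so that no bound on `i` is needed. -/
noncomputable def lastPartial (f : (i : ℕ) → ℝ → State m (i + 2) → Block m i) (t₁ : ℝ) {s : ℕ}
    (z : State m s) (i : ℕ) : Block m (i + 1) →L[ℝ] Block m i :=
  fderiv ℝ (f i t₁) (padL m s (i + 2) z) ∘L extendL m (i + 1) ∘L .inr ℝ _ _

theorem lastPartial_of_le {t₁ : ℝ} {s i : ℕ} (h : i + 2 ≤ s) (z : State m s) :
    lastPartial f t₁ z i
      = fderiv ℝ (f i t₁) (trunc h z) ∘L extendL m (i + 1) ∘L .inr ℝ _ _ := by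
  rw [lastPartial, padL_eq_trunc h]

theorem surjective_lastPartial {t₁ : ℝ} {s i : ℕ} (h : i + 2 ≤ s) {z : State m s}
    (hf : DifferentiableAt ℝ (f i t₁) (trunc h z))
    (hrank : Module.finrank ℝ (LinearMap.range (fderiv ℝ
      (fun v => f i t₁ (extend (trunc ((i + 1).le_succ.trans h) z) v)) (z ⟨i + 1, h⟩)).toLinearMap)
      = m i) :
    Function.Surjective (lastPartial f t₁ z i) := by
  have hext : HasFDerivAt (fun v => extend (trunc ((i + 1).le_succ.trans h) z) v)
      (extendL m (i + 1) ∘L .inr ℝ _ _) (z ⟨i + 1, h⟩) :=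
    (extendL m (i + 1)).hasFDerivAt.comp (z ⟨i + 1, h⟩)
      (hasFDerivAt_prodMk_right (trunc ((i + 1).le_succ.trans h) z) _)
  rw [← extend_trunc] at hf
  have hderiv : fderiv ℝ (fun v => f i t₁ (extend (trunc ((i + 1).le_succ.trans h) z) v))
      (z ⟨i + 1, h⟩) = lastPartial f t₁ z i := by
    rw [lastPartial_of_le h, ← extend_trunc h]
    exact (hf.hasFDerivAt.comp _ hext).fderiv
  rw [hderiv] at hrank
  exact LinearMap.range_eq_top.1 (Submodule.eq_top_of_finrank_eq
    (hrank.trans (finrank_euclideanSpace_fin (𝕜 := ℝ)).symm))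

theorem approximatesLinearOn_rescaledField_apply {p i : ℕ} (hi : i < p) {t : ℝ}
    {z₀ : State m (i + 2)} {D : State m (i + 2) →L[ℝ] Block m i} {ρ : ℝ} {c κ : ℝ≥0}
    (hf : ApproximatesLinearOn (f i t) D (closedBall z₀ ρ) c) {e : State m p} {w : Block m p}
    (hz : ‖trunc (Nat.succ_le_succ hi) (extend e w) - z₀‖ ≤ ρ / 2) {δ : ℝ} (hδ : 0 < δ)
    (hδ1 : δ ≤ 1) (hκ : c + ‖D‖ * δ ≤ κ) (W : State m p) :
    ApproximatesLinearOn
      (fun q : State m p × Block m p => rescaledField f δ t e W w q.1 q.2 ⟨i, hi⟩)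
      ((D ∘L extendL m (i + 1) ∘L .inr ℝ _ _) ∘L
        ContinuousLinearMap.proj (Fin.succ ⟨i, hi⟩) ∘L extendL m p) (closedBall 0 (ρ / 2)) κ := by
  have htr : ∀ q : State m p × Block m p,
      ‖trunc (Nat.succ_le_succ hi) (extend q.1 q.2)‖ ≤ ‖q‖ := fun q =>
    (norm_trunc_le _ _).trans (norm_extend_le q.1 q.2)
  let N := (dilate δ (i + 1) (r := i + 2)) ∘L truncL m (Nat.succ_le_succ hi) ∘L extendL m p
  have happrox := approximatesLinearOn_inv_smul hf hz (N := N)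
    (fun q => (norm_dilate_le hδ.le hδ1 _ _).trans (htr q)) (pow_pos hδ (p - 1 - i))
    (pow_le_one₀ hδ.le hδ1) (W ⟨i, hi⟩)
  have hN : ∀ q : State m p × Block m p, trunc (Nat.succ_le_succ hi) (extend e w)
      + δ ^ (p - 1 - i) • N q
      = trunc (Nat.succ_le_succ hi) (extend (e + dilate δ p q.1) (w + q.2)) := fun q =>
    (trunc_extend_add_dilate δ hi e q.1 w q.2).symm
  simp only [hN] at happrox
  refine approximatesLinearOn_of_norm_sub_le happrox ((add_le_add_right ?_ _).trans hκ)
  refine ContinuousLinearMap.opNorm_le_bound _ (by positivity) fun q => ?_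
  calc _ = ‖D (N q - extend (r := i + 1) 0 (extend q.1 q.2 (Fin.succ ⟨i, hi⟩)))‖ := by
        rw [map_sub]
        rfl
    _ ≤ ‖D‖ * (δ * ‖trunc (Nat.succ_le_succ hi) (extend q.1 q.2)‖) :=
        (D.le_opNorm _).trans (by gcongr; exact norm_dilate_sub_le hδ.le hδ1 _)
    _ ≤ ‖D‖ * (δ * ‖q‖) := by gcongr; exact htr q
    _ = ‖D‖ * δ * ‖q‖ := (mul_assoc _ _ _).symm

theorem exists_approximatesLinearOn_rescaledField {s : Set ℝ} {p : ℕ}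
    (hf : ∀ i < p, SpatialC1 s (f i)) {t₁ : ℝ} (ht₁ : t₁ ∈ s) (x₀ : State m p) (v₀ : Block m p)
    {κ : ℝ≥0} (hκ : 0 < κ) :
    ∀ᶠ r in 𝓝[>] (0 : ℝ), ∀ δ ∈ Ioc 0 r, ∀ t ∈ s, |t - t₁| ≤ r → ∀ (e W : State m p)
      (w : Block m p), ‖e - x₀‖ ≤ r → ‖w - v₀‖ ≤ r →
      ApproximatesLinearOn (fun q : State m p × Block m p => rescaledField f δ t e W w q.1 q.2)
        (chainL (lastPartial f t₁ (extend x₀ v₀)) p) (closedBall 0 r) κ := by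
  suffices h : ∀ i : Fin p, ∀ᶠ r in 𝓝[>] (0 : ℝ), ∀ δ ∈ Ioc 0 r, ∀ t ∈ s, |t - t₁| ≤ r →
      ∀ (e W : State m p) (w : Block m p), ‖e - x₀‖ ≤ r → ‖w - v₀‖ ≤ r →
      ApproximatesLinearOn (fun q : State m p × Block m p => rescaledField f δ t e W w q.1 q.2 i)
        (ContinuousLinearMap.proj i ∘L chainL (lastPartial f t₁ (extend x₀ v₀)) p)
        (closedBall 0 r) κ by
    filter_upwards [eventually_all.2 h] with r hr δ hδ t ht htr e W w he hw
    exact approximatesLinearOn_pi fun i => hr i δ hδ t ht htr e W w he hw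
  intro i
  have hi : (i : ℕ) + 2 ≤ p + 1 := Nat.succ_le_succ i.2
  obtain ⟨ρ, hρ, happrox⟩ := (hf i i.2).exists_approximatesLinearOn ht₁
    (trunc hi (extend x₀ v₀)) (half_pos hκ)
  set D := fderiv ℝ (f i t₁) (trunc hi (extend x₀ v₀))
  have hsmall : Tendsto (fun r : ℝ => ((κ / 2 : ℝ≥0) : ℝ) + ‖D‖ * r) (𝓝[>] 0)
      (𝓝 ((κ / 2 : ℝ≥0) : ℝ)) := by
    have h : Continuous fun r : ℝ => ((κ / 2 : ℝ≥0) : ℝ) + ‖D‖ * r := by fun_prop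
    simpa using (h.tendsto 0).mono_left nhdsWithin_le_nhds
  filter_upwards [Ioc_mem_nhdsGT one_pos, Ioc_mem_nhdsGT (half_pos hρ),
    hsmall.eventually_le_const (NNReal.coe_lt_coe.2 (NNReal.half_lt_self hκ.ne'))]
    with r hr1 hrρ hrκ δ hδ t ht htr e W w he hw
  have hz : ‖trunc hi (extend e w) - trunc hi (extend x₀ v₀)‖ ≤ ρ / 2 := by
    have hsub : extend e w - extend x₀ v₀ = extend (e - x₀) (w - v₀) :=
      (map_sub (extendL m p) (e, w) (x₀, v₀)).symm
    calc _ = ‖trunc hi (extend (e - x₀) (w - v₀))‖ := by rw [← hsub]; rfl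
      _ ≤ ρ / 2 := (norm_trunc_le _ _).trans ((norm_extend_le _ _).trans
        (max_le (he.trans hrρ.2) (hw.trans hrρ.2)))
  have hD := approximatesLinearOn_rescaledField_apply i.2
    (happrox t ht (htr.trans (hrρ.2.trans (half_le_self hρ.le)))) hz hδ.1 (hδ.2.trans hr1.2)
    (κ := κ) (hrκ.trans' (by gcongr; exact hδ.2)) W
  have hchain : ContinuousLinearMap.proj i ∘L chainL (lastPartial f t₁ (extend x₀ v₀)) p
      = (D ∘L extendL m (i + 1) ∘L .inr ℝ _ _) ∘L
        ContinuousLinearMap.proj i.succ ∘L extendL m p := by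
    rw [← lastPartial_of_le hi]
    rfl
  rw [hchain]
  exact hD.mono_set (closedBall_subset_closedBall hrρ.2)

end Scaling

section ChainCurves

variable {m : ℕ → ℕ} {P : Type*} [TopologicalSpace P]

/-- `y` is a continuous family of `C¹` curves on `[a, b]`, with velocities `W`, that satisfy those
equations of the triangular system in which the control does not occur. -/
structure ChainCurves (f : (i : ℕ) → ℝ → State m (i + 2) → Block m i) (p : ℕ) (a b : ℝ)
    (y W : P → ℝ → State m p) : Prop where
  continuousOn : ContinuousOn (fun q : P × ℝ => y q.1 q.2) (univ ×ˢ Icc a b)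
  continuousOn_velocity : ContinuousOn (fun q : P × ℝ => W q.1 q.2) (univ ×ˢ Icc a b)
  hasDerivWithinAt : ∀ q, ∀ t ∈ Icc a b, HasDerivWithinAt (y q) (W q t) (Icc a b) t
  velocity_eq : ∀ q, ∀ t ∈ Icc a b, ∀ (i : ℕ) (hi : i + 2 ≤ p),
    W q t ⟨i, i.lt_succ_self.trans hi⟩ = f i t (trunc hi (y q t))

variable {f : (i : ℕ) → ℝ → State m (i + 2) → Block m i} {p : ℕ} {a b : ℝ}
  {y W : P → ℝ → State m p}

theorem ChainCurves.comp (h : ChainCurves f p a b y W) {P' : Type*} [TopologicalSpace P']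
    {π : P' → P} (hπ : Continuous π) :
    ChainCurves f p a b (fun q => y (π q)) (fun q => W (π q)) where
  continuousOn := h.continuousOn.comp (f := fun q : P' × ℝ => (π q.1, q.2)) (by fun_prop)
    fun _ hq => ⟨mem_univ _, hq.2⟩
  continuousOn_velocity := h.continuousOn_velocity.comp (f := fun q : P' × ℝ => (π q.1, q.2))
    (by fun_prop) fun _ hq => ⟨mem_univ _, hq.2⟩
  hasDerivWithinAt q := h.hasDerivWithinAt (π q)
  velocity_eq q := h.velocity_eq (π q)

omit [TopologicalSpace P] in
theorem field_of_lt (t : ℝ) (x : State m p) (v : Block m p) {i : ℕ} (hi : i + 2 ≤ p) :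
    field f p t x v ⟨i, i.lt_succ_self.trans hi⟩ = f i t (trunc hi x) :=
  congrArg (f i t) (funext fun j => extend_of_lt x v (j.2.trans_le hi) _)

end ChainCurves

section RescaledField

open Metric
open scoped NNReal

variable {m : ℕ → ℕ} {f : (i : ℕ) → ℝ → State m (i + 2) → Block m i} {p : ℕ}

theorem continuousOn_rescaledField {Z : Type*} [TopologicalSpace Z] {S : Set Z} {s : Set ℝ}
    (hf : SpatialC1 s fun t (q : State m p × Block m p) => field f p t q.1 q.2)
    {δ t : Z → ℝ} {e W X : Z → State m p} {w V : Z → Block m p} (hδ : ContinuousOn δ S)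
    (hδ0 : ∀ z ∈ S, δ z ≠ 0) (ht : ContinuousOn t S) (hts : MapsTo t S s) (he : ContinuousOn e S)
    (hW : ContinuousOn W S) (hw : ContinuousOn w S) (hX : ContinuousOn X S)
    (hV : ContinuousOn V S) :
    ContinuousOn (fun z => rescaledField f (δ z) (t z) (e z) (W z) (w z) (X z) (V z)) S := by
  have hfield := hf.continuousOn.comp (ht.prodMk ((he.add
    ((continuous_dilate p).comp_continuousOn (hδ.prodMk hX))).prodMk (hw.add hV)))
    fun z hz => ⟨hts hz, mem_univ _⟩
  exact continuousOn_pi.2 fun i =>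
    ((hδ.pow _).inv₀ fun z hz => pow_ne_zero _ (hδ0 z hz)).smul
      ((continuousOn_pi.1 hfield i).sub (continuousOn_pi.1 hW i))

theorem norm_rescaledField_zero_le {δ t ε : ℝ} {e W : State m p} {w : Block m p}
    (hW : ∀ (i : ℕ) (hi : i + 2 ≤ p), W ⟨i, i.lt_succ_self.trans hi⟩ = f i t (trunc hi e))
    (hε : ‖field f p t e w - W‖ ≤ ε) : ‖rescaledField f δ t e W w 0 0‖ ≤ ε := by
  have hε0 : 0 ≤ ε := (norm_nonneg _).trans hε
  refine (pi_norm_le_iff_of_nonneg hε0).2 fun ⟨i, hi⟩ => ?_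
  rw [rescaledField, map_zero, add_zero, add_zero]
  obtain hi2 | hi2 : i + 2 ≤ p ∨ p - 1 - i = 0 := by omega
  · have h0 : field f p t e w ⟨i, hi⟩ - W ⟨i, hi⟩ = 0 :=
      sub_eq_zero.2 ((field_of_lt t e w hi2).trans (hW i hi2).symm)
    rwa [h0, smul_zero, norm_zero]
  · rw [hi2, pow_zero, inv_one, one_smul]
    exact (norm_le_pi_norm (field f p t e w - W) ⟨i, hi⟩).trans hε

theorem isIntegralCurveOn_add_dilate {δ t₁ : ℝ} (hδ : 0 < δ) {y W : ℝ → State m p}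
    (hy : ∀ t ∈ Icc t₁ (t₁ + δ), HasDerivWithinAt y (W t) (Icc t₁ (t₁ + δ)) t)
    {w V : ℝ → Block m p} {X : ℝ → State m p}
    (hX : IsIntegralCurveOn X (fun s x => rescaledField f δ (t₁ + δ * s) (y (t₁ + δ * s))
      (W (t₁ + δ * s)) (w (t₁ + δ * s)) x (V s)) (Icc 0 1)) :
    IsIntegralCurveOn (fun t => y t + dilate δ p (X ((t - t₁) / δ)))
      (fun t x => field f p t x (w t + V ((t - t₁) / δ))) (Icc t₁ (t₁ + δ)) := by
  have hmaps : MapsTo (fun t => (t - t₁) / δ) (Icc t₁ (t₁ + δ)) (Icc 0 1) := fun t ht =>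
    ⟨div_nonneg (by linarith [ht.1]) hδ.le, (div_le_one hδ).2 (by linarith [ht.2])⟩
  intro t ht
  have htime : t₁ + δ * ((t - t₁) / δ) = t := by
    rw [mul_div_cancel₀ _ hδ.ne', add_sub_cancel]
  have haff : HasDerivWithinAt (fun t => (t - t₁) / δ) (1 / δ) (Icc t₁ (t₁ + δ)) t :=
    (((hasDerivAt_id t).sub_const t₁).div_const δ).hasDerivWithinAt
  have hXt := HasDerivWithinAt.scomp (h := fun t => (t - t₁) / δ) t (hX _ (hmaps ht)) haff hmaps
  simp only [htime] at hXt
  convert! (hy t ht).add ((dilate δ p).hasFDerivAt.comp_hasDerivWithinAt t hXt) using 1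
  funext i
  have hpow : δ ^ (p - i : ℕ) * (1 / δ) * (δ ^ (p - 1 - i : ℕ))⁻¹ = 1 := by
    rw [show p - (i : ℕ) = (p - 1 - i) + 1 by omega, pow_succ]
    field_simp
  rw [Pi.add_apply, dilate_apply, Pi.smul_apply, rescaledField, smul_smul, smul_smul, hpow,
    one_smul, add_sub_cancel]

end RescaledField

section LocalSteering

open Metric
open scoped NNReal

variable {m : ℕ → ℕ} {f : (i : ℕ) → ℝ → State m (i + 2) → Block m i} {p : ℕ} {t₁ T : ℝ}
  {P : Type*} [TopologicalSpace P] {y W : P → ℝ → State m p} {v₀ : ℝ → Block m p}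

theorem eventually_norm_field_sub_le (hf : ∀ i < p, SpatialC1 (Icc t₁ T) (f i)) (hT : t₁ ≤ T)
    (x₀ : State m p) (hv₀ : Continuous v₀) {ε : ℝ} (hε : 0 < ε) :
    ∀ᶠ r in 𝓝[>] (0 : ℝ), ∀ t ∈ Icc t₁ T, |t - t₁| ≤ r → ∀ x, ‖x - x₀‖ ≤ r →
      ‖field f p t x (v₀ t) - field f p t₁ x₀ (v₀ t₁)‖ ≤ ε := by
  have hfield : ContinuousOn (fun q : ℝ × State m p => field f p q.1 q.2 (v₀ q.1))
      (Icc t₁ T ×ˢ univ) :=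
    (spatialC1_field hf).continuousOn.comp (f := fun q : ℝ × State m p => (q.1, q.2, v₀ q.1))
      (by fun_prop) fun q hq => ⟨hq.1, mem_univ _⟩
  obtain ⟨ρ, hρ, hfield'⟩ :=
    Metric.continuousOn_iff.1 hfield (t₁, x₀) ⟨⟨le_rfl, hT⟩, mem_univ _⟩ ε hε
  filter_upwards [Ioo_mem_nhdsGT hρ] with r hr t ht htr x hx
  rw [← dist_eq_norm] at hx ⊢
  exact (hfield' (t, x) ⟨ht, mem_univ _⟩ (max_lt (htr.trans_lt hr.2) (hx.trans_lt hr.2))).le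

theorem eventually_nearLinearField_rescaledField (hf : ∀ i < p, SpatialC1 (Icc t₁ T) (f i))
    (hT : t₁ ≤ T) (x₀ : State m p) (hv₀ : Continuous v₀) {κ : ℝ≥0} (hκ : 0 < κ) :
    ∃ ρ > 0, ∀ᶠ r in 𝓝[>] (0 : ℝ), ∀ {y W : P → ℝ → State m p}, ChainCurves f p t₁ T y W →
      ∀ (q : P), ∀ δ ∈ Ioc 0 r, t₁ + δ ≤ T →
      (∀ t ∈ Icc t₁ (t₁ + δ), ‖y q t - x₀‖ ≤ r ∧ ‖W q t - field f p t₁ x₀ (v₀ t₁)‖ ≤ r) →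
      NearLinearField (chainL (lastPartial f t₁ (extend x₀ (v₀ t₁))) p ∘L .inl ℝ _ _)
        (chainL (lastPartial f t₁ (extend x₀ (v₀ t₁))) p ∘L .inr ℝ _ _) κ ρ
        (fun s => rescaledField f δ (t₁ + δ * s) (y q (t₁ + δ * s)) (W q (t₁ + δ * s))
          (v₀ (t₁ + δ * s))) := by
  have ht₁ : t₁ ∈ Icc t₁ T := ⟨le_rfl, hT⟩
  obtain ⟨ρ, happrox, hρ⟩ := ((exists_approximatesLinearOn_rescaledField hf ht₁ x₀ (v₀ t₁)
    hκ).and self_mem_nhdsWithin).exists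
  have hκρ : 0 < κ * ρ / 2 := by positivity
  obtain ⟨ρ₁, hρ₁, hv₀'⟩ := Metric.continuousAt_iff.1 (hv₀.continuousAt (x := t₁)) ρ hρ
  refine ⟨ρ, hρ, ?_⟩
  filter_upwards [Ioc_mem_nhdsGT hρ, Ioc_mem_nhdsGT hκρ, Ioo_mem_nhdsGT hρ₁,
    eventually_norm_field_sub_le hf hT x₀ hv₀ hκρ] with r hrρ hrκ hrρ₁ hfield y W hy q δ hδ hδT hyW
  have htime : ∀ s ∈ Icc (0 : ℝ) 1, t₁ + δ * s ∈ Icc t₁ (t₁ + δ) ∧ t₁ + δ * s ∈ Icc t₁ T ∧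
      |t₁ + δ * s - t₁| ≤ r := fun s hs => by
    have h0 : 0 ≤ δ * s := mul_nonneg hδ.1.le hs.1
    have h1 : δ * s ≤ δ := mul_le_of_le_one_right hδ.1.le hs.2
    refine ⟨⟨by linarith, by linarith⟩, ⟨by linarith, by linarith⟩, ?_⟩
    rw [add_sub_cancel_left, abs_of_nonneg h0]
    exact h1.trans hδ.2
  refine ⟨?_, fun s hs => ?_, fun s hs => ?_⟩
  · have hmaps : MapsTo (fun z : ℝ × State m p × Block m p => (q, t₁ + δ * z.1))
        (Icc 0 1 ×ˢ univ) (univ ×ˢ Icc t₁ T) := fun z hz => ⟨mem_univ _, (htime _ hz.1).2.1⟩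
    exact continuousOn_rescaledField (spatialC1_field hf) continuousOn_const
      (fun _ _ => hδ.1.ne') (by fun_prop) (fun z hz => (htime _ hz.1).2.1)
      (hy.continuousOn.comp (by fun_prop) hmaps)
      (hy.continuousOn_velocity.comp (by fun_prop) hmaps) (by fun_prop) (by fun_prop)
      (by fun_prop)
  · obtain ⟨ht, htT, htr⟩ := htime s hs
    rw [ContinuousLinearMap.coprod_comp_inl_inr]
    refine happrox δ ⟨hδ.1, hδ.2.trans hrρ.2⟩ _ htT (htr.trans hrρ.2) _ _ _
      ((hyW _ ht).1.trans hrρ.2) ?_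
    rw [← dist_eq_norm]
    exact (hv₀' (htr.trans_lt hrρ₁.2)).le
  · obtain ⟨ht, htT, htr⟩ := htime s hs
    refine norm_rescaledField_zero_le (hy.velocity_eq q _ htT) ?_
    have hnear := hfield _ htT htr _ (hyW _ ht).1
    have hvel := (norm_sub_rev _ _).trans_le ((hyW _ ht).2.trans hrκ.2)
    calc _ ≤ _ := norm_sub_le_norm_sub_add_norm_sub _ (field f p t₁ x₀ (v₀ t₁)) _
      _ ≤ κ * ρ / 2 + κ * ρ / 2 := add_le_add hnear hvel
      _ = κ * ρ := add_halves _

theorem exists_local_steering (hf : ∀ i < p, SpatialC1 (Icc t₁ T) (f i)) (hT : t₁ ≤ T)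
    (x₀ : State m p) (hv₀ : Continuous v₀)
    (hB : ∀ i < p, Function.Surjective (lastPartial f t₁ (extend x₀ (v₀ t₁)) i)) :
    ∃ QU : ℝ → State m p →L[ℝ] Block m p, ContDiff ℝ 1 QU ∧ (∀ s < 1 / 3, QU s = 0) ∧
      (∀ s, 1 ≤ s → QU s = 0) ∧ ∀ᶠ r in 𝓝[>] (0 : ℝ), ∀ {y W : P → ℝ → State m p},
        ChainCurves f p t₁ T y W → ∀ {δ : P → ℝ}, Continuous δ → (∀ q, δ q ∈ Ioc 0 r) →
        (∀ q, t₁ + δ q ≤ T) →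
        (∀ q, ∀ t ∈ Icc t₁ (t₁ + δ q),
          ‖y q t - x₀‖ ≤ r ∧ ‖W q t - field f p t₁ x₀ (v₀ t₁)‖ ≤ r) →
        ∀ {η : P → State m p}, Continuous η → (∀ q, ‖η q‖ ≤ r) →
        ∃ c : P → State m p, Continuous c ∧ ∀ q, ∃ x : ℝ → State m p,
          x t₁ = y q t₁ ∧ x (t₁ + δ q) = y q (t₁ + δ q) + dilate (δ q) p (η q) ∧
          IsIntegralCurveOn x (fun t x => field f p t x (v₀ t + QU ((t - t₁) / δ q) (c q)))
            (Icc t₁ (t₁ + δ q)) := by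
  obtain ⟨QX, QU, hQ, hQU, hQU0, hQU1⟩ := exists_steeringCurves_chainL _ hB
  obtain ⟨κ, hκ, hsteer⟩ := hQ.exists_steering (P := P)
  obtain ⟨ρ, hρ, hnear⟩ := eventually_nearLinearField_rescaledField (P := P) hf hT x₀ hv₀ hκ
  refine ⟨QU, hQU, hQU0, hQU1, ?_⟩
  filter_upwards [hnear, Ioc_mem_nhdsGT (show 0 < κ * ρ by positivity)]
    with r hnear hrκ y W hy δ hδ hδr hδT hyW η hη hηr
  have hmaps : MapsTo (fun z : P × ℝ × State m p × Block m p => (z.1, t₁ + δ z.1 * z.2.1))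
      (univ ×ˢ Icc 0 1 ×ˢ univ) (univ ×ˢ Icc t₁ T) := fun z hz =>
    ⟨mem_univ _, by nlinarith [(hδr z.1).1, hz.2.1.1],
      by nlinarith [(hδr z.1).1, hz.2.1.2, hδT z.1]⟩
  obtain ⟨c, hc, hX⟩ := hsteer ρ hρ (fun q s => rescaledField f (δ q) (t₁ + δ q * s)
      (y q (t₁ + δ q * s)) (W q (t₁ + δ q * s)) (v₀ (t₁ + δ q * s))) η
    (continuousOn_rescaledField (spatialC1_field hf) (by fun_prop)
      (fun z _ => (hδr z.1).1.ne') (by fun_prop) (fun z hz => (hmaps hz).2)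
      (hy.continuousOn.comp (by fun_prop) hmaps)
      (hy.continuousOn_velocity.comp (by fun_prop) hmaps) (by fun_prop) (by fun_prop)
      (by fun_prop))
    (fun q => hnear hy q (δ q) (hδr q) (hδT q) (hyW q)) hη fun q => (hηr q).trans hrκ.2
  refine ⟨c, hc, fun q => ?_⟩
  obtain ⟨X, hX0, hX1, hX⟩ := hX q
  have hδ0 := (hδr q).1
  refine ⟨_, ?_, ?_, isIntegralCurveOn_add_dilate hδ0 (fun t ht =>
    (hy.hasDerivWithinAt q t ⟨ht.1, ht.2.trans (hδT q)⟩).mono (Icc_subset_Icc_right (hδT q))) hX⟩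
  · rw [sub_self, zero_div, hX0, map_zero, add_zero]
  · rw [add_sub_cancel_left, div_self hδ0.ne', hX1]

end LocalSteering

section Tracking

open Metric MeasureTheory
open scoped NNReal

variable {E E₁ U X : Type*} [NormedAddCommGroup E] [NormedSpace ℝ E]
  [NormedAddCommGroup E₁] [NormedSpace ℝ E₁]
  [NormedAddCommGroup U] {a b : ℝ}

theorem norm_integral_le_of_eq_zero_on_middle {g : ℝ → E} {M h t : ℝ} (hh : 0 ≤ h)
    (ht : t ∈ Icc a b) (hM : ∀ s ∈ Icc a b, ‖g s‖ ≤ M) (h0 : ∀ s ∈ Icc (a + h) (b - h), g s = 0) :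
    ‖∫ s in t..b, g s‖ ≤ M * (2 * h) := by
  have hM0 : 0 ≤ M := (norm_nonneg _).trans (hM t ht)
  let S : Set ℝ := Ioc t b ∩ (Icc a (a + h) ∪ Icc (b - h) b)
  have hS : volume.real S ≤ 2 * h := calc
    volume.real S ≤ volume.real (Icc a (a + h) ∪ Icc (b - h) b) :=
      measureReal_mono inter_subset_right
        (measure_union_lt_top (by simp) (by simp)).ne
    _ ≤ volume.real (Icc a (a + h)) + volume.real (Icc (b - h) b) := measureReal_union_le _ _
    _ = 2 * h := by
      rw [Real.volume_real_Icc_of_le (by linarith), Real.volume_real_Icc_of_le (by linarith)]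
      ring
  rw [intervalIntegral.integral_of_le ht.2,
    setIntegral_eq_of_subset_of_forall_sdiff_eq_zero measurableSet_Ioc
      (inter_subset_left : S ⊆ Ioc t b) fun s hs => h0 s ?_]
  · refine (norm_setIntegral_le_of_norm_le_const ?_ fun s hs => ?_).trans (by gcongr)
    · exact (measure_mono inter_subset_left).trans_lt (by simp : volume (Ioc t b) < ⊤)
    · exact hM s ⟨ht.1.trans hs.1.1.le, hs.1.2⟩
  · by_contra hmid
    refine hs.2 ⟨hs.1, ?_⟩
    rcases not_and_or.1 hmid with hlt | hlt
    · exact .inl ⟨ht.1.trans hs.1.1.le, (not_le.1 hlt).le⟩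
    · exact .inr ⟨(not_le.1 hlt).le, hs.1.2⟩

theorem norm_integral_le_of_eqOn_middle {g G : ℝ → E} {M h ε t : ℝ}
    (hg : ContinuousOn g (Icc a b)) (hG : ContinuousOn G (Icc a b)) (hh : 0 ≤ h)
    (ht : t ∈ Icc a b) (hgM : ∀ s ∈ Icc a b, ‖g s‖ ≤ M) (hGM : ∀ s ∈ Icc a b, ‖G s‖ ≤ M)
    (hgG : EqOn g G (Icc (a + h) (b - h))) (hGε : ‖∫ s in t..b, G s‖ ≤ ε) :
    ‖∫ s in t..b, g s‖ ≤ ε + 4 * M * h := by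
  have hint : ∀ {k : ℝ → E}, ContinuousOn k (Icc a b) → IntervalIntegrable k volume t b :=
    fun hk => (hk.mono (by rw [uIcc_of_le ht.2]; exact Icc_subset_Icc_left ht.1)).intervalIntegrable
  have hdiff := norm_integral_le_of_eq_zero_on_middle (g := fun s => g s - G s) hh ht
    (fun s hs => (norm_sub_le _ _).trans (add_le_add (hgM s hs) (hGM s hs)))
    fun s hs => sub_eq_zero.2 (hgG hs)
  rw [intervalIntegral.integral_sub (hint hg) (hint hG)] at hdiff
  linarith [norm_le_norm_add_norm_sub' (∫ s in t..b, g s) (∫ s in t..b, G s)]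

theorem exists_isIntegralCurveOn_near_of_norm_integral_le [CompleteSpace E] [CompleteSpace E₁]
    (hab : a ≤ b) {F : ℝ → E → E} (hF : ContinuousOn (Function.uncurry F) (Icc a b ×ˢ univ))
    {y : ℝ → E} {g : ℝ → E₁} (hg : ContinuousOn g (Icc a b)) {ι : E₁ →L[ℝ] E}
    (hι : ∀ e, ‖ι e‖ ≤ ‖e‖)
    (hy : ∀ t ∈ Icc a b, HasDerivWithinAt y (F t (y t) - ι (g t)) (Icc a b) t)
    {L : ℝ≥0} {ρ ε : ℝ} (hρ : 0 < ρ)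
    (hL : ∀ t ∈ Icc a b, LipschitzOnWith L (F t) (closedBall (y t) ρ))
    (hgε : ∀ t ∈ Icc a b, ‖∫ s in t..b, g s‖ ≤ ε) (hε : ε * Real.exp (L * (b - a)) ≤ ρ) :
    ∃ x : ℝ → E, x b = y b ∧ IsIntegralCurveOn x F (Icc a b) ∧ ∀ t ∈ Icc a b, ‖x t - y t‖ ≤ ρ := by
  obtain ⟨G, -, hG⟩ := exists_primitive_on_Icc hab hg 0
  have hFTC : ∀ t ∈ Icc a b, ∫ s in t..b, g s = G b - G t := fun t ht => by
    have hsub : Icc t b ⊆ Icc a b := Icc_subset_Icc_left ht.1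
    refine intervalIntegral.integral_eq_sub_of_hasDerivAt_of_le ht.2
      (fun s hs => ((hG s (hsub hs)).continuousWithinAt).mono hsub)
      (fun s hs => (hG s (hsub (Ioo_subset_Icc_self hs))).hasDerivAt
        (Icc_mem_nhds (ht.1.trans_lt hs.1) hs.2)) ?_
    exact ((uIcc_of_le ht.2).symm ▸ hg.mono hsub : ContinuousOn g (uIcc t b)).intervalIntegrable
  obtain ⟨x, hxb, hx, hxy⟩ := exists_isIntegralCurveOn_near_right hab hF (z := y)
    (w := fun t => y t + ι (G t - G b)) (ε := ε)
    (fun t ht => (hy t ht).continuousWithinAt)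
    (fun t ht => by
      simpa only [sub_add_cancel, Function.comp_apply] using (hy t ht).fun_add
        (ι.hasFDerivAt.comp_hasDerivWithinAt t ((hG t ht).sub_const (G b))))
    hρ hL (fun t ht => by
      have h := hι (G b - G t)
      rw [← hFTC t ht] at h
      rw [sub_add_cancel_left, ← map_neg, neg_sub, ← hFTC t ht]
      exact h.trans (hgε t ht)) hε
  exact ⟨x, by simpa using hxb, hx, fun t ht => (hxy t ht).trans hε⟩

/-- Along each curve `y ξ`, the control system `x' = Φ t x u` differs from the velocity of `y ξ`
only in the directions `ι e`, and suitable controls `u` realise every such defect `φ ξ t u`. -/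
structure SurjectiveDefect [TopologicalSpace X] (Φ : ℝ → E → U → E) (ι : E₁ →L[ℝ] E) (a b : ℝ)
    (y : X → ℝ → E) (φ : X → ℝ → U → E₁) : Prop where
  norm_le : ∀ e, ‖ι e‖ ≤ ‖e‖
  continuousOn : ContinuousOn (fun q : X × ℝ => y q.1 q.2) (univ ×ˢ Icc a b)
  continuousOn_defect :
    ContinuousOn (fun q : X × ℝ × U => φ q.1 q.2.1 q.2.2) (univ ×ˢ Icc a b ×ˢ univ)
  surjective : ∀ ξ, ∀ t ∈ Icc a b, Function.Surjective (φ ξ t)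
  hasDerivWithinAt : ∀ ξ, ∀ t ∈ Icc a b, ∀ u,
    HasDerivWithinAt (y ξ) (Φ t (y ξ t) u - ι (φ ξ t u)) (Icc a b) t

theorem SurjectiveDefect.exists_isIntegralCurveOn_near [TopologicalSpace X] [CompleteSpace E]
    [CompleteSpace E₁] {Φ : ℝ → E → U → E} {ι : E₁ →L[ℝ] E} {y : X → ℝ → E} {φ : X → ℝ → U → E₁}
    (hD : SurjectiveDefect Φ ι a b y φ)
    (hΦ : ContinuousOn (fun q : ℝ × E × U => Φ q.1 q.2.1 q.2.2) (Icc a b ×ˢ univ)) (ξ : X)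
    {c : ℝ} (hc : c ∈ Icc a b) {u V : ℝ → U} (hu : Continuous u) (hV : Continuous V)
    {h : ℝ} (hh : 0 ≤ h) (huV : EqOn u V (Icc (c + h) (b - h))) {M ε ρ : ℝ} {L : ℝ≥0}
    (huM : ∀ t ∈ Icc c b, ‖φ ξ t (u t)‖ ≤ M) (hVM : ∀ t ∈ Icc c b, ‖φ ξ t (V t)‖ ≤ M)
    (hVε : ∀ t ∈ Icc a b, ‖∫ s in a..t, φ ξ s (V s)‖ ≤ ε) (hρ : 0 < ρ)
    (hL : ∀ t ∈ Icc c b, LipschitzOnWith L (fun x => Φ t x (u t)) (closedBall (y ξ t) ρ))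
    (hε : (2 * ε + 4 * M * h) * Real.exp (L * (b - a)) ≤ ρ) :
    ∃ x : ℝ → E, x b = y ξ b ∧ IsIntegralCurveOn x (fun t x => Φ t x (u t)) (Icc c b) ∧
      ∀ t ∈ Icc c b, ‖x t - y ξ t‖ ≤ ρ := by
  have hsub : Icc c b ⊆ Icc a b := Icc_subset_Icc_left hc.1
  have hφ : ∀ {w : ℝ → U}, Continuous w → ContinuousOn (fun t => φ ξ t (w t)) (Icc a b) :=
    fun {w} hw => hD.continuousOn_defect.comp (f := fun t => (ξ, t, w t)) (by fun_prop)
      fun t ht => ⟨mem_univ _, ht, mem_univ _⟩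
  have hε0 : 0 ≤ ε := (norm_nonneg _).trans (hVε c hc)
  have hM0 : 0 ≤ M := (norm_nonneg _).trans (huM c ⟨le_rfl, hc.2⟩)
  have hchatter : ∀ t ∈ Icc a b, ‖∫ s in t..b, φ ξ s (V s)‖ ≤ 2 * ε := fun t ht => by
    have hint : ∀ {d e}, d ∈ Icc a b → e ∈ Icc a b →
        IntervalIntegrable (fun s => φ ξ s (V s)) volume d e := fun hd he =>
      ((hφ hV).mono (ordConnected_Icc.uIcc_subset hd he)).intervalIntegrable
    have ha : a ∈ Icc a b := ⟨le_rfl, hc.1.trans hc.2⟩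
    have hb : b ∈ Icc a b := ⟨hc.1.trans hc.2, le_rfl⟩
    rw [← intervalIntegral.integral_interval_sub_left (hint ha hb) (hint ha ht)]
    linarith [norm_sub_le (∫ s in a..b, φ ξ s (V s)) (∫ s in a..t, φ ξ s (V s)), hVε b hb, hVε t ht]
  refine exists_isIntegralCurveOn_near_of_norm_integral_le hc.2
    (F := fun t x => Φ t x (u t)) (hΦ.comp (f := fun q : ℝ × E => (q.1, q.2, u q.1)) (by fun_prop)
      fun q hq => ⟨hsub hq.1, mem_univ _⟩) ((hφ hu).mono hsub) hD.norm_le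
    (fun t ht => (hD.hasDerivWithinAt ξ t (hsub ht) (u t)).mono hsub) hρ hL
    (fun t ht => norm_integral_le_of_eqOn_middle ((hφ hu).mono hsub) ((hφ hV).mono hsub) hh ht
      huM hVM (fun s hs => by simp only [huV hs]) (hchatter t (hsub ht))) (hε.trans' ?_)
  gcongr
  exact hc.1

theorem SurjectiveDefect.exists_tracking [MetricSpace X] [ProperSpace E] [FiniteDimensional ℝ E₁]
    [NormedSpace ℝ U] [ProperSpace U] {Φ : ℝ → E → U → E} {ι : E₁ →L[ℝ] E} {y : X → ℝ → E}
    {φ : X → ℝ → U → E₁} (hab : a ≤ b) (hD : SurjectiveDefect Φ ι a b y φ)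
    (hΦ : SpatialC1 (Icc a b) fun t (q : E × U) => Φ t q.1 q.2) :
    ∃ V : X × Ioi (0 : ℝ) → ℝ → U, JointC1 V ∧ ∀ ξ₀,
      (∃ R, ∀ᶠ ξ in 𝓝 ξ₀, ∀ h t, ‖V (ξ, h) t‖ ≤ R) ∧
      ∀ R, ∀ ρ > 0, ∃ h₀ > 0, ∀ᶠ ξ in 𝓝 ξ₀, ∀ h : Ioi (0 : ℝ), (h : ℝ) ≤ h₀ → ∀ c ∈ Icc a b,
        ∀ u : ℝ → U, Continuous u → (∀ t ∈ Icc c b, ‖u t‖ ≤ R) →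
          EqOn u (V (ξ, h)) (Icc (c + h) (b - h)) →
          ∃ x : ℝ → E, x b = y ξ b ∧ IsIntegralCurveOn x (fun t x => Φ t x (u t)) (Icc c b) ∧
            ∀ t ∈ Icc c b, ‖x t - y ξ t‖ ≤ ρ := by
  have := FiniteDimensional.complete ℝ E₁
  obtain ⟨V, hV, hVφ⟩ := exists_chattering hab hD.continuousOn_defect hD.surjective
  refine ⟨V, hV, fun ξ₀ => ⟨(hVφ ξ₀).1, fun R ρ hρ => ?_⟩⟩
  obtain ⟨⟨RV, hRV⟩, hchatter⟩ := hVφ ξ₀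
  obtain ⟨Ry, hRy⟩ := exists_eventually_norm_le_of_isCompact isCompact_Icc hD.continuousOn ξ₀
  obtain ⟨M, hM⟩ :=
    (exists_eventually_norm_le_and_norm_sub_le hD.continuousOn_defect ξ₀ (max R RV)).1
  obtain ⟨L, hL⟩ := hΦ.exists_lipschitzOnWith_closedBall_left isCompact_Icc (max R (Ry + ρ))
  let e : ℝ := Real.exp (L * (b - a))
  have he : 0 < e := Real.exp_pos _
  let M' : ℝ := max M 1
  have : 0 < M' := lt_max_of_lt_right one_pos
  obtain ⟨h₁, hh₁, hch⟩ := hchatter (ρ / (4 * e)) (by positivity)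
  refine ⟨min h₁ (ρ / (8 * M' * e)), by positivity, ?_⟩
  filter_upwards [hRV, hRy, hM, hch] with ξ hξV hξy hξM hξch h hh c hc u hu huR huV
  have hsub : Icc c b ⊆ Icc a b := Icc_subset_Icc_left hc.1
  have hφM : ∀ t ∈ Icc c b, ∀ v, ‖v‖ ≤ max R RV → ‖φ ξ t v‖ ≤ M' := fun t ht v hv =>
    (hξM t (hsub ht) v hv).trans (le_max_left _ _)
  refine hD.exists_isIntegralCurveOn_near hΦ.continuousOn ξ hc hu
    (hV.continuous.comp (.prodMk_right (ξ, h))) h.2.le huV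
    (fun t ht => hφM t ht _ ((huR t ht).trans (le_max_left _ _)))
    (fun t ht => hφM t ht _ ((hξV h t).trans (le_max_right _ _)))
    (hξch h (hh.trans (min_le_left _ _))) hρ
    (fun t ht => (hL t (hsub ht) _ ((huR t ht).trans (le_max_left _ _))).mono ?_) ?_
  · refine (closedBall_subset_closedBall' ?_).trans
      (closedBall_subset_closedBall (le_max_right R (Ry + ρ)))
    rw [dist_zero_right]
    linarith [hξy t (hsub ht)]
  · have hh' : h * (8 * M' * e) ≤ ρ :=
      (le_div_iff₀ (by positivity)).1 (hh.trans (min_le_right _ _))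
    calc (2 * (ρ / (4 * e)) + 4 * M' * h) * e = ρ / 2 + h * (8 * M' * e) / 2 := by
          field_simp
          ring
      _ ≤ ρ := by linarith

end Tracking

section Blend

variable {U : Type*} [NormedAddCommGroup U] [NormedSpace ℝ U]

/-- The control that equals `v₀` before `a`, follows `V` inside `[a, b]` and reaches `β` at `b`,
with transitions of length `h`. -/
noncomputable def blend (v₀ V : ℝ → U) (β : U) (a b h t : ℝ) : U :=
  v₀ t + Real.smoothTransition ((t - a) / h) • (V t - v₀ t)
    + Real.smoothTransition (1 - (b - t) / h) • (β - V t)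

variable {v₀ V : ℝ → U} {β : U} {a b h t : ℝ}

theorem blend_of_le (hh : 0 < h) (hab : h ≤ b - a) (ht : t ≤ a) : blend v₀ V β a b h t = v₀ t := by
  have hb : 1 ≤ (b - t) / h := (one_le_div hh).2 (by linarith)
  have ha : (t - a) / h ≤ 0 := div_nonpos_of_nonpos_of_nonneg (by linarith) hh.le
  simp [blend, Real.smoothTransition.zero_of_nonpos ha,
    Real.smoothTransition.zero_of_nonpos (sub_nonpos.2 hb)]

theorem blend_right (hh : 0 < h) (hab : h ≤ b - a) : blend v₀ V β a b h b = β := by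
  simp [blend, Real.smoothTransition.one_of_one_le ((one_le_div hh).2 hab)]

theorem eqOn_blend (hh : 0 < h) : EqOn (blend v₀ V β a b h) V (Icc (a + h) (b - h)) := by
  intro t ht
  have hb : 1 ≤ (b - t) / h := (one_le_div hh).2 (by linarith [ht.2])
  have ha : 1 ≤ (t - a) / h := (one_le_div hh).2 (by linarith [ht.1])
  simp [blend, Real.smoothTransition.one_of_one_le ha,
    Real.smoothTransition.zero_of_nonpos (sub_nonpos.2 hb)]

theorem norm_blend_le {R : ℝ} (h₀ : ‖v₀ t‖ ≤ R) (hV : ‖V t‖ ≤ R) (hβ : ‖β‖ ≤ R) :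
    ‖blend v₀ V β a b h t‖ ≤ 5 * R := by
  have hsmul : ∀ (s : ℝ) (u : U), ‖Real.smoothTransition s • u‖ ≤ ‖u‖ := fun s u => by
    rw [norm_smul_of_nonneg (Real.smoothTransition.nonneg s)]
    exact mul_le_of_le_one_left (norm_nonneg _) (Real.smoothTransition.le_one s)
  refine norm_add₃_le.trans ?_
  have hV₀ := (hsmul ((t - a) / h) (V t - v₀ t)).trans (norm_sub_le _ _)
  have hVβ := (hsmul (1 - (b - t) / h) (β - V t)).trans (norm_sub_le _ _)
  linarith

theorem jointC1_blend {Y : Type*} [TopologicalSpace Y] (hv₀ : ContDiff ℝ 1 v₀) {V : Y → ℝ → U}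
    (hV : JointC1 V) {β : Y → U} (hβ : Continuous β) {a h : Y → ℝ} (ha : Continuous a)
    (hh : Continuous h) (hh0 : ∀ q, 0 < h q) (b : ℝ) :
    JointC1 fun q => blend v₀ (V q) (β q) (a q) b (h q) := by
  have hi : Continuous fun q => (h q)⁻¹ := hh.inv₀ fun q => (hh0 q).ne'
  have hS : ∀ {γ : Y → ℝ}, Continuous γ →
      JointC1 fun q t => Real.smoothTransition ((h q)⁻¹ * t + γ q) := fun hγ =>
    (JointC1.of_contDiff (Y := Unit) Real.smoothTransition.contDiff).comp_affine
      (π := fun _ => ()) continuous_const hi hγ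
  have hv : JointC1 fun (_ : Y) t => v₀ t := JointC1.of_contDiff hv₀
  convert! (hv.add ((hS (γ := fun q => -(a q) * (h q)⁻¹) (by fun_prop)).smul (hV.sub hv))).add
    ((hS (γ := fun q => 1 - b * (h q)⁻¹) (by fun_prop)).smul ((JointC1.const hβ).sub hV))
    using 3 with q t
  rw [blend]
  congr 4 <;> ring

end Blend

section Backward

open Metric
open scoped NNReal

theorem exists_continuous_forall_of_local {X : Type*} [TopologicalSpace X] [ParacompactSpace X]
    [NormalSpace X] {good : X → ℝ → Prop}
    (h : ∀ x₀, ∃ h₀ > 0, ∀ᶠ x in 𝓝 x₀, ∀ h, 0 < h → h ≤ h₀ → good x h) :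
    ∃ δ : X → ℝ, Continuous δ ∧ ∀ x, 0 < δ x ∧ good x (δ x) := by
  obtain ⟨g, hg⟩ := exists_continuous_forall_mem_convex_of_local_const
    (t := fun x => {d : ℝ | 0 < d ∧ ∀ h, 0 < h → h ≤ d → good x h})
    (fun x => Set.OrdConnected.convex ⟨fun a ha b hb c hc =>
      ⟨ha.1.trans_le hc.1, fun h h0 hh => hb.2 h h0 (hh.trans hc.2)⟩⟩)
    (fun x₀ => by
      obtain ⟨h₀, hh₀, hx⟩ := h x₀
      exact ⟨h₀, hx.mono fun x hx => ⟨hh₀, hx⟩⟩)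
  exact ⟨g, g.continuous, fun x => ⟨(hg x).1, (hg x).2 _ (hg x).1 le_rfl⟩⟩

variable {E E₁ U X : Type*} [NormedAddCommGroup E] [NormedSpace ℝ E] [ProperSpace E]
  [NormedAddCommGroup E₁] [NormedSpace ℝ E₁] [FiniteDimensional ℝ E₁]
  [NormedAddCommGroup U] [NormedSpace ℝ U] [ProperSpace U] [MetricSpace X]
  {a b : ℝ} {Φ : ℝ → E → U → E} {ι : E₁ →L[ℝ] E} {y : X → ℝ → E} {φ : X → ℝ → U → E₁}

theorem SurjectiveDefect.exists_blend_tracking (hab : a ≤ b) (hD : SurjectiveDefect Φ ι a b y φ)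
    (hΦ : SpatialC1 (Icc a b) fun t (q : E × U) => Φ t q.1 q.2) {v₀ : ℝ → U}
    (hv₀ : ContDiff ℝ 1 v₀) {c ε : X → ℝ} (hc : Continuous c) (hac : ∀ ξ, a ≤ c ξ)
    (hcb : ∀ ξ, c ξ < b) (hε : Continuous ε) (hε0 : ∀ ξ, 0 < ε ξ) :
    ∃ (V : X × Ioi (0 : ℝ) → ℝ → U) (h : X × U → Ioi (0 : ℝ)), JointC1 V ∧ Continuous h ∧
      ∀ q : X × U, (h q : ℝ) ≤ b - c q.1 ∧ ∃ x : ℝ → E, x b = y q.1 b ∧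
        IsIntegralCurveOn x
          (fun t x => Φ t x (blend v₀ (V (q.1, h q)) q.2 (c q.1) b (h q) t)) (Icc (c q.1) b) ∧
        ∀ t ∈ Icc (c q.1) b, ‖x t - y q.1 t‖ ≤ ε q.1 := by
  obtain ⟨V, hV, hVx⟩ := hD.exists_tracking hab hΦ
  obtain ⟨R₀, hR₀⟩ := (isCompact_Icc (a := a) (b := b)).exists_bound_of_continuousOn
    hv₀.continuous.continuousOn
  obtain ⟨h, hh, hgood⟩ := exists_continuous_forall_of_local (X := X × U)
    (good := fun q h => ∀ hh : 0 < h, h ≤ b - c q.1 ∧ ∃ x : ℝ → E, x b = y q.1 b ∧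
      IsIntegralCurveOn x
        (fun t x => Φ t x (blend v₀ (V (q.1, ⟨h, hh⟩)) q.2 (c q.1) b h t)) (Icc (c q.1) b) ∧
      ∀ t ∈ Icc (c q.1) b, ‖x t - y q.1 t‖ ≤ ε q.1) fun ⟨ξ₀, β₀⟩ => by
    obtain ⟨⟨RV, hRV⟩, htrack⟩ := hVx ξ₀
    let R : ℝ := max R₀ (max RV (‖β₀‖ + 1))
    obtain ⟨h₁, hh₁, hx⟩ := htrack (5 * R) (ε ξ₀ / 2) (half_pos (hε0 ξ₀))
    have hgap : 0 < b - c ξ₀ := sub_pos.2 (hcb ξ₀)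
    have hlen : ∀ᶠ ξ in 𝓝 ξ₀, (b - c ξ₀) / 2 < b - c ξ :=
      continuousAt_const.eventually_lt (by fun_prop) (half_lt_self hgap)
    have hclose : ∀ᶠ ξ in 𝓝 ξ₀, ε ξ₀ / 2 < ε ξ :=
      continuousAt_const.eventually_lt hε.continuousAt (half_lt_self (hε0 ξ₀))
    have hβ : ∀ᶠ β in 𝓝 β₀, ‖β‖ < ‖β₀‖ + 1 :=
      continuous_norm.continuousAt.eventually_lt continuousAt_const (lt_add_one _)
    refine ⟨min h₁ ((b - c ξ₀) / 2), by positivity, ?_⟩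
    filter_upwards [(hlen.and (hclose.and (hRV.and hx))).prod_inl_nhds β₀,
      hβ.prod_inr_nhds ξ₀] with ⟨ξ, β⟩ ⟨hξlen, hξε, hξV, hξx⟩ hβ h h0 hle hh
    have huC : Continuous (blend v₀ (V (ξ, ⟨h, hh⟩)) β (c ξ) b h) :=
      (jointC1_blend (Y := Unit) hv₀ (hV.comp (π := fun _ => (ξ, ⟨h, hh⟩)) continuous_const)
        (β := fun _ => β) continuous_const (a := fun _ => c ξ) continuous_const
        (h := fun _ => h) continuous_const (fun _ => h0) b).continuous.comp (.prodMk_right ())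
    refine ⟨(hle.trans (min_le_right _ _)).trans hξlen.le, ?_⟩
    obtain ⟨x, hxb, hx, hxy⟩ := hξx ⟨h, hh⟩ (hle.trans (min_le_left _ _)) (c ξ)
      ⟨hac ξ, (hcb ξ).le⟩ _ huC (fun t ht => norm_blend_le
        ((hR₀ t ⟨(hac ξ).trans ht.1, ht.2⟩).trans (le_max_left _ _))
        ((hξV _ t).trans ((le_max_left _ _).trans (le_max_right _ _)))
        (hβ.le.trans ((le_max_right _ _).trans (le_max_right _ _)))) (eqOn_blend hh)
    exact ⟨x, hxb, hx, fun t ht => (hxy t ht).trans hξε.le⟩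
  exact ⟨V, fun q => ⟨h q, (hgood q).1⟩, hV, hh.subtype_mk _, fun q => (hgood q).2 (hgood q).1⟩

theorem SurjectiveDefect.exists_backward_control (hab : a ≤ b)
    (hD : SurjectiveDefect Φ ι a b y φ)
    (hΦ : SpatialC1 (Icc a b) fun t (q : E × U) => Φ t q.1 q.2) {v₀ : ℝ → U}
    (hv₀ : ContDiff ℝ 1 v₀) {c ε : X → ℝ} (hc : Continuous c) (hac : ∀ ξ, a ≤ c ξ)
    (hcb : ∀ ξ, c ξ < b) (hε : Continuous ε) (hε0 : ∀ ξ, 0 < ε ξ) :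
    ∃ u : X × U → ℝ → U, JointC1 u ∧ (∀ q, ∀ t ≤ c q.1, u q t = v₀ t) ∧ (∀ q, u q b = q.2) ∧
      ∃ x₁ : X × U → E, Continuous x₁ ∧ ∀ q, ‖x₁ q - y q.1 (c q.1)‖ ≤ ε q.1 ∧
        ∃ x : ℝ → E, x (c q.1) = x₁ q ∧ x b = y q.1 b ∧
          IsIntegralCurveOn x (fun t x => Φ t x (u q t)) (Icc (c q.1) b) := by
  obtain ⟨V, h, hV, hh, hx⟩ := hD.exists_blend_tracking hab hΦ hv₀ hc hac hcb hε hε0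
  choose hlen x hxb hx hxy using hx
  have hu : JointC1 fun q : X × U => blend v₀ (V (q.1, h q)) q.2 (c q.1) b (h q) :=
    jointC1_blend hv₀ (hV.comp (π := fun q : X × U => (q.1, h q)) (by fun_prop))
      continuous_snd (by fun_prop) (by fun_prop) (fun q => (h q).2) b
  refine ⟨_, hu, fun q t ht => blend_of_le (h q).2 (hlen q) ht,
    fun q => blend_right (h q).2 (hlen q), fun q => x q (c q.1), ?_,
    fun q => ⟨hxy q _ ⟨le_rfl, (hcb _).le⟩, x q, rfl, hxb q, hx q⟩⟩
  refine continuous_isIntegralCurveOn_left_endpoint (c := fun q : X × U => c q.1) (by fun_prop)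
    (fun q => hac q.1) (fun q => (hcb q.1).le)
    (hΦ.continuousOn.comp (f := fun q : (X × U) × ℝ × E => (q.2.1, q.2.2, _))
      (continuousOn_snd.fst.prodMk (continuousOn_snd.snd.prodMk
        (hu.continuous.comp (f := fun q : (X × U) × ℝ × E => (q.1, q.2.1))
          (by fun_prop)).continuousOn)) fun q hq => ⟨hq.2.1, mem_univ _⟩)
    hx ?_ fun q₀ => ?_
  · simp only [hxb]
    exact hD.continuousOn.comp_continuous (f := fun q : X × U => (q.1, b)) (by fun_prop)
      fun q => ⟨mem_univ _, hab, le_rfl⟩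
  · obtain ⟨Ru, hRu⟩ := exists_eventually_norm_le_of_isCompact (isCompact_Icc (a := a) (b := b))
      (g := fun (q : X × U) t => blend v₀ (V (q.1, h q)) q.2 (c q.1) b (h q) t)
      hu.continuous.continuousOn q₀
    obtain ⟨Ry, hRy⟩ := exists_eventually_norm_le_of_isCompact isCompact_Icc hD.continuousOn q₀.1
    have hεq : ∀ᶠ ξ in 𝓝 q₀.1, ε ξ < ε q₀.1 + 1 :=
      hε.continuousAt.eventually_lt continuousAt_const (lt_add_one _)
    let R : ℝ := max Ru (ε q₀.1 + 1 + Ry)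
    obtain ⟨L, hL⟩ := hΦ.exists_lipschitzOnWith_closedBall_left isCompact_Icc R
    refine ⟨L, closedBall 0 R, ?_⟩
    filter_upwards [hRu, continuous_fst.continuousAt.eventually (hRy.and hεq)] with
      q hqu ⟨hqy, hqε⟩ t ht
    have ht' : t ∈ Icc a b := ⟨(hac _).trans ht.1, ht.2⟩
    refine ⟨hL t ht' _ ((hqu t ht').trans (le_max_left _ _)), mem_closedBall_zero_iff.2 ?_⟩
    refine le_trans ?_ (le_max_right _ _)
    linarith [norm_le_norm_add_norm_sub' (x q t) (y q.1 t), hxy q t ht, hqy t ht']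

end Backward

section Families

theorem continuousOn_prod_of_tendstoUniformlyOn {X Z F : Type*} [TopologicalSpace X]
    [TopologicalSpace Z] [UniformSpace F] {g : X → Z → F} {K : Set Z}
    (hu : ∀ x₀, TendstoUniformlyOn g (g x₀) (𝓝 x₀) K) (hc : ∀ x, ContinuousOn (g x) K) :
    ContinuousOn (fun q : X × Z => g q.1 q.2) (univ ×ˢ K) := by
  rintro ⟨x₀, z₀⟩ ⟨-, hz₀⟩
  rw [ContinuousWithinAt, nhdsWithin_prod_eq, nhdsWithin_univ]
  have hloc : TendstoLocallyUniformlyOn (fun q : X × Z => g q.1) (g x₀) (𝓝 x₀ ×ˢ 𝓝[K] z₀) K :=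
    TendstoUniformlyOn.tendstoLocallyUniformlyOn fun u hu' =>
      tendsto_fst.eventually (hu x₀ u hu')
  exact hloc.tendsto_comp (hc x₀ z₀ hz₀) hz₀ tendsto_snd

theorem chainCurves_derivWithin {X : Type*} [TopologicalSpace X] {m : ℕ → ℕ}
    {f : (i : ℕ) → ℝ → State m (i + 2) → Block m i} {a b : ℝ} (hab : a < b) {p : ℕ}
    {y : X → ℝ → State m p} (hy : ∀ i, ContinuousC1Family a b fun ξ t => y ξ t i)
    (hode : ∀ ξ (i : ℕ) (hi : i + 2 ≤ p), ∀ t ∈ Icc a b,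
      HasDerivWithinAt (fun s => y ξ s ⟨i, i.lt_succ_self.trans hi⟩) (f i t (trunc hi (y ξ t)))
        (Icc a b) t) :
    ChainCurves f p a b y fun ξ t i => derivWithin (fun s => y ξ s i) (Icc a b) t where
  continuousOn := continuousOn_pi.2 fun i => continuousOn_prod_of_tendstoUniformlyOn
    (hy i).tendsto fun ξ => ((hy i).contDiffOn ξ).continuousOn
  continuousOn_velocity := continuousOn_pi.2 fun i => continuousOn_prod_of_tendstoUniformlyOn
    (hy i).tendsto_deriv fun ξ =>
      ((hy i).contDiffOn ξ).continuousOn_derivWithin (uniqueDiffOn_Icc hab) le_rfl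
  hasDerivWithinAt ξ t ht := hasDerivWithinAt_pi.2 fun i =>
    (((hy i).contDiffOn ξ).differentiableOn one_ne_zero t ht).hasDerivWithinAt
  velocity_eq ξ t ht i hi := (hode ξ i hi t ht).derivWithin (uniqueDiffOn_Icc hab t ht)

theorem exists_continuous_pos_forall_norm_sub_le {X E : Type*} [TopologicalSpace X]
    [ParacompactSpace X] [NormalSpace X] [NormedAddCommGroup E] {a b : ℝ} (hab : a < b) {r : ℝ}
    (hr : 0 < r) {g : X → ℝ → E}
    (hg : ContinuousOn (fun q : X × ℝ => g q.1 q.2) (univ ×ˢ Icc a b)) {g₀ : E}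
    (hg₀ : ∀ ξ, g ξ a = g₀) :
    ∃ δ : X → ℝ, Continuous δ ∧ ∀ ξ, 0 < δ ξ ∧ δ ξ ≤ r ∧ a + δ ξ < b ∧
      ∀ t ∈ Icc a (a + δ ξ), ‖g ξ t - g₀‖ ≤ r := by
  refine exists_continuous_forall_of_local (good := fun ξ d => d ≤ r ∧ a + d < b ∧
    ∀ t ∈ Icc a (a + d), ‖g ξ t - g₀‖ ≤ r) fun ξ₀ => ?_
  have hnear : ∀ᶠ q in 𝓝 ξ₀ ×ˢ 𝓝[≥] a, ‖g q.1 q.2 - g₀‖ < r := by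
    have h := ((hg (ξ₀, a) ⟨mem_univ _, left_mem_Icc.2 hab.le⟩).sub
      (continuousWithinAt_const (b := g₀))).norm
    rw [ContinuousWithinAt, nhdsWithin_prod_eq, nhdsWithin_univ, nhdsWithin_Icc_eq_nhdsGE hab] at h
    exact h.eventually_lt_const (by simpa [hg₀] using hr)
  obtain ⟨X₀, hX₀, S, hS, hXS⟩ := eventually_prod_iff.1 hnear
  obtain ⟨c, hc, hcS⟩ := mem_nhdsGE_iff_exists_Icc_subset.1 hS
  refine ⟨min (min r ((b - a) / 2)) (c - a),
    lt_min (lt_min hr (half_pos (sub_pos.2 hab))) (sub_pos.2 hc), ?_⟩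
  filter_upwards [hX₀] with ξ hξ d _ hd
  obtain ⟨⟨hdr, hdb⟩, hdc⟩ := (le_min_iff.1 hd).imp_left le_min_iff.1
  exact ⟨hdr, by linarith, fun t ht => (hXS hξ (hcS ⟨ht.1, by linarith [ht.2]⟩)).le⟩

end Families

section Trajectories

theorem exists_isIntegralCurveOn_glue {E : Type*} [NormedAddCommGroup E] [NormedSpace ℝ E]
    {F : ℝ → E → E} {a b c : ℝ} (hac : a ≤ c) (hcb : c ≤ b) {x₁ x₂ : ℝ → E} (hc : x₁ c = x₂ c)
    (h₁ : IsIntegralCurveOn x₁ F (Icc a c)) (h₂ : IsIntegralCurveOn x₂ F (Icc c b)) :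
    ∃ x, x a = x₁ a ∧ x b = x₂ b ∧ IsIntegralCurveOn x F (Icc a b) := by
  let x : ℝ → E := fun t => if t ≤ c then x₁ t else x₂ t
  have hx₁ : EqOn x x₁ (Icc a c) := fun t ht => if_pos ht.2
  have hx₂ : EqOn x x₂ (Icc c b) := by
    intro t ht
    obtain rfl | h := ht.1.eq_or_lt
    · exact (if_pos le_rfl).trans hc
    · exact if_neg h.not_ge
  refine ⟨x, hx₁ ⟨le_rfl, hac⟩, hx₂ ⟨hcb, le_rfl⟩, fun t _ => ?_⟩
  rw [← Icc_union_Icc_eq_Icc hac hcb]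
  have hpiece : ∀ {x' : ℝ → E} {s : Set ℝ}, IsClosed s → EqOn x x' s → IsIntegralCurveOn x' F s →
      HasDerivWithinAt x (F t (x t)) s t := fun {x' s} hs he hx' => by
    by_cases hts : t ∈ s
    · rw [he hts]
      exact (hx' t hts).congr he (he hts)
    · exact HasFDerivWithinAt.of_notMem_closure (by rwa [hs.closure_eq])
  exact (hpiece isClosed_Icc hx₁ h₁).union (hpiece isClosed_Icc hx₂ h₂)

variable {m : ℕ → ℕ} {f : (i : ℕ) → ℝ → State m (i + 2) → Block m i}

theorem IsTrajectory.eqOn {p : ℕ} {a b : ℝ}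
    (hf : SpatialC1 (Icc a b) fun t (q : State m p × Block m p) => field f p t q.1 q.2)
    {v : ℝ → Block m p} (hv : ContinuousOn v (Icc a b)) {y₀ : State m p} {x x' : ℝ → State m p}
    (hx : IsTrajectory f p a b y₀ v x) (hx' : IsTrajectory f p a b y₀ v x') :
    EqOn x x' (Icc a b) := by
  obtain ⟨Rv, hRv⟩ := isCompact_Icc.exists_bound_of_continuousOn hv
  refine eqOn_of_isIntegralCurveOn_of_lipschitzOnWith_closedBall
    (F := fun t x => field f p t x (v t)) (fun R => ?_) hx.ode hx'.ode
    (hx.initial.trans hx'.initial.symm)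
  obtain ⟨L, hL⟩ := hf.exists_lipschitzOnWith_closedBall_left isCompact_Icc (max R Rv)
  exact ⟨L, fun t ht => (hL t ht _ ((hRv t ht).trans (le_max_right _ _))).mono
    (Metric.closedBall_subset_closedBall (le_max_left _ _))⟩

end Trajectories

section Dilation

variable {m : ℕ → ℕ} {p : ℕ} {δ : ℝ}

theorem dilate_dilate_inv (hδ : δ ≠ 0) (x : State m p) : dilate δ p (dilate δ⁻¹ p x) = x :=
  funext fun i => by
    rw [dilate_apply, dilate_apply, inv_pow, smul_inv_smul₀ (pow_ne_zero _ hδ)]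

theorem norm_dilate_inv_le (hδ : δ ∈ Ioc 0 1) (x : State m p) :
    ‖dilate δ⁻¹ p x‖ ≤ (δ ^ p)⁻¹ * ‖x‖ := by
  have hδ0 := hδ.1
  refine (pi_norm_le_iff_of_nonneg (by positivity)).2 fun i => ?_
  rw [dilate_apply, norm_smul, norm_pow, norm_inv, Real.norm_of_nonneg hδ0.le, inv_pow]
  exact mul_le_mul (inv_anti₀ (by positivity) (pow_le_pow_of_le_one hδ0.le hδ.2 (Nat.sub_le p i)))
    (norm_le_pi_norm x i) (norm_nonneg _) (by positivity)

end Dilation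

section Control

variable {m : ℕ → ℕ} {f : (i : ℕ) → ℝ → State m (i + 2) → Block m i} {k : ℕ} {a b : ℝ}

section

variable {X : Type*} [TopologicalSpace X] {y W : X → ℝ → State m (k + 1)}

theorem ChainCurves.field_eq (hy : ChainCurves f (k + 1) a b y W) (ξ : X) {t : ℝ}
    (ht : t ∈ Icc a b) (v : Block m (k + 1)) :
    field f (k + 1) t (y ξ t) v = W ξ t +
      ContinuousLinearMap.single ℝ (fun i : Fin (k + 1) => Block m i) ⟨k, k.lt_succ_self⟩
        (f k t (extend (y ξ t) v) - W ξ t ⟨k, k.lt_succ_self⟩) := by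
  funext ⟨i, hi⟩
  obtain hi' | rfl := Nat.lt_succ_iff_lt_or_eq.1 hi
  · have hne : (⟨i, hi⟩ : Fin (k + 1)) ≠ ⟨k, k.lt_succ_self⟩ := fun h => hi'.ne (Fin.mk.inj h)
    simpa [hne] using (field_of_lt t (y ξ t) v (by omega)).trans
      (hy.velocity_eq ξ t ht i (by omega)).symm
  · simp only [Pi.add_apply, ContinuousLinearMap.single_apply, Pi.single_eq_same]
    exact (add_sub_cancel _ _).symm

theorem ChainCurves.surjectiveDefect (hy : ChainCurves f (k + 1) a b y W)
    (hf : ContinuousOn (fun q : ℝ × State m (k + 2) => f k q.1 q.2) (Icc a b ×ˢ univ))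
    (hsurj : ∀ t ∈ Icc a b, ∀ x : State m (k + 1),
      Function.Surjective fun v : Block m (k + 1) => f k t (extend x v)) :
    SurjectiveDefect (field f (k + 1))
      (ContinuousLinearMap.single ℝ (fun i : Fin (k + 1) => Block m i) ⟨k, k.lt_succ_self⟩) a b y
      fun ξ t v => f k t (extend (y ξ t) v) - W ξ t ⟨k, k.lt_succ_self⟩ where
  norm_le e := (Pi.norm_single (G := fun i : Fin (k + 1) => Block m i) e).le
  continuousOn := hy.continuousOn
  continuousOn_defect := by
    have hmaps : MapsTo (fun q : X × ℝ × Block m (k + 1) => (q.1, q.2.1))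
        (univ ×ˢ Icc a b ×ˢ univ) (univ ×ˢ Icc a b) := fun q hq => ⟨mem_univ _, hq.2.1⟩
    have hfy : ContinuousOn (fun q : X × ℝ × Block m (k + 1) =>
        f k q.2.1 (extend (y q.1 q.2.1) q.2.2)) (univ ×ˢ Icc a b ×ˢ univ) :=
      hf.comp (f := fun q : X × ℝ × Block m (k + 1) => (q.2.1, extend (y q.1 q.2.1) q.2.2))
        (continuousOn_snd.fst.prodMk ((extendL m (k + 1)).continuous.comp_continuousOn
          ((hy.continuousOn.comp (by fun_prop) hmaps).prodMk continuousOn_snd.snd)))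
        fun q hq => ⟨hq.2.1, mem_univ _⟩
    exact hfy.sub ((continuous_apply (⟨k, k.lt_succ_self⟩ : Fin (k + 1))).comp_continuousOn
      (hy.continuousOn_velocity.comp (by fun_prop) hmaps))
  surjective ξ t ht e := by
    obtain ⟨v, hv⟩ := hsurj t ht (y ξ t) (e + W ξ t ⟨k, k.lt_succ_self⟩)
    exact ⟨v, sub_eq_of_eq_add hv⟩
  hasDerivWithinAt ξ t ht v :=
    (hy.hasDerivWithinAt ξ t ht).congr_deriv (eq_sub_of_add_eq (hy.field_eq ξ ht v).symm)

end

variable {X : Type*} [MetricSpace X] {y W : X → ℝ → State m (k + 1)} {v₀ : ℝ → Block m (k + 1)}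

theorem ChainCurves.exists_backward_control (hy : ChainCurves f (k + 1) a b y W) (hab : a ≤ b)
    (hf : ∀ i < k + 1, SpatialC1 (Icc a b) (f i))
    (hsurj : ∀ t ∈ Icc a b, ∀ x : State m (k + 1),
      Function.Surjective fun v : Block m (k + 1) => f k t (extend x v))
    (hv₀ : ContDiff ℝ 1 v₀) {δ : X → ℝ} (hδ : Continuous δ) (hδ1 : ∀ ξ, δ ξ ∈ Ioc 0 1)
    (hδb : ∀ ξ, a + δ ξ < b) {r : ℝ} (hr : 0 < r) :
    ∃ u : X × Block m (k + 1) → ℝ → Block m (k + 1), JointC1 u ∧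
      (∀ q, ∀ t ≤ a + δ q.1, u q t = v₀ t) ∧ (∀ q, u q b = q.2) ∧
      ∃ η : X × Block m (k + 1) → State m (k + 1), Continuous η ∧ ∀ q, ‖η q‖ ≤ r ∧
        ∃ x : ℝ → State m (k + 1),
          x (a + δ q.1) = y q.1 (a + δ q.1) + dilate (δ q.1) (k + 1) (η q) ∧ x b = y q.1 b ∧
          IsIntegralCurveOn x (fun t x => field f (k + 1) t x (u q t)) (Icc (a + δ q.1) b) := by
  have hδ0 : ∀ ξ, 0 < δ ξ := fun ξ => (hδ1 ξ).1
  obtain ⟨u, hu, huv, hub, x₁, hx₁, hx⟩ :=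
    (hy.surjectiveDefect (hf k k.lt_succ_self).continuousOn hsurj).exists_backward_control hab
      (spatialC1_field hf) hv₀ (c := fun ξ => a + δ ξ) (by fun_prop)
      (fun ξ => le_add_of_nonneg_right (hδ0 ξ).le) hδb (ε := fun ξ => δ ξ ^ (k + 1) * r)
      (by fun_prop) fun ξ => mul_pos (pow_pos (hδ0 ξ) _) hr
  have hyδ : Continuous fun q : X × Block m (k + 1) => y q.1 (a + δ q.1) :=
    hy.continuousOn.comp_continuous (f := fun q : X × Block m (k + 1) => (q.1, a + δ q.1))
      (by fun_prop) fun q => ⟨mem_univ _, le_add_of_nonneg_right (hδ0 q.1).le, (hδb q.1).le⟩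
  refine ⟨u, hu, huv, hub, fun q => dilate (δ q.1)⁻¹ (k + 1) (x₁ q - y q.1 (a + δ q.1)),
    (continuous_dilate (k + 1)).comp (((hδ.comp continuous_fst).inv₀
      fun q => (hδ0 q.1).ne').prodMk (hx₁.sub hyδ)), fun q => ⟨?_, ?_⟩⟩
  · exact (norm_dilate_inv_le (hδ1 q.1) _).trans
      ((inv_mul_le_iff₀ (pow_pos (hδ0 q.1) _)).2 (hx q).1)
  · obtain ⟨-, x, hxδ, hxb, hx⟩ := hx q
    refine ⟨x, ?_, hxb, hx⟩
    rw [dilate_dilate_inv (hδ0 q.1).ne', hxδ, add_sub_cancel]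

theorem JointC1.rescaled_clm_apply {Y E F : Type*} [TopologicalSpace Y] [NormedAddCommGroup E]
    [NormedSpace ℝ E] [NormedAddCommGroup F] [NormedSpace ℝ F] {A : ℝ → E →L[ℝ] F}
    (hA : ContDiff ℝ 1 A) {δ : Y → ℝ} (hδ : Continuous δ) (hδ0 : ∀ q, δ q ≠ 0) {c : Y → E}
    (hc : Continuous c) (a : ℝ) : JointC1 fun q t => A ((t - a) / δ q) (c q) := by
  have hδi : Continuous fun q => (δ q)⁻¹ := hδ.inv₀ hδ0
  convert! ((JointC1.of_contDiff (Y := Unit) hA).comp_affine (π := fun _ : Y => ())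
    continuous_const hδi (β := fun q => -a * (δ q)⁻¹) (by fun_prop)).clm_apply hc using 4 with q t
  rw [sub_div, div_eq_inv_mul, div_eq_mul_inv, neg_mul, sub_eq_add_neg]

theorem ChainCurves.exists_control (hy : ChainCurves f (k + 1) a b y W) (hab : a < b)
    (hf : ∀ i < k + 1, SpatialC1 (Icc a b) (f i))
    (hsurj : ∀ t ∈ Icc a b, ∀ x : State m (k + 1),
      Function.Surjective fun v : Block m (k + 1) => f k t (extend x v))
    (hv₀ : ContDiff ℝ 1 v₀) {x₀ : State m (k + 1)}
    (hB : ∀ i < k + 1, Function.Surjective (lastPartial f a (extend x₀ (v₀ a)) i))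
    (hy₀ : ∀ ξ, y ξ a = x₀) (hW₀ : ∀ ξ, W ξ a = field f (k + 1) a x₀ (v₀ a)) :
    ∃ v : X × Block m (k + 1) → ℝ → Block m (k + 1), JointC1 v ∧ ∀ q, v q b = q.2 ∧
      v q =ᶠ[𝓝 a] v₀ ∧ ∃ x : ℝ → State m (k + 1), x b = y q.1 b ∧
        IsTrajectory f (k + 1) a b x₀ (v q) x := by
  obtain ⟨QU, hQU, hQU0, hQU1, hsteer⟩ :=
    exists_local_steering (P := X × Block m (k + 1)) hf hab.le x₀ hv₀.continuous hB
  obtain ⟨r, hr, hr0, hr1⟩ := (hsteer.and (Ioc_mem_nhdsGT one_pos)).exists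
  obtain ⟨δ, hδ, hδr⟩ := exists_continuous_pos_forall_norm_sub_le hab hr0
    (g := fun ξ t => (y ξ t, W ξ t)) (g₀ := (x₀, field f (k + 1) a x₀ (v₀ a)))
    (hy.continuousOn.prodMk hy.continuousOn_velocity) fun ξ => Prod.ext (hy₀ ξ) (hW₀ ξ)
  choose hδ0 hδr hδb hyW using hδr
  obtain ⟨u, hu, huv, hub, η, hη, hx⟩ := hy.exists_backward_control hab.le hf hsurj hv₀ hδ
    (fun ξ => ⟨hδ0 ξ, (hδr ξ).trans hr1⟩) hδb hr0
  choose hηr x₂ hx₂δ hx₂b hx₂ using hx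
  obtain ⟨c, hc, hx⟩ := hr (hy.comp continuous_fst) (δ := fun q => δ q.1) (by fun_prop)
    (fun q => ⟨hδ0 q.1, hδr q.1⟩) (fun q => (hδb q.1).le)
    (fun q t ht => norm_prod_le_iff.1 (hyW q.1 t ht)) hη hηr
  choose x₁ hx₁a hx₁δ hx₁ using hx
  have hafter : ∀ q : X × Block m (k + 1), ∀ t, a + δ q.1 ≤ t → QU ((t - a) / δ q.1) = 0 :=
    fun q t ht => hQU1 _ ((one_le_div (hδ0 q.1)).2 (by linarith))
  have hbefore : ∀ q : X × Block m (k + 1), ∀ t < a + δ q.1 / 3, QU ((t - a) / δ q.1) = 0 :=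
    fun q t ht => hQU0 _ ((div_lt_iff₀ (hδ0 q.1)).2 (by linarith))
  refine ⟨fun q t => u q t + QU ((t - a) / δ q.1) (c q), hu.add (.rescaled_clm_apply hQU
    (δ := fun q => δ q.1) (by fun_prop) (fun q => (hδ0 q.1).ne') hc a), fun q => ⟨?_, ?_, ?_⟩⟩
  · beta_reduce
    rw [hafter q b (hδb q.1).le, hub, zero_apply, add_zero]
  · filter_upwards [Iio_mem_nhds (show a < a + δ q.1 / 3 by linarith [hδ0 q.1])] with t ht
    rw [mem_Iio] at ht
    rw [hbefore q t ht, huv q t (by linarith [hδ0 q.1]), zero_apply, add_zero]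
  · obtain ⟨x, hxa, hxb, hx⟩ := exists_isIntegralCurveOn_glue
      (F := fun t x => field f (k + 1) t x (u q t + QU ((t - a) / δ q.1) (c q)))
      (c := a + δ q.1) (le_add_of_nonneg_right (hδ0 q.1).le) (hδb q.1).le
      ((hx₁δ q).trans (hx₂δ q).symm)
      (fun t ht => by simpa only [huv q t ht.2] using hx₁ q t ht)
      (fun t ht => by simpa only [hafter q t ht.1, zero_apply, add_zero] using hx₂ q t ht)
    exact ⟨x, hxb.trans (hx₂b q), hxa.trans ((hx₁a q).trans (hy₀ q.1)), hx⟩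

end Control

end TriangularControl

open TriangularControl in
theorem theorem2p2_general {X : Type*} [MetricSpace X] {m : ℕ → ℕ}
    {f : (i : ℕ) → ℝ → State m (i + 2) → Block m i} {t₁ T : ℝ} (hT : t₁ < T) {k : ℕ}
    (hf : ∀ i < k + 1, SpatialC1 (Icc t₁ T) (f i))
    (hsurj : ∀ t ∈ Icc t₁ T, ∀ x : State m (k + 1),
      Function.Surjective fun v : Block m (k + 1) => f k t (extend x v))
    (xs : State m (k + 2)) (z : Block m (k + 1))
    (hrank : ∀ (i : ℕ) (hi : i < k + 1),
      Module.finrank ℝ (LinearMap.range (fderiv ℝ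
        (fun v : Block m (i + 1) => f i t₁ (extend (trunc (r := i + 1) (by omega) xs) v))
        (xs ⟨i + 1, by omega⟩)).toLinearMap) = m i)
    {y : X → ℝ → State m (k + 1)}
    (hy_C1 : ∀ i : Fin (k + 1), ContinuousC1Family t₁ T fun ξ t => y ξ t i)
    (hy_ode : ∀ ξ (i : ℕ) (hi : i + 2 ≤ k + 1), ∀ t ∈ Icc t₁ T,
      HasDerivWithinAt (fun s => y ξ s ⟨i, by omega⟩) (f i t (trunc hi (y ξ t))) (Icc t₁ T) t)
    (hy_start : ∀ ξ, y ξ t₁ = trunc (by omega) xs)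
    (hy_deriv : ∀ ξ,
      HasDerivWithinAt (fun s => y ξ s ⟨k, k.lt_succ_self⟩) (f k t₁ xs) (Icc t₁ T) t₁) :
    ∃ vhat : X × Block m (k + 1) → ℝ → Block m (k + 1), ContinuousC1Family t₁ T vhat ∧
      ∀ ξ β, vhat (ξ, β) T = β ∧ vhat (ξ, β) t₁ = xs ⟨k + 1, (k + 1).lt_succ_self⟩ ∧
        HasDerivWithinAt (vhat (ξ, β)) z (Icc t₁ T) t₁ ∧
        (∃ x, IsTrajectory f (k + 1) t₁ T (trunc (by omega) xs) (vhat (ξ, β)) x) ∧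
        ∀ x, IsTrajectory f (k + 1) t₁ T (trunc (by omega) xs) (vhat (ξ, β)) x → x T = y ξ T := by
  let v₀ : ℝ → Block m (k + 1) := fun t => xs ⟨k + 1, (k + 1).lt_succ_self⟩ + (t - t₁) • z
  have hv₀ : ContDiff ℝ 1 v₀ := by fun_prop
  have hv₀t : v₀ t₁ = xs ⟨k + 1, (k + 1).lt_succ_self⟩ := by simp [v₀]
  have hv₀' : HasDerivAt v₀ z t₁ := by
    have h := (((hasDerivAt_id t₁).sub_const t₁).smul_const z).const_add
      (xs ⟨k + 1, (k + 1).lt_succ_self⟩)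
    rwa [one_smul] at h
  have hxs : extend (trunc (Nat.le_succ _) xs) (v₀ t₁) = xs := hv₀t ▸ extend_trunc le_rfl xs
  have hy := chainCurves_derivWithin hT hy_C1 hy_ode
  have ht₁ : t₁ ∈ Icc t₁ T := left_mem_Icc.2 hT.le
  obtain ⟨v, hv, hvx⟩ := hy.exists_control hT hf hsurj hv₀ (fun i hi => by
    rw [hxs]
    exact surjective_lastPartial (by omega) ((hf i hi).differentiable t₁ ht₁ _) (hrank i hi))
    hy_start fun ξ => by
      have hlast := (hy_deriv ξ).derivWithin (uniqueDiffOn_Icc hT t₁ ht₁)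
      rw [← hy_start ξ, hy.field_eq ξ ht₁, hy_start ξ, hxs, hlast, sub_self, map_zero, add_zero]
  refine ⟨v, hv.continuousC1Family hT, fun ξ β => ?_⟩
  obtain ⟨hvT, hv₁, x, hxT, hx⟩ := hvx (ξ, β)
  refine ⟨hvT, hv₁.eq_of_nhds.trans hv₀t, (hv₀'.congr_of_eventuallyEq hv₁).hasDerivWithinAt,
    ⟨x, hx⟩, fun x' hx' => ?_⟩
  rw [hx'.eqOn (spatialC1_field hf) (hv.differentiable _).continuous.continuousOn hx
    ⟨hT.le, le_rfl⟩, hxT]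

theorem theorem2p2
    -- block dimensions and components of the triangular right-hand side
    (ν : ℕ) (m : ℕ → ℕ) (hm : ∀ i < ν, m i ≤ m (i + 1))
    (f : (i : ℕ) → ℝ → TriangularControl.State m (i + 2) → TriangularControl.Block m i)
    (t₀ t₁ T : ℝ) (ht₁ : t₁ ∈ Ioo t₀ T)
    (hI : TriangularControl.RegularField ν f t₀ T)
    (hII : TriangularControl.SurjectiveBlocks ν f t₀ T)
    -- reference point `x*₁, …, x*_{ν+1} = u*` and reference velocities `z*₁, …, z*_{ν+1}`
    (xs zs : TriangularControl.State m (ν + 1))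
    (hzs : ∀ (i : ℕ) (hi : i < ν),
      zs ⟨i, by omega⟩ = f i t₁ (TriangularControl.trunc (by omega) xs))
    (hrank : ∀ (i : ℕ) (hi : i < ν),
      Module.finrank ℝ (LinearMap.range (fderiv ℝ
        (fun v : TriangularControl.Block m (i + 1) => f i t₁
          (TriangularControl.extend (TriangularControl.trunc (r := i + 1) (by omega) xs) v))
        (xs ⟨i + 1, by omega⟩)).toLinearMap) = m i)
    -- number of blocks of the truncated system
    (p : ℕ) (hp : 1 ≤ p) (hpν : p ≤ ν)
    -- the given family of trajectories
    (y : TriangularControl.State m p → ℝ → TriangularControl.State m p)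
    (hy_C1 : ∀ i : Fin p, TriangularControl.ContinuousC1Family t₁ T (fun ξ t => y ξ t i))
    (hy_ode : ∀ (ξ : TriangularControl.State m p) (i : ℕ) (hi : i + 2 ≤ p), ∀ t ∈ Icc t₁ T,
      HasDerivWithinAt (fun s => y ξ s ⟨i, by omega⟩)
        (f i t (TriangularControl.trunc hi (y ξ t))) (Icc t₁ T) t)
    (hy_start : ∀ ξ, y ξ t₁ = TriangularControl.trunc (by omega) xs)
    (hy_end : ∀ ξ, y ξ T = ξ)
    (hy_deriv : ∀ ξ, HasDerivWithinAt (fun s => y ξ s ⟨p - 1, by omega⟩)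
      (zs ⟨p - 1, by omega⟩) (Icc t₁ T) t₁) :
    ∃ vhat : TriangularControl.State m p × TriangularControl.Block m p →
        ℝ → TriangularControl.Block m p,
      TriangularControl.ContinuousC1Family t₁ T vhat ∧
      ∀ (ξ : TriangularControl.State m p) (β : TriangularControl.Block m p),
        vhat (ξ, β) T = β ∧
        vhat (ξ, β) t₁ = xs ⟨p, by omega⟩ ∧
        HasDerivWithinAt (vhat (ξ, β)) (zs ⟨p, by omega⟩) (Icc t₁ T) t₁ ∧
        (∃ x : ℝ → TriangularControl.State m p,
          TriangularControl.IsTrajectory f p t₁ T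
            (TriangularControl.trunc (by omega) xs) (vhat (ξ, β)) x) ∧
        (∀ x : ℝ → TriangularControl.State m p,
          TriangularControl.IsTrajectory f p t₁ T
            (TriangularControl.trunc (by omega) xs) (vhat (ξ, β)) x → x T = ξ) := by
  obtain ⟨k, rfl⟩ : ∃ k, p = k + 1 := ⟨p - 1, by omega⟩
  have hsub : Icc t₁ T ⊆ Icc t₀ T := Icc_subset_Icc_left ht₁.1.le
  obtain ⟨vhat, hvhat, h⟩ := theorem2p2_general ht₁.2
    (fun i hi => (hI.spatialC1_field.component (by omega)).mono hsub)
    (fun t ht x => (hII k hpν t (hsub ht) x).2)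
    (TriangularControl.trunc (by omega) xs) (zs ⟨k + 1, by omega⟩)
    (fun i hi => hrank i (by omega)) hy_C1 hy_ode hy_start fun ξ => hzs k hpν ▸ hy_deriv ξ
  simp only [hy_end] at h
  exact ⟨vhat, hvhat, h⟩
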